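/- **Setting.** Let $M,k>0$, $\Delta=r^2+k^2r^4-2Mr$, let $r_+$ be the largest real zero of $\Delta$, and $w=\Delta/r^4$. Let $\mathcal M=\mathbb R_{t^\star}\times[r_+,\infty)_r\times\mathbb S^2_{\vartheta,\varphi}$ be the Schwarzschild–AdS exterior and $\mathcal H^+=\{r=r_+\}$; let $t=t^\star-r^\star+k^{-1}\arctan(kr)$ with $\frac{dr^\star}{dr}=\frac{r^2}{\Delta}$ and $r^\star(r=+\infty)=\frac{\pi}{2}$. In the coordinates $(t,r,\vartheta,\varphi)$ put $\partial_{r^\star}=\frac{\Delta}{r^2}\partial_r$, $L=\partial_t+\partial_{r^\star}$, $\underline L=\partial_t-\partial_{r^\star}$. A star denotes complex conjugation. For $n\in\mathbb Z$ let $$\mathcal L_n=\partial_\vartheta+\tfrac{i}{\sin\vartheta}\partial_\varphi+n\cot\vartheta,\qquad \mathcal L_n^\dagger=\partial_\vartheta-\tfrac{i}{\sin\vartheta}\partial_\varphi+n\cot\vartheta,$$ $$-\mathcal L^{[\pm2]}=\tfrac1{\sin\vartheta}\partial_\vartheta(\sin\vartheta\,\partial_\vartheta)+\tfrac1{\sin^2\vartheta}\partial_\varphi^2\pm4i\tfrac{\cos\vartheta}{\sin^2\vartheta}\partial_\varphi-4\cot^2\vartheta-4,\qquad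 \mathcal L=\mathcal L^{[+2]}.$$ All functions live on $\mathcal M\setminus\mathcal H^+$, or on its part $\{t^\star\ge t^\star_0\}$ for some $t_0^\star\in\mathbb R$. With $\tilde Z_1=-\sin\varphi\,\partial_\vartheta+\cos\varphi(-is\csc\vartheta-\cot\vartheta\,\partial_\varphi)$, $\tilde Z_2=-\cos\varphi\,\partial_\vartheta-\sin\varphi(-is\csc\vartheta-\cot\vartheta\,\partial_\varphi)$, $\tilde Z_3=\partial_\varphi$, a smooth spin-$s$-weighted function is a complex-valued function, smooth away from the poles of the spheres and $2\pi$-periodic in $\varphi$, such that, for all its derivatives $f$ by $\partial_{t^\star}$, $\partial_r$ (in the coordinates $(t^\star,r,\vartheta,\varphi)$) and the $\tilde Z_i$, $e^{is\varphi}f$ extends continuously to $\vartheta=0$ and $e^{-is\varphi}f$ to $\vartheta=\pi$. A smooth spin-$s$-weighted function $f$ is regular at the horizon if all $L^p(\Delta^{-1}\underline L)^q\tilde Z_1^{a}\tilde Z_2^{b}\tilde Z_3^{c}f$ extend continuously to $r=r_+$ (as spin-weighted functions, poles included), and regular at infinity if all $(L-\underline L)^p(L+\underline L)^q\tilde Z_1^{a}\tilde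 Z_2^{b}\tilde Z_3^{c}f$ extend continuously to $r=\infty$. Let $S_{m\ell}(\vartheta)e^{im\varphi}$, $\ell\ge2$, $|m|\le\ell$, with $S_{m\ell}$ real, be the orthonormal basis of spin-$(+2)$-weighted spherical harmonics, with signs chosen so that $\mathcal L_{-1}\mathcal L_0\mathcal L_1\mathcal L_2(S_{m\ell}e^{-im\varphi})=(\ell-1)\ell(\ell+1)(\ell+2)\,S_{(-m)\ell}e^{-im\varphi}$; explicitly, $S_{m\ell}e^{im\varphi}=\sqrt{\tfrac{(\ell-2)!}{(\ell+2)!}}\,\mathcal L_{-1}\mathcal L_0Y_{m\ell}$ with $Y_{m\ell}=\sqrt{\tfrac{2\ell+1}{4\pi}\tfrac{(\ell-|m|)!}{(\ell+|m|)!}}\,\sin^{|m|}\vartheta\,P_\ell^{(|m|)}(\cos\vartheta)e^{im\varphi}$, where $P_\ell^{(j)}$ is the $j$-th derivative of the Legendre polynomial $P_\ell$. The functions $S_{m\ell}e^{-im\varphi}$ form the corresponding basis for spin weight $-2$. Let $\mathcal C$ be the operator from spin-$(+2)$- to spin-$(-2)$-weighted functions with $\mathcal C(S_{m\ell}e^{im\varphi})=S_{(-m)\ell}e^{im\varphi}$,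 acting on each sphere, and for $f$ of spin weight $+2$ let $f_s=\frac12f+\frac12(\mathcal Cf)^*$, $f_a=\frac12f-\frac12(\mathcal Cf)^*$. **Corollary.** Let $\Psi^D,\Psi^R$ be two smooth spin-$(+2)$-weighted functions, regular at the horizon and at infinity, which solve the (homogeneous) decoupled Regge–Wheeler problem, that is, $$-L\underline L\Psi-\tfrac{\Delta}{r^4}\Big(\mathcal L-\tfrac{6M}{r}\Big)\Psi=0\quad\text{for }\Psi=\Psi^D\text{ and }\Psi=\Psi^R,$$ $$\Psi^D\to0,\qquad 2\partial_t^2\Psi^R+\tfrac{\mathcal L(\mathcal L-2)}{6M}\partial_{r^\star}\Psi^R+k^2\mathcal L\Psi^R\to0\qquad(r\to+\infty).$$ Define $\Psi^{[\pm2]}$ by $$\Psi^{[+2]}=\tfrac12\Psi^D+\tfrac12\big(\Psi^R-12M\,G\big),\qquad(\Psi^{[-2]})^*=-\tfrac12\Psi^D+\tfrac12\big(\Psi^R-12M\,G\big),$$ where $G=\frac{1}{\mathcal L(\mathcal L-2)}\partial_t\Psi^D$ is the smooth spin-$(+2)$-weighted function with $\mathcal L(\mathcal L-2)G=\partial_t\Psi^D$,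 and let $\widetilde\alpha^{[\pm2]}$ be the reverse Chandrasekhar transformations of $\Psi^{[\pm2]}$: $$\widetilde\alpha^{[+2]}=w^2\big(\mathcal L^{[+2]}(\mathcal L^{[+2]}-2)+12M\partial_t\big)(w^{-1}L)(w^{-1}L)\Psi^{[+2]},$$ $$\widetilde\alpha^{[-2]}=w^2\big(\mathcal L^{[-2]}(\mathcal L^{[-2]}-2)-12M\partial_t\big)(w^{-1}\underline L)(w^{-1}\underline L)\Psi^{[-2]}.$$ If $\Psi^D_s=0$ and $\Psi^R_a=0$, then $\widetilde\alpha^{[\pm2]}$ satisfy the Teukolsky–Starobinsky identities $$w^2(w^{-1}L)^4(\widetilde\alpha^{[-2]})^*=\mathcal L_{-1}\mathcal L_0\mathcal L_1\mathcal L_2(\widetilde\alpha^{[+2]})^*-12M\,\partial_t\widetilde\alpha^{[+2]},$$ $$w^2(w^{-1}\underline L)^4(\widetilde\alpha^{[+2]})^*=\mathcal L_{-1}^\dagger\mathcal L_0^\dagger\mathcal L_1^\dagger\mathcal L_2^\dagger(\widetilde\alpha^{[-2]})^*+12M\,\partial_t\widetilde\alpha^{[-2]}.$$ -/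

import Mathlib

open Filter Topology
open scoped ContDiff

noncomputable section

namespace RWTS

/-! ### The Schwarzschild-AdS exterior in the regular coordinates `(t⋆, r, ϑ, φ)` -/

/-- A coordinate quadruple `(t⋆, r, ϑ, φ)`. -/
abbrev Pt : Type := ℝ × ℝ × ℝ × ℝ

/-- `Δ = r² + k² r⁴ - 2 M r`. -/
def delta (M k r : ℝ) : ℝ := r ^ 2 + k ^ 2 * r ^ 4 - 2 * M * r

/-- `w = Δ / r⁴`. -/
def wt (M k r : ℝ) : ℝ := delta M k r / r ^ 4

/-- The horizon radius `r₊`, the largest real zero of `Δ` (for `k > 0` the set of zeros is finite,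
and it contains `0`). -/
def rPlus (M k : ℝ) : ℝ := sSup {r : ℝ | delta M k r = 0}

/-- The black hole exterior without the horizon, restricted to times `t⋆ ∈ I` and read in the polar
coordinates `0 < ϑ < π`, `φ ∈ ℝ` of the sphere (functions are asked to be `2π`-periodic in `φ`,
and their behaviour at the two poles is prescribed separately). -/
def region (M k : ℝ) (I : Set ℝ) : Set Pt :=
  {p | p.1 ∈ I ∧ rPlus M k < p.2.1 ∧ p.2.2.1 ∈ Set.Ioo 0 Real.pi}

/-! ### Coordinate derivatives on a set `D` of coordinates

`fderivWithin` is used since `D` contains the initial slice when `I = [t₀, ∞)`; for `I = ℝ` the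
set `D` is open and this is the usual derivative. -/

/-- `∂_t`, which is the same as `∂_{t⋆}`. -/
def dT (D : Set Pt) (f : Pt → ℂ) (p : Pt) : ℂ := fderivWithin ℝ f D p (1, 0, 0, 0)

/-- `∂_r` at constant `t⋆`. -/
def dR (D : Set Pt) (f : Pt → ℂ) (p : Pt) : ℂ := fderivWithin ℝ f D p (0, 1, 0, 0)

/-- `∂_ϑ`. -/
def dTh (D : Set Pt) (f : Pt → ℂ) (p : Pt) : ℂ := fderivWithin ℝ f D p (0, 0, 1, 0)

/-- `∂_φ`. -/
def dPh (D : Set Pt) (f : Pt → ℂ) (p : Pt) : ℂ := fderivWithin ℝ f D p (0, 0, 0, 1)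

/-- `∂_r` at constant `t`. As `t⋆ = t + r⋆ - k⁻¹ arctan (k r)` with `dr⋆/dr = r²/Δ`, the chain rule
gives `∂_r|_t = ∂_r|_{t⋆} + (r²/Δ - 1/(1 + k²r²)) ∂_{t⋆}`. -/
def dRt (M k : ℝ) (D : Set Pt) (f : Pt → ℂ) (p : Pt) : ℂ :=
  dR D f p + ((p.2.1 ^ 2 / delta M k p.2.1 - 1 / (1 + k ^ 2 * p.2.1 ^ 2) : ℝ) : ℂ) * dT D f p

/-- `∂_{r⋆} = (Δ/r²) ∂_r` in the coordinates `(t, r, ϑ, φ)`. -/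
def dRstar (M k : ℝ) (D : Set Pt) (f : Pt → ℂ) (p : Pt) : ℂ :=
  ((delta M k p.2.1 / p.2.1 ^ 2 : ℝ) : ℂ) * dRt M k D f p

/-- `L = ∂_t + (Δ/r²) ∂_r`. -/
def opL (M k : ℝ) (D : Set Pt) (f : Pt → ℂ) (p : Pt) : ℂ := dT D f p + dRstar M k D f p

/-- `L̲ = ∂_t - (Δ/r²) ∂_r`. -/
def opLbar (M k : ℝ) (D : Set Pt) (f : Pt → ℂ) (p : Pt) : ℂ := dT D f p - dRstar M k D f p

/-- `w⁻¹ L`. -/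
def winvL (M k : ℝ) (D : Set Pt) (f : Pt → ℂ) (p : Pt) : ℂ :=
  ((wt M k p.2.1)⁻¹ : ℝ) * opL M k D f p

/-- `w⁻¹ L̲`. -/
def winvLbar (M k : ℝ) (D : Set Pt) (f : Pt → ℂ) (p : Pt) : ℂ :=
  ((wt M k p.2.1)⁻¹ : ℝ) * opLbar M k D f p

/-- Pointwise complex conjugation of a function. -/
def conjF (f : Pt → ℂ) (p : Pt) : ℂ := (starRingEnd ℂ) (f p)

/-! ### Angular operators -/

/-- The operator `𝓛^{[s]}`, `s = ±2`:
`-𝓛^{[s]} = (1/sin ϑ) ∂_ϑ (sin ϑ ∂_ϑ) + (1/sin² ϑ) ∂_φ² + 2 s i (cos ϑ/sin² ϑ) ∂_φ - 4 cot² ϑ - 4`. -/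
def angL (s : ℤ) (D : Set Pt) (f : Pt → ℂ) (p : Pt) : ℂ :=
  -((1 / Real.sin p.2.2.1 : ℝ) * dTh D (fun q => (Real.sin q.2.2.1 : ℂ) * dTh D f q) p
    + (1 / Real.sin p.2.2.1 ^ 2 : ℝ) * dPh D (dPh D f) p
    + 2 * (s : ℂ) * Complex.I * (Real.cos p.2.2.1 / Real.sin p.2.2.1 ^ 2 : ℝ) * dPh D f p
    - 4 * ((Real.cos p.2.2.1 / Real.sin p.2.2.1) ^ 2 : ℝ) * f p
    - 4 * f p)

/-- `𝓛^{[s]} (𝓛^{[s]} - 2)`. -/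
def angLL (s : ℤ) (D : Set Pt) (f : Pt → ℂ) : Pt → ℂ :=
  angL s D (fun p => angL s D f p - 2 * f p)

/-- `𝓛_n = ∂_ϑ + (i/sin ϑ) ∂_φ + n cot ϑ`. -/
def edth (n : ℤ) (D : Set Pt) (f : Pt → ℂ) (p : Pt) : ℂ :=
  dTh D f p + Complex.I * (1 / Real.sin p.2.2.1 : ℝ) * dPh D f p
    + (n : ℂ) * (Real.cos p.2.2.1 / Real.sin p.2.2.1 : ℝ) * f p

/-- `𝓛_n^† = ∂_ϑ - (i/sin ϑ) ∂_φ + n cot ϑ`. -/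
def edthDag (n : ℤ) (D : Set Pt) (f : Pt → ℂ) (p : Pt) : ℂ :=
  dTh D f p - Complex.I * (1 / Real.sin p.2.2.1 : ℝ) * dPh D f p
    + (n : ℂ) * (Real.cos p.2.2.1 / Real.sin p.2.2.1 : ℝ) * f p

/-! ### Smooth spin-weighted functions and their regularity -/

/-- The spin-`s` angular momentum operator `Z̃₁ = -sin φ ∂_ϑ + cos φ (-i s csc ϑ - cot ϑ ∂_φ)`. -/
def Z1 (s : ℤ) (D : Set Pt) (f : Pt → ℂ) (p : Pt) : ℂ :=
  -(Real.sin p.2.2.2 : ℂ) * dTh D f p + (Real.cos p.2.2.2 : ℂ) *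
    (-Complex.I * (s : ℂ) * (1 / Real.sin p.2.2.1 : ℝ) * f p
      - (Real.cos p.2.2.1 / Real.sin p.2.2.1 : ℝ) * dPh D f p)

/-- The spin-`s` angular momentum operator `Z̃₂ = -cos φ ∂_ϑ - sin φ (-i s csc ϑ - cot ϑ ∂_φ)`. -/
def Z2 (s : ℤ) (D : Set Pt) (f : Pt → ℂ) (p : Pt) : ℂ :=
  -(Real.cos p.2.2.2 : ℂ) * dTh D f p - (Real.sin p.2.2.2 : ℂ) *
    (-Complex.I * (s : ℂ) * (1 / Real.sin p.2.2.1 : ℝ) * f p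
      - (Real.cos p.2.2.1 / Real.sin p.2.2.1 : ℝ) * dPh D f p)

/-- `Z̃₁^a Z̃₂^b Z̃₃^c f`, where `Z̃₃ = ∂_φ`. -/
def Zs (s : ℤ) (D : Set Pt) (a b c : ℕ) (f : Pt → ℂ) : Pt → ℂ :=
  (Z1 s D)^[a] ((Z2 s D)^[b] ((dPh D)^[c] f))

/-- Continuous extension of a spin-`s`-weighted quantity to the poles of the sphere: `e^{isφ} f` has
a limit at `ϑ = 0` and `e^{-isφ} f` has a limit at `ϑ = π`, where the time and the radius tend along
the filters `lt`, `lr`. The limits are uniform in `φ` and do not depend on it. -/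
def PoleLimits (s : ℤ) (lt lr : Filter ℝ) (f : Pt → ℂ) : Prop :=
  (∃ c : ℂ, Tendsto (fun p : Pt => Complex.exp (Complex.I * s * (p.2.2.2 : ℂ)) * f p)
    (lt ×ˢ lr ×ˢ 𝓝[>] (0 : ℝ) ×ˢ (⊤ : Filter ℝ)) (𝓝 c)) ∧
  (∃ c : ℂ, Tendsto (fun p : Pt => Complex.exp (-(Complex.I * s * (p.2.2.2 : ℂ))) * f p)
    (lt ×ˢ lr ×ˢ 𝓝[<] Real.pi ×ˢ (⊤ : Filter ℝ)) (𝓝 c))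

/-- A spin-`s`-weighted quantity extends continuously to the boundary hypersurface which is
approached when `r` tends along the filter `lr` (`r ↓ r₊` for the future event horizon, `r → ∞` for
the conformal boundary), on the whole sphere and for all times of `I`. -/
def ExtendsTo (s : ℤ) (I : Set ℝ) (lr : Filter ℝ) (f : Pt → ℂ) : Prop :=
  ∀ t ∈ I,
    (∀ θ ∈ Set.Ioo 0 Real.pi, ∀ φ : ℝ,
      ∃ c : ℂ, Tendsto f (𝓝[I] t ×ˢ lr ×ˢ 𝓝 θ ×ˢ 𝓝 φ) (𝓝 c)) ∧
    PoleLimits s (𝓝[I] t) lr f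

/-- Smooth spin-`s`-weighted complex-valued functions on the exterior without the horizon, for times
in `I`: smooth away from the poles, `2π`-periodic in `φ`, and all derivatives by `∂_{t⋆}`, `∂_r` and
the spin-weighted angular momentum operators extend continuously to the poles. -/
structure IsSmoothSpin (M k : ℝ) (I : Set ℝ) (s : ℤ) (f : Pt → ℂ) : Prop where
  smooth : ContDiffOn ℝ ∞ f (region M k I)
  periodic : ∀ t r θ φ : ℝ, (t, r, θ, φ) ∈ region M k I →
    f (t, r, θ, φ + 2 * Real.pi) = f (t, r, θ, φ)
  poles : ∀ i j a b c : ℕ, ∀ t ∈ I, ∀ r, rPlus M k < r →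
    PoleLimits s (𝓝[I] t) (𝓝 r)
      ((dT (region M k I))^[i] ((dR (region M k I))^[j] (Zs s (region M k I) a b c f)))

/-- Regularity at the future event horizon `r = r₊`: all `L^p (Δ⁻¹ L̲)^q Z̃₁^a Z̃₂^b Z̃₃^c f` extend
continuously to it. -/
def RegularAtHorizon (M k : ℝ) (I : Set ℝ) (s : ℤ) (f : Pt → ℂ) : Prop :=
  ∀ p q a b c : ℕ, ExtendsTo s I (𝓝[>] (rPlus M k))
    ((opL M k (region M k I))^[p]
      ((fun g x => ((delta M k x.2.1)⁻¹ : ℝ) * opLbar M k (region M k I) g x)^[q]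
        (Zs s (region M k I) a b c f)))

/-- Regularity at the conformal boundary `r = ∞`: all
`(L - L̲)^p (L + L̲)^q Z̃₁^a Z̃₂^b Z̃₃^c f` extend continuously to it. -/
def RegularAtInfinity (M k : ℝ) (I : Set ℝ) (s : ℤ) (f : Pt → ℂ) : Prop :=
  ∀ p q a b c : ℕ, ExtendsTo s I atTop
    ((fun g x => opL M k (region M k I) g x - opLbar M k (region M k I) g x)^[p]
      ((fun g x => opL M k (region M k I) g x + opLbar M k (region M k I) g x)^[q]
        (Zs s (region M k I) a b c f)))

/-- `f → 0` as `r → ∞` at fixed `(t⋆, ϑ, φ)`. -/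
def VanishesAtInfinity (I : Set ℝ) (f : Pt → ℂ) : Prop :=
  ∀ t ∈ I, ∀ θ ∈ Set.Ioo 0 Real.pi, ∀ φ : ℝ,
    Tendsto (fun r : ℝ => f (t, r, θ, φ)) atTop (𝓝 0)

/-! ### The decoupled Regge-Wheeler problem -/

/-- The Regge-Wheeler operator
`R^{[s]} Ψ = - L L̲ Ψ - (Δ/r⁴) (𝓛^{[s]} - 6M/r) Ψ`. -/
def reggeWheeler (M k : ℝ) (s : ℤ) (D : Set Pt) (f : Pt → ℂ) (p : Pt) : ℂ :=
  -opL M k D (opLbar M k D f) p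
    - (delta M k p.2.1 / p.2.1 ^ 4 : ℝ) * (angL s D f p - (6 * M / p.2.1 : ℝ) * f p)

/-- `(Ψ^D, Ψ^R)` is a solution of the (homogeneous) decoupled Regge-Wheeler problem for times in
`I`: both are smooth spin-`+2`-weighted functions, regular at the horizon and at infinity, satisfy
the Regge-Wheeler equation, and satisfy at infinity the Dirichlet condition `Ψ^D → 0` and the
Robin condition `2 ∂_t² Ψ^R + (6M)⁻¹ 𝓛(𝓛-2) ∂_{r⋆} Ψ^R + k² 𝓛 Ψ^R → 0`. -/
structure IsDecoupledRWSolution (M k : ℝ) (I : Set ℝ) (ΨD ΨR : Pt → ℂ) : Prop where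
  spinD : IsSmoothSpin M k I 2 ΨD
  spinR : IsSmoothSpin M k I 2 ΨR
  eqD : ∀ p ∈ region M k I, reggeWheeler M k 2 (region M k I) ΨD p = 0
  eqR : ∀ p ∈ region M k I, reggeWheeler M k 2 (region M k I) ΨR p = 0
  infinityD : RegularAtInfinity M k I 2 ΨD
  infinityR : RegularAtInfinity M k I 2 ΨR
  horizonD : RegularAtHorizon M k I 2 ΨD
  horizonR : RegularAtHorizon M k I 2 ΨR
  dirichlet : VanishesAtInfinity I ΨD
  robin : VanishesAtInfinity I (fun p =>
    2 * dT (region M k I) (dT (region M k I) ΨR) p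
      + (1 / (6 * M) : ℝ) * angLL 2 (region M k I) (dRstar M k (region M k I) ΨR) p
      + (k ^ 2 : ℝ) * angL 2 (region M k I) ΨR p)

/-- `G = (𝓛(𝓛-2))⁻¹ F` on spin-`+2`-weighted functions: `G` is the smooth spin-`+2`-weighted function
with `𝓛(𝓛-2) G = F`, where `𝓛 = 𝓛^{[+2]}`. -/
def IsInverseLL (M k : ℝ) (I : Set ℝ) (F G : Pt → ℂ) : Prop :=
  IsSmoothSpin M k I 2 G ∧ ∀ p ∈ region M k I, angLL 2 (region M k I) G p = F p

/-- `Ψ^{[+2]} = ½ Ψ^D + ½ (Ψ^R - 12 M G)`, to be used with `G = (𝓛(𝓛-2))⁻¹ ∂_t Ψ^D`. -/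
def psiPlus (M : ℝ) (ΨD ΨR G : Pt → ℂ) (p : Pt) : ℂ :=
  1 / 2 * ΨD p + 1 / 2 * (ΨR p - 12 * (M : ℂ) * G p)

/-- `Ψ^{[-2]}`, given by `(Ψ^{[-2]})^* = - ½ Ψ^D + ½ (Ψ^R - 12 M G)`, to be used with
`G = (𝓛(𝓛-2))⁻¹ ∂_t Ψ^D`. -/
def psiMinus (M : ℝ) (ΨD ΨR G : Pt → ℂ) : Pt → ℂ :=
  conjF (fun p => -(1 / 2) * ΨD p + 1 / 2 * (ΨR p - 12 * (M : ℂ) * G p))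

/-! ### Reverse Chandrasekhar transformations and Teukolsky-Starobinsky identities -/

/-- `α̃^{[+2],r} = w² (𝓛^{[+2]}(𝓛^{[+2]} - 2) + 12 M ∂_t) (w⁻¹L) ψ^{[+2],r}`, with
`ψ^{[+2],r} = w⁻¹ L Ψ^{[+2]}`. -/
def revChandraPlus (M k : ℝ) (D : Set Pt) (Ψ : Pt → ℂ) (p : Pt) : ℂ :=
  (wt M k p.2.1 ^ 2 : ℝ) *
    (angLL 2 D (winvL M k D (winvL M k D Ψ)) p
      + 12 * (M : ℂ) * dT D (winvL M k D (winvL M k D Ψ)) p)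

/-- `α̃^{[-2],r} = w² (𝓛^{[-2]}(𝓛^{[-2]} - 2) - 12 M ∂_t) (w⁻¹L̲) ψ^{[-2],r}`, with
`ψ^{[-2],r} = w⁻¹ L̲ Ψ^{[-2]}`. -/
def revChandraMinus (M k : ℝ) (D : Set Pt) (Ψ : Pt → ℂ) (p : Pt) : ℂ :=
  (wt M k p.2.1 ^ 2 : ℝ) *
    (angLL (-2) D (winvLbar M k D (winvLbar M k D Ψ)) p
      - 12 * (M : ℂ) * dT D (winvLbar M k D (winvLbar M k D Ψ)) p)

/-- The Teukolsky-Starobinsky identities for the pair `(α̃^{[+2]}, α̃^{[-2]})`: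
`w² (w⁻¹L)⁴ (α̃^{[-2]})^* = 𝓛_{-1} 𝓛_0 𝓛_1 𝓛_2 (α̃^{[+2]})^* - 12 M ∂_t α̃^{[+2]}` and
`w² (w⁻¹L̲)⁴ (α̃^{[+2]})^* = 𝓛_{-1}^† 𝓛_0^† 𝓛_1^† 𝓛_2^† (α̃^{[-2]})^* + 12 M ∂_t α̃^{[-2]}`. -/
def TeukolskyStarobinsky (M k : ℝ) (D : Set Pt) (αp αm : Pt → ℂ) : Prop :=
  ∀ p ∈ D,
    (wt M k p.2.1 ^ 2 : ℝ) * (winvL M k D)^[4] (conjF αm) p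
      = edth (-1) D (edth 0 D (edth 1 D (edth 2 D (conjF αp)))) p - 12 * (M : ℂ) * dT D αp p ∧
    (wt M k p.2.1 ^ 2 : ℝ) * (winvLbar M k D)^[4] (conjF αp) p
      = edthDag (-1) D (edthDag 0 D (edthDag 1 D (edthDag 2 D (conjF αm)))) p
        + 12 * (M : ℂ) * dT D αm p

/-! ### The Hilbert basis of spin-weighted spherical harmonics and the conjugacy operator -/

/-- The Legendre polynomial `P_ℓ`, by Rodrigues' formula. -/
def legendre (ℓ : ℕ) : Polynomial ℝ :=
  Polynomial.C (1 / (2 ^ ℓ * (Nat.factorial ℓ : ℝ))) *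
    Polynomial.derivative^[ℓ] ((Polynomial.X ^ 2 - 1) ^ ℓ)

/-- The associated Legendre function `sin^j ϑ · P_ℓ^{(j)}(cos ϑ)`, without the sign `(-1)^j`. -/
def assocLegendre (ℓ j : ℕ) (θ : ℝ) : ℝ :=
  Real.sin θ ^ j * (Polynomial.derivative^[j] (legendre ℓ)).eval (Real.cos θ)

/-- The action of `𝓛_n` on the `m`-th azimuthal mode: `𝓛_n (g(ϑ) e^{imφ}) = (edthMode n m g)(ϑ) e^{imφ}`. -/
def edthMode (n m : ℤ) (g : ℝ → ℝ) (θ : ℝ) : ℝ :=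
  deriv g θ - m / Real.sin θ * g θ + n * (Real.cos θ / Real.sin θ) * g θ

/-- The real functions `S_{mℓ}(ϑ)`, `ℓ ≥ 2`, `|m| ≤ ℓ`, for which `S_{mℓ}(ϑ) e^{imφ}` is the
orthonormal basis of spin-`+2`-weighted spherical harmonics. They are obtained by raising the spin
of the scalar harmonics twice: `S_{mℓ} e^{imφ} = ((ℓ-2)!/(ℓ+2)!)^{1/2} 𝓛_{-1} 𝓛_0 Y_{mℓ}`, with the scalar
harmonics normalised by `∫ |Y_{mℓ}|² = 1` and `Y_{(-m)ℓ} = (Y_{mℓ})^*`. With this choice of signs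
`𝓛_{-1} 𝓛_0 𝓛_1 𝓛_2 (S_{mℓ} e^{-imφ}) = (ℓ-1) ℓ (ℓ+1) (ℓ+2) S_{(-m)ℓ} e^{-imφ}`. -/
def spinS (m : ℤ) (ℓ : ℕ) (θ : ℝ) : ℝ :=
  Real.sqrt ((2 * ℓ + 1) / (4 * Real.pi)
      * ((Nat.factorial (ℓ - m.natAbs) : ℝ) / (Nat.factorial (ℓ + m.natAbs) : ℝ))
      * ((Nat.factorial (ℓ - 2) : ℝ) / (Nat.factorial (ℓ + 2) : ℝ)))
    * edthMode (-1) m (edthMode 0 m (assocLegendre ℓ m.natAbs)) θ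

/-- The coefficient of `f(t⋆, r, ·)`, of spin weight `+2`, on the basis element `S_{mℓ}(ϑ) e^{imφ}`. -/
def coeffPlus (f : Pt → ℂ) (t r : ℝ) (m : ℤ) (ℓ : ℕ) : ℂ :=
  ∫ θ in (0 : ℝ)..Real.pi, ∫ φ in (0 : ℝ)..(2 * Real.pi),
    f (t, r, θ, φ) * ((spinS m ℓ θ : ℂ) * Complex.exp (-(Complex.I * m * (φ : ℂ))))
      * (Real.sin θ : ℂ)

/-- The coefficient of `f(t⋆, r, ·)`, of spin weight `-2`, on the basis element `S_{mℓ}(ϑ) e^{-imφ}`. -/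
def coeffMinus (f : Pt → ℂ) (t r : ℝ) (m : ℤ) (ℓ : ℕ) : ℂ :=
  ∫ θ in (0 : ℝ)..Real.pi, ∫ φ in (0 : ℝ)..(2 * Real.pi),
    f (t, r, θ, φ) * ((spinS m ℓ θ : ℂ) * Complex.exp (Complex.I * m * (φ : ℂ)))
      * (Real.sin θ : ℂ)

/-- `g = 𝓒 f`, where `𝓒` is the conjugacy operator from spin-`+2` to spin-`-2`-weighted functions,
`𝓒 (S_{mℓ}(ϑ) e^{imφ}) = S_{(-m)ℓ}(ϑ) e^{imφ}`, on each sphere of constant `(t⋆, r)`. The coefficient of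
`f` on `S_{mℓ} e^{imφ}` thus becomes the coefficient of `g` on the spin-`-2` basis element of
index `-m`. -/
def IsConjugacy (M k : ℝ) (I : Set ℝ) (f g : Pt → ℂ) : Prop :=
  IsSmoothSpin M k I (-2) g ∧
    ∀ t ∈ I, ∀ r, rPlus M k < r → ∀ (ℓ : ℕ) (m : ℤ), 2 ≤ ℓ → m.natAbs ≤ ℓ →
      coeffMinus g t r (-m) ℓ = coeffPlus f t r m ℓ

/-- `f_s = ½ f + ½ (𝓒 f)^*` vanishes identically. -/
def SymPartVanishes (M k : ℝ) (I : Set ℝ) (f : Pt → ℂ) : Prop :=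
  ∃ g : Pt → ℂ, IsConjugacy M k I f g ∧
    ∀ p ∈ region M k I, 1 / 2 * f p + 1 / 2 * conjF g p = 0

/-- `f_a = ½ f - ½ (𝓒 f)^*` vanishes identically. -/
def AntiPartVanishes (M k : ℝ) (I : Set ℝ) (f : Pt → ℂ) : Prop :=
  ∃ g : Pt → ℂ, IsConjugacy M k I f g ∧
    ∀ p ∈ region M k I, 1 / 2 * f p - 1 / 2 * conjF g p = 0

end RWTS

end

noncomputable section

set_option autoImplicit false
set_option linter.unusedSimpArgs false
set_option linter.unusedSectionVars false

namespace RWTS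

/-! ### The algebra of smooth functions on a set of coordinates -/

/-! Write T for ∂_t, Λ for 𝓛(𝓛-2) and K f = 𝓛_{-1} 𝓛_0 𝓛_1 𝓛_2 (f^*), all on spin weight +2; K is
`edConj`. Put Ψ = Ψ^{[+2]} and Φ = (Ψ^{[-2]})^*. The operators T, Λ, K, the weight w and w⁻¹L, w⁻¹L̲
commute wherever this is needed, because radial functions and time do not see the angles and
everything but the spin operators is real.

The analytic identity is `chandrasekhar_inversion`: on Regge-Wheeler solutions, (w⁻¹L)² w² (w⁻¹L̲)²
= Λ + 12M T, and with L, L̲ exchanged the sign of 12M T changes. Since (α̃^{[-2]})^* = w² (w⁻¹L̲)²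
(Λ - 12M T) Φ, the left side of the first identity is w² (w⁻¹L)² (Λ + 12M T)(Λ - 12M T) Φ. The right
side is w² (w⁻¹L)² (Λ + 12M T)(K - 12M T) Ψ. So KΨ - ΛΦ = 12M T(Ψ - Φ) suffices, and the mirrored
relation gives the second identity (`starobinsky_identity`).

That relation comes from the symmetries. On spin weight 2, Λ = 𝓛_{-1} 𝓛_0 𝓛_1^† 𝓛_2^†
(`lapLap_two_eq`). Lowering both spins to 0 turns the nonlocal operator 𝓒 into the identity: 𝓛_1 𝓛_2
(𝓒 f) = 𝓛_1^† 𝓛_2^† f (`ed_ed_eq_dg_dg_of_isConjugacy`). This is proved by integrating the harmonic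
coefficients by parts and using completeness of Fourier modes and associated Legendre functions.
Hence f_s = 0 gives K f = -Λ f, and f_a = 0 gives K f = Λ f. Moreover Λ is injective on smooth
spin-2 functions, as 𝓛 ≥ 6 there, so G inherits from Ψ^D both K G = -Λ G and the wave equation. The
G-terms of KΨ - ΛΦ then add up to 12M Λ G = 12M T Ψ^D = 12M T(Ψ - Φ), while all others cancel.

To make such computations algebraic, functions are replaced by elements of the commutative algebra
`SmoothFn D`, on which coordinate derivatives are commuting derivations; `Rep` carries statements
back and forth. -/

/-- Sets on which iterated `fderivWithin` behaves like the usual derivative. -/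
class SmoothDomain (D : Set Pt) : Prop where
  uniqueDiff : UniqueDiffOn ℝ D
  dense : D ⊆ closure (interior D)

/-- Extension by zero of a function on `D`. -/
def extendZero {D : Set Pt} (f : D → ℂ) (p : Pt) : ℂ := by
  classical exact if h : p ∈ D then f ⟨p, h⟩ else 0

theorem extendZero_of_mem {D : Set Pt} (f : D → ℂ) {p : Pt} (h : p ∈ D) :
    extendZero f p = f ⟨p, h⟩ := by
  simp [extendZero, h]

/-- Smooth complex-valued functions on `D`. -/
def SmoothFn (D : Set Pt) : Subalgebra ℂ (D → ℂ) where
  carrier := {f | ContDiffOn ℝ ∞ (extendZero f) D}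
  mul_mem' := by
    intro f g hf hg
    exact (ContDiffOn.mul hf hg).congr fun p hp => by simp [extendZero_of_mem _ hp]
  add_mem' := by
    intro f g hf hg
    exact (ContDiffOn.add hf hg).congr fun p hp => by simp [extendZero_of_mem _ hp]
  algebraMap_mem' := by
    intro c
    exact (contDiffOn_const (c := c)).congr fun p hp => by simp [extendZero_of_mem _ hp]

namespace SmoothFn

variable {D : Set Pt}

/-- A smooth function on `D` as a function on all coordinates, with junk value `0` off `D`. -/
def toFun (f : SmoothFn D) : Pt → ℂ := extendZero f.1

instance : CoeFun (SmoothFn D) (fun _ => Pt → ℂ) := ⟨toFun⟩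

theorem smooth (f : SmoothFn D) : ContDiffOn ℝ ∞ f D := f.2

theorem ext_on {f g : SmoothFn D} (h : ∀ p ∈ D, f p = g p) : f = g := by
  apply Subtype.ext
  funext ⟨p, hp⟩
  simpa [toFun, extendZero_of_mem _ hp] using h p hp

/-- The class of a function which is smooth on `D`. -/
def ofFun (g : Pt → ℂ) (hg : ContDiffOn ℝ ∞ g D) : SmoothFn D :=
  ⟨fun p => g p, hg.congr fun p hp => by simp [extendZero_of_mem _ hp]⟩

theorem ofFun_apply (g : Pt → ℂ) (hg : ContDiffOn ℝ ∞ g D) {p : Pt} (hp : p ∈ D) :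
    ofFun g hg p = g p := by
  simp [ofFun, toFun, extendZero_of_mem _ hp]

theorem add_apply (f g : SmoothFn D) {p : Pt} (hp : p ∈ D) : (f + g) p = f p + g p := by
  simp [toFun, extendZero_of_mem _ hp]

theorem mul_apply (f g : SmoothFn D) {p : Pt} (hp : p ∈ D) : (f * g) p = f p * g p := by
  simp [toFun, extendZero_of_mem _ hp]

theorem sub_apply (f g : SmoothFn D) {p : Pt} (hp : p ∈ D) : (f - g) p = f p - g p := by
  simp [toFun, extendZero_of_mem _ hp]

theorem neg_apply (f : SmoothFn D) {p : Pt} (hp : p ∈ D) : (-f) p = -f p := by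
  simp [toFun, extendZero_of_mem _ hp]

theorem smul_apply (c : ℂ) (f : SmoothFn D) {p : Pt} (hp : p ∈ D) : (c • f) p = c * f p := by
  simp [toFun, extendZero_of_mem _ hp]

theorem pow_apply (f : SmoothFn D) (n : ℕ) {p : Pt} (hp : p ∈ D) : (f ^ n) p = f p ^ n := by
  simp [toFun, extendZero_of_mem _ hp]

theorem algebraMap_apply (c : ℂ) {p : Pt} (hp : p ∈ D) :
    (algebraMap ℂ (SmoothFn D) c) p = c := by
  simp [toFun, extendZero_of_mem _ hp]

theorem zero_apply (p : Pt) : (0 : SmoothFn D) p = 0 := by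
  simp [toFun, extendZero]

theorem one_apply {p : Pt} (hp : p ∈ D) : (1 : SmoothFn D) p = 1 := by
  simp [toFun, extendZero_of_mem _ hp]

theorem ofNat_apply (n : ℕ) [n.AtLeastTwo] {p : Pt} (hp : p ∈ D) :
    (OfNat.ofNat n : SmoothFn D) p = OfNat.ofNat n := by
  have h := algebraMap_apply (D := D) (OfNat.ofNat n) hp
  rwa [map_ofNat] at h

theorem intCast_apply (n : ℤ) {p : Pt} (hp : p ∈ D) : (n : SmoothFn D) p = n := by
  have := algebraMap_apply (D := D) (n : ℂ) hp
  simpa using this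

theorem differentiableWithinAt (f : SmoothFn D) {p : Pt} (hp : p ∈ D) :
    DifferentiableWithinAt ℝ f D p :=
  ((smooth f).differentiableOn (by simp)) p hp

theorem contDiffOn_fderivWithin_apply [hD : SmoothDomain D] (f : SmoothFn D) (v : Pt) :
    ContDiffOn ℝ ∞ (fun p => fderivWithin ℝ f D p v) D :=
  ((smooth f).fderivWithin hD.uniqueDiff (m := ∞) (by simp)).clm_apply contDiffOn_const

/-- The derivative in the direction `v`. -/
def pd [hD : SmoothDomain D] (v : Pt) : Derivation ℂ (SmoothFn D) (SmoothFn D) :=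
  Derivation.mk'
    { toFun := fun f => ofFun _ (contDiffOn_fderivWithin_apply f v)
      map_add' := by
        intro f g
        apply ext_on
        intro p hp
        rw [ofFun_apply _ _ hp, add_apply _ _ hp, ofFun_apply _ _ hp, ofFun_apply _ _ hp,
          fderivWithin_congr (f₁ := (f + g : SmoothFn D)) (f := fun q => f q + g q)
            (fun q hq => add_apply f g hq) (add_apply f g hp),
          fderivWithin_fun_add (hD.uniqueDiff p hp) (SmoothFn.differentiableWithinAt f hp)
            (SmoothFn.differentiableWithinAt g hp)]
        rfl
      map_smul' := by
        intro c f
        apply ext_on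
        intro p hp
        rw [ofFun_apply _ _ hp, RingHom.id_apply, smul_apply _ _ hp, ofFun_apply _ _ hp,
          fderivWithin_congr (f₁ := (c • f : SmoothFn D)) (f := fun q => c * f q)
            (fun q hq => smul_apply c f hq) (smul_apply c f hp),
          fderivWithin_const_mul (hD.uniqueDiff p hp) (SmoothFn.differentiableWithinAt f hp)]
        rfl }
    (by
      intro f g
      apply ext_on
      intro p hp
      simp only [LinearMap.coe_mk, AddHom.coe_mk, smul_eq_mul]
      rw [ofFun_apply _ _ hp, add_apply _ _ hp, mul_apply _ _ hp, mul_apply _ _ hp,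
        ofFun_apply _ _ hp, ofFun_apply _ _ hp,
        fderivWithin_congr (f₁ := (f * g : SmoothFn D)) (f := fun q => f q * g q)
            (fun q hq => mul_apply f g hq) (mul_apply f g hp),
        fderivWithin_fun_mul (hD.uniqueDiff p hp) (SmoothFn.differentiableWithinAt f hp)
            (SmoothFn.differentiableWithinAt g hp)]
      simp)

theorem pd_apply [SmoothDomain D] (v : Pt) (f : SmoothFn D) {p : Pt} (hp : p ∈ D) :
    pd v f p = fderivWithin ℝ f D p v :=
  ofFun_apply _ _ hp

/-- Symmetry of the second derivative holds on the initial slice too, since `D` lies in the closure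
of its interior. -/
theorem pd_comm [hD : SmoothDomain D] (u v : Pt) (f : SmoothFn D) :
    pd u (pd v f) = pd v (pd u f) := by
  have key : ∀ a b : Pt, ∀ p ∈ D, pd a (pd b f) p
      = fderivWithin ℝ (fderivWithin ℝ f D) D p a b := by
    intro a b p hp
    rw [pd_apply _ _ hp, fderivWithin_congr (f₁ := pd b f)
      (f := fun q => fderivWithin ℝ f D q b) (fun q hq => pd_apply b f hq) (pd_apply b f hp),
      fderivWithin_clm_apply (hD.uniqueDiff p hp)
        ((((smooth f).fderivWithin hD.uniqueDiff (m := ∞) (by simp)).differentiableOn (by simp)) p hp)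
        (differentiableWithinAt_const _)]
    simp
  apply ext_on
  intro p hp
  rw [key u v p hp, key v u p hp]
  exact (ContDiffWithinAt.isSymmSndFDerivWithinAt (n := ∞) ((smooth f) p hp) (by simp; exact WithTop.coe_le_coe.2 le_top)
    hD.uniqueDiff (hD.dense hp) hp) u v

theorem pd_ofFun [hD : SmoothDomain D] (v : Pt) (g : Pt → ℂ) (hg : ContDiffOn ℝ ∞ g D) {p : Pt}
    (hp : p ∈ D) : pd v (ofFun g hg) p = fderivWithin ℝ g D p v := by
  rw [pd_apply _ _ hp, fderivWithin_congr (fun q hq => ofFun_apply g hg hq) (ofFun_apply g hg hp)]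

theorem contDiffOn_conj (f : SmoothFn D) :
    ContDiffOn ℝ ∞ (fun p => (starRingEnd ℂ) (f p)) D :=
  Complex.conjCLE.contDiff.comp_contDiffOn (smooth f)

/-- Complex conjugation. -/
def conj : SmoothFn D →+* SmoothFn D where
  toFun f := ofFun (fun p => (starRingEnd ℂ) (f p)) (contDiffOn_conj f)
  map_one' := ext_on fun p hp => by rw [ofFun_apply _ _ hp, one_apply hp, map_one]
  map_mul' f g := ext_on fun p hp => by
    simp only [ofFun_apply _ _ hp, mul_apply _ _ hp, map_mul]
  map_zero' := ext_on fun p hp => by simp only [ofFun_apply _ _ hp, zero_apply, map_zero]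
  map_add' f g := ext_on fun p hp => by
    simp only [ofFun_apply _ _ hp, add_apply _ _ hp, map_add]

theorem conj_apply (f : SmoothFn D) {p : Pt} (hp : p ∈ D) :
    conj f p = (starRingEnd ℂ) (f p) :=
  ofFun_apply _ _ hp

theorem conj_conj (f : SmoothFn D) : conj (conj f) = f :=
  ext_on fun p hp => by simp [conj_apply _ hp]

theorem conj_algebraMap (c : ℂ) :
    conj (algebraMap ℂ (SmoothFn D) c) = algebraMap ℂ _ ((starRingEnd ℂ) c) :=
  ext_on fun p hp => by simp [conj_apply _ hp, algebraMap_apply _ hp]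

theorem conj_pd [hD : SmoothDomain D] (v : Pt) (f : SmoothFn D) :
    conj (pd v f) = pd v (conj f) := by
  apply ext_on
  intro p hp
  rw [conj_apply _ hp, pd_apply _ _ hp, pd_apply _ _ hp,
    fderivWithin_congr (f₁ := conj f) (f := fun q => Complex.conjCLE (f q))
      (fun q hq => conj_apply f hq) (conj_apply f hp)]
  have h := (Complex.conjCLE.toContinuousLinearMap.hasFDerivAt (x := f p)).comp_hasFDerivWithinAt p
    (SmoothFn.differentiableWithinAt f hp).hasFDerivWithinAt
  have h2 := h.fderivWithin (hD.uniqueDiff p hp)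
  have h3 : fderivWithin ℝ (fun q => Complex.conjCLE (f q)) D p = _ := h2
  rw [h3]
  simp

/-- `f` and `a` agree on `D`. -/
def Rep (f : Pt → ℂ) (a : SmoothFn D) : Prop := ∀ p ∈ D, f p = a p

theorem Rep.fderivWithin [SmoothDomain D] {f : Pt → ℂ} {a : SmoothFn D} (h : Rep f a) (v : Pt) :
    Rep (fun p => fderivWithin ℝ f D p v) (pd v a) := by
  intro p hp
  show _root_.fderivWithin ℝ f D p v = _
  rw [pd_apply _ _ hp, fderivWithin_congr h (h p hp)]

theorem rep_ofFun (f : Pt → ℂ) (hf : ContDiffOn ℝ ∞ f D) : Rep f (ofFun f hf) :=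
  fun _ hp => (ofFun_apply f hf hp).symm

end SmoothFn

/-! ### The Chandrasekhar transformation identity -/

section Radial

variable {A : Type*} [CommRing A] [Algebra ℂ A]

/-- Two applications of the Chandrasekhar transformation invert, up to the angular operator
`𝓛(𝓛-2) + 2c ∂_t`, its reverse on solutions of the Regge-Wheeler equation. Here `X` is `± ∂_{r⋆}`. -/
theorem chandrasekhar_inversion (T X : Derivation ℂ A A) (ℒ : A →ₗ[ℂ] A)
    (w v u q c : A) (hwv : w * v = 1)
    (hTX : ∀ f, T (X f) = X (T f))
    (hTw : T w = 0) (hTv : T v = 0) (hTu : T u = 0) (hTq : T q = 0) (hTc : T c = 0)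
    (hXw : X w = u * w) (hXu : X u = w * (2 - 2 * q)) (hXq : X q = -(c * w)) (hXc : X c = 0)
    (hcu : c * u = q ^ 2 - 2 * q)
    (hℒT : ∀ f, ℒ (T f) = T (ℒ f)) (hℒX : ∀ f, ℒ (X f) = X (ℒ f))
    (hℒw : ∀ f, ℒ (w * f) = w * ℒ f) (hℒq : ∀ f, ℒ (q * f) = q * ℒ f)
    (f : A) (hf : T (T f) - X (X f) = -(w * (ℒ f - q * f))) :
    (fun g => v * (T g + X g)) ((fun g => v * (T g + X g))
      (w ^ 2 * (fun g => v * (T g - X g)) ((fun g => v * (T g - X g)) f)))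
      = ℒ (ℒ f - 2 * f) + 2 * c * T f := by
  have hXv : X v = -(u * v) := by
    have h1 : X (w * v) = 0 := by rw [hwv]; simp
    rw [Derivation.leibniz, hXw] at h1
    simp only [smul_eq_mul] at h1
    linear_combination (v * h1 - (X v + u * v) * hwv)
  set P := T f - X f with hP
  have hLP : T P + X P = -(w * (ℒ f - q * f)) := by
    rw [← hf, hP, map_sub, map_sub, hTX]; abel
  have hℒ2 : ℒ (2 * f) = 2 * ℒ f := by
    rw [two_mul, two_mul, map_add]
  have hℒP : T (ℒ f) - X (ℒ f) = ℒ P := by rw [hP, map_sub, hℒT, hℒX]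
  have hXP : X P = -(w * (ℒ f - q * f)) - T P := by linear_combination hLP
  -- The derivative of `v = w⁻¹` produces the first-order term `u * P`, where `u` is the logarithmic
  -- derivative of `w`.
  have s1 : w ^ 2 * (v * (T (v * P) - X (v * P))) = T P - X P + u * P := by
    simp only [Derivation.leibniz, smul_eq_mul, hTv, hXv]
    linear_combination (w * v + 1) * (T P - X P + P * u) * hwv
  have hTXP : T (X P) = X (T P) := hTX P
  -- `L L̲ P = L̲ (L P)`, and `L P` is known from the wave equation. The terms `u w (ℒ f - q f)`
  -- coming from `L̲ w` and from `u * L P` cancel, so that the result is divisible by `w`.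
  have s2 : T (T P - X P + u * P) + X (T P - X P + u * P)
      = -(w * (ℒ P - q * P)) + w * c * w * f + w * (2 - 2 * q) * P := by
    have e : T (T P) + X (T P) - (T (X P) + X (X P))
        = T (-(w * (ℒ f - q * f))) - X (-(w * (ℒ f - q * f))) := by
      rw [← hLP, map_add, map_add, hTX P]
    simp only [map_add, map_sub, Derivation.leibniz, smul_eq_mul, hTu, hXu, map_neg, hTw, hXw, hTq,
      hXq] at e ⊢
    linear_combination e - w * hℒP + w * q * hP + u * hLP
  have s3 : v * (-(w * (ℒ P - q * P)) + w * c * w * f + w * (2 - 2 * q) * P)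
      = -ℒ P + c * w * f + (2 - q) * P := by
    linear_combination (-ℒ P + c * w * f + (2 - q) * P) * hwv
  have hℒLP : T (ℒ P) + X (ℒ P) = -(w * (ℒ (ℒ f) - q * ℒ f)) := by
    rw [← hℒT, ← hℒX, ← map_add, hLP, map_neg, hℒw, map_sub, hℒq]
  show v * (T (v * (T (w ^ 2 * (v * (T (v * P) - X (v * P)))) + X (w ^ 2 * (v * (T (v * P) - X (v * P))))))
    + X (v * (T (w ^ 2 * (v * (T (v * P) - X (v * P)))) + X (w ^ 2 * (v * (T (v * P) - X (v * P)))))))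
    = _
  rw [s1, s2, s3]
  have h2T : T (2 : A) = 0 := by simpa using T.map_natCast 2
  have h2X : X (2 : A) = 0 := by simpa using X.map_natCast 2
  simp only [map_add, map_sub, map_neg, Derivation.leibniz, smul_eq_mul, hTq, hXq, hTc, hXc, hTw,
    hXw, h2T, h2X, hℒ2]
  -- The last application of `L` uses the wave equation twice more. The two terms `c (T f + X f)`
  -- and `c P` add up to `2 c T f`, and the zeroth-order remainder `c u + 2 q - q²` vanishes by
  -- `hcu`.
  linear_combination v * (-hℒLP + (2 - q) * hLP) + c * w * v * hP
    + (ℒ (ℒ f) - q * ℒ f + c * u * f + c * T f + c * X f + c * P - (2 - q) * (ℒ f - q * f)) * hwv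
    + f * hcu

end Radial

/-! ### Spin-weighted angular operators over an abstract algebra -/

/-- A commutative algebra with the derivations `∂_ϑ`, `∂_φ` and the functions `sin ϑ`, `1/sin ϑ`,
`cot ϑ`, `sin φ`, `cos φ`. -/
structure SphereCalc (A : Type*) [CommRing A] [Algebra ℂ A] where
  Θ : Derivation ℂ A A
  Φ : Derivation ℂ A A
  sn : A
  cs : A
  ct : A
  sφ : A
  cφ : A
  comm : ∀ f, Φ (Θ f) = Θ (Φ f)
  sn_cs : sn * cs = 1
  cs_sq : cs ^ 2 = 1 + ct ^ 2
  sφ_sq : sφ ^ 2 + cφ ^ 2 = 1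
  Θsn : Θ sn = ct * sn
  Θcs : Θ cs = -(cs * ct)
  Θct : Θ ct = -cs ^ 2
  Θsφ : Θ sφ = 0
  Θcφ : Θ cφ = 0
  Φsn : Φ sn = 0
  Φcs : Φ cs = 0
  Φct : Φ ct = 0
  Φsφ : Φ sφ = cφ
  Φcφ : Φ cφ = -sφ

namespace SphereCalc

variable {A : Type*} [CommRing A] [Algebra ℂ A] (S : SphereCalc A)

/-- The imaginary unit. -/
def ii (A : Type*) [CommRing A] [Algebra ℂ A] : A := algebraMap ℂ A Complex.I

theorem ii_sq : ii A ^ 2 = -1 := by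
  rw [ii, ← map_pow, Complex.I_sq, map_neg, map_one]

theorem der_ii (P : Derivation ℂ A A) : P (ii A) = 0 := P.map_algebraMap _

theorem der_ofNat (P : Derivation ℂ A A) (n : ℕ) [n.AtLeastTwo] :
    P (OfNat.ofNat n : A) = 0 := P.map_natCast n

theorem der_intCast (P : Derivation ℂ A A) (n : ℤ) : P (n : A) = 0 := P.map_intCast n

/-- `𝓛_n`. -/
def ed (n : ℤ) (f : A) : A := S.Θ f + ii A * S.cs * S.Φ f + n * S.ct * f

/-- `𝓛_n^†`. -/
def dg (n : ℤ) (f : A) : A := S.Θ f - ii A * S.cs * S.Φ f + n * S.ct * f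

/-- `𝓛^{[s]}`. -/
def lap (s : ℤ) : A →ₗ[ℂ] A where
  toFun f := -(S.cs * S.Θ (S.sn * S.Θ f) + S.cs ^ 2 * S.Φ (S.Φ f)
    + 2 * s * ii A * (S.ct * S.cs) * S.Φ f - 4 * S.ct ^ 2 * f - 4 * f)
  map_add' f g := by simp only [map_add, mul_add]; ring
  map_smul' c f := by
    simp only [Algebra.smul_def (R := ℂ) (A := A), Derivation.leibniz, Derivation.map_algebraMap, smul_eq_mul,
      RingHom.id_apply, map_add, mul_zero, add_zero]
    ring

/-- `𝓛^{[s]} (𝓛^{[s]} - 2)`. -/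
def lapLap (s : ℤ) (f : A) : A := S.lap s (S.lap s f - 2 * f)

/-- `Z̃₁` for spin `s`. -/
def z1 (s : ℤ) : A →ₗ[ℂ] A where
  toFun f := -S.sφ * S.Θ f + S.cφ * (-(ii A * s * S.cs) * f - S.ct * S.Φ f)
  map_add' f g := by simp only [map_add, mul_add]; ring
  map_smul' c f := by
    simp only [Algebra.smul_def (R := ℂ) (A := A), Derivation.leibniz, Derivation.map_algebraMap, smul_eq_mul,
      RingHom.id_apply, map_add, mul_zero, add_zero]
    ring

/-- `Z̃₂` for spin `s`. -/
def z2 (s : ℤ) : A →ₗ[ℂ] A where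
  toFun f := -S.cφ * S.Θ f - S.sφ * (-(ii A * s * S.cs) * f - S.ct * S.Φ f)
  map_add' f g := by simp only [map_add, mul_add]; ring
  map_smul' c f := by
    simp only [Algebra.smul_def (R := ℂ) (A := A), Derivation.leibniz, Derivation.map_algebraMap, smul_eq_mul,
      RingHom.id_apply, map_add, mul_zero, add_zero]
    ring

theorem ed_def (n : ℤ) (f : A) : S.ed n f = S.Θ f + ii A * S.cs * S.Φ f + n * S.ct * f := rfl

theorem dg_def (n : ℤ) (f : A) : S.dg n f = S.Θ f - ii A * S.cs * S.Φ f + n * S.ct * f := rfl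

theorem lap_def (s : ℤ) (f : A) : S.lap s f = -(S.cs * S.Θ (S.sn * S.Θ f) + S.cs ^ 2 * S.Φ (S.Φ f)
    + 2 * s * ii A * (S.ct * S.cs) * S.Φ f - 4 * S.ct ^ 2 * f - 4 * f) := rfl

theorem z1_def (s : ℤ) (f : A) :
    S.z1 s f = -S.sφ * S.Θ f + S.cφ * (-(ii A * s * S.cs) * f - S.ct * S.Φ f) := rfl

theorem z2_def (s : ℤ) (f : A) :
    S.z2 s f = -S.cφ * S.Θ f - S.sφ * (-(ii A * s * S.cs) * f - S.ct * S.Φ f) := rfl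

theorem lap_eq (s : ℤ) (f : A) : S.lap s f = -(S.Θ (S.Θ f) + S.ct * S.Θ f + S.cs ^ 2 * S.Φ (S.Φ f)
    + 2 * s * ii A * (S.ct * S.cs) * S.Φ f - 4 * S.ct ^ 2 * f - 4 * f) := by
  rw [lap_def]
  simp only [Derivation.leibniz, smul_eq_mul, S.Θsn]
  linear_combination -(S.Θ (S.Θ f) + S.ct * S.Θ f) * S.sn_cs

/-- Factorisation through spin weight 1, which leads to the fourth-order factorisation of 𝓛(𝓛-2). -/
theorem lap_two_eq_raise_lower (f : A) : S.lap 2 f = 2 * f - S.ed (-1) (S.dg 2 f) := by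
  rw [lap_eq]
  simp only [ed, dg, map_add, map_sub, map_neg, Derivation.leibniz, smul_eq_mul, S.Θcs, S.Θct,
    S.Φcs, S.Φct, S.comm, der_ii, der_intCast, der_ofNat]
  push_cast
  linear_combination (-S.cs ^ 2 * S.Φ (S.Φ f)) * ii_sq (A := A) - 2 * f * S.cs_sq

/-- Factorisation through spin weight 3. As `-dg 3` is formally adjoint to `ed (-2)`, it exhibits
the lower bound 6 of 𝓛. -/
theorem lap_two_eq_lower_raise (f : A) : S.lap 2 f = 6 * f - S.dg 3 (S.ed (-2) f) := by
  rw [lap_eq]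
  simp only [ed, dg, map_add, map_sub, map_neg, Derivation.leibniz, smul_eq_mul, S.Θcs, S.Θct,
    S.Φcs, S.Φct, S.comm, der_ii, der_intCast, der_ofNat]
  push_cast
  linear_combination (-S.cs ^ 2 * S.Φ (S.Φ f)) * ii_sq (A := A) + 2 * f * S.cs_sq

theorem dg_two_ed (f : A) : S.dg 2 (S.ed (-1) f) = S.ed 0 (S.dg 1 f) + 2 * f := by
  simp only [ed, dg, map_add, map_sub, map_neg, Derivation.leibniz, smul_eq_mul, S.Θcs, S.Θct,
    S.Φcs, S.Φct, S.comm, der_ii, der_intCast, der_ofNat]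
  push_cast
  linear_combination 2 * f * S.cs_sq

theorem dg_one_ed (f : A) : S.dg 1 (S.ed 0 f)
    = S.Θ (S.Θ f) + S.ct * S.Θ f + S.cs ^ 2 * S.Φ (S.Φ f) := by
  simp only [ed, dg, map_add, map_sub, map_neg, Derivation.leibniz, smul_eq_mul, S.Θcs, S.Θct,
    S.Φcs, S.Φct, S.comm, der_ii, der_intCast, der_ofNat]
  push_cast
  linear_combination (-S.cs ^ 2 * S.Φ (S.Φ f)) * ii_sq (A := A)

theorem ed_add (n : ℤ) (f g : A) : S.ed n (f + g) = S.ed n f + S.ed n g := by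
  simp only [ed, map_add]; ring

theorem dg_add (n : ℤ) (f g : A) : S.dg n (f + g) = S.dg n f + S.dg n g := by
  simp only [dg, map_add]; ring

theorem ed_neg (n : ℤ) (f : A) : S.ed n (-f) = -S.ed n f := by
  simp only [ed, map_neg]; ring

theorem ed_ofNat_mul (n : ℤ) (k : ℕ) [k.AtLeastTwo] (f : A) :
    S.ed n (OfNat.ofNat k * f) = OfNat.ofNat k * S.ed n f := by
  simp only [ed, Derivation.leibniz, der_ofNat, smul_eq_mul]; ring

theorem dg_ofNat_mul (n : ℤ) (k : ℕ) [k.AtLeastTwo] (f : A) :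
    S.dg n (OfNat.ofNat k * f) = OfNat.ofNat k * S.dg n f := by
  simp only [dg, Derivation.leibniz, der_ofNat, smul_eq_mul]; ring

/-- `𝓛(𝓛-2) = 𝓛_{-1} 𝓛_0 𝓛_1^† 𝓛_2^†` on spin weight `2`. -/
theorem lapLap_two_eq (f : A) : S.lapLap 2 f = S.ed (-1) (S.ed 0 (S.dg 1 (S.dg 2 f))) := by
  have h : S.lap 2 f - 2 * f = -S.ed (-1) (S.dg 2 f) := by rw [lap_two_eq_raise_lower]; ring
  rw [lapLap, h, map_neg, lap_two_eq_raise_lower, dg_two_ed, ed_add, ed_ofNat_mul]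
  ring

/-- `𝓛_1^† 𝓛_2^† 𝓛_{-1} 𝓛_0` is the real operator `Δ(Δ+2)` on spin weight `0`. -/
theorem dg_dg_ed_ed (f : A) : S.dg 1 (S.dg 2 (S.ed (-1) (S.ed 0 f)))
    = S.dg 1 (S.ed 0 (S.dg 1 (S.ed 0 f))) + 2 * S.dg 1 (S.ed 0 f) := by
  rw [dg_two_ed, dg_add, dg_ofNat_mul]

/-! Commutation with the angular momentum operators. -/

/-- Spin lowering is rotation invariant, with the generators taken for the respective weights. This
and its companions carry control of all angular derivatives from one spin weight to the next. -/
theorem z1_dg (s : ℤ) (f : A) : S.z1 (s - 1) (S.dg s f) = S.dg s (S.z1 s f) := by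
  simp only [dg, z1_def, map_add, map_sub, map_neg, Derivation.leibniz, smul_eq_mul, S.Θcs,
    S.Θct, S.Φcs, S.Φct, S.comm, der_ii, der_intCast, S.Θsφ, S.Θcφ, S.Φsφ, S.Φcφ, neg_mul]
  push_cast
  linear_combination (s * S.cs ^ 2 * S.sφ * f - S.cφ * S.cs ^ 2 * S.Φ f) * ii_sq (A := A)

theorem z1_ed (s : ℤ) (f : A) : S.z1 (s + 1) (S.ed (-s) f) = S.ed (-s) (S.z1 s f) := by
  simp only [ed, z1_def, map_add, map_sub, map_neg, Derivation.leibniz, smul_eq_mul, S.Θcs,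
    S.Θct, S.Φcs, S.Φct, S.comm, der_ii, der_intCast, S.Θsφ, S.Θcφ, S.Φsφ, S.Φcφ, neg_mul]
  push_cast
  linear_combination (-s * S.cs ^ 2 * S.sφ * f - S.cφ * S.cs ^ 2 * S.Φ f) * ii_sq (A := A)

theorem z2_dg (s : ℤ) (f : A) : S.z2 (s - 1) (S.dg s f) = S.dg s (S.z2 s f) := by
  simp only [dg, z2_def, map_add, map_sub, map_neg, Derivation.leibniz, smul_eq_mul, S.Θcs,
    S.Θct, S.Φcs, S.Φct, S.comm, der_ii, der_intCast, S.Θsφ, S.Θcφ, S.Φsφ, S.Φcφ, neg_mul]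
  push_cast
  linear_combination (s * S.cs ^ 2 * S.cφ * f - -S.sφ * S.cs ^ 2 * S.Φ f) * ii_sq (A := A)

theorem z2_ed (s : ℤ) (f : A) : S.z2 (s + 1) (S.ed (-s) f) = S.ed (-s) (S.z2 s f) := by
  simp only [ed, z2_def, map_add, map_sub, map_neg, Derivation.leibniz, smul_eq_mul, S.Θcs,
    S.Θct, S.Φcs, S.Φct, S.comm, der_ii, der_intCast, S.Θsφ, S.Θcφ, S.Φsφ, S.Φcφ, neg_mul]
  push_cast
  linear_combination (-s * S.cs ^ 2 * S.cφ * f - -S.sφ * S.cs ^ 2 * S.Φ f) * ii_sq (A := A)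

/-- The commutation relations of the rotation algebra, whose structure constants do not depend on
the spin. They are the input to `orderedSpan_stable`. -/
theorem z1_z2 (s : ℤ) (f : A) : S.z1 s (S.z2 s f) - S.z2 s (S.z1 s f) = S.Φ f := by
  simp only [z1_def, z2_def, map_add, map_sub, map_neg, Derivation.leibniz, smul_eq_mul, S.Θcs,
    S.Θct, S.Φcs, S.Φct, S.comm, der_ii, der_intCast, S.Θsφ, S.Θcφ, S.Φsφ, S.Φcφ, neg_mul]
  linear_combination (S.cs ^ 2 - S.ct ^ 2) * S.Φ f * S.sφ_sq + S.Φ f * S.cs_sq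

theorem Φ_z1 (s : ℤ) (f : A) : S.Φ (S.z1 s f) - S.z1 s (S.Φ f) = S.z2 s f := by
  simp only [z1_def, z2_def, map_add, map_sub, map_neg, Derivation.leibniz, smul_eq_mul, S.Θcs, S.Θct,
    S.Φcs, S.Φct, S.comm, der_ii, der_intCast, S.Θsφ, S.Θcφ, S.Φsφ, S.Φcφ, neg_mul]
  ring

theorem Φ_z2 (s : ℤ) (f : A) : S.Φ (S.z2 s f) - S.z2 s (S.Φ f) = -S.z1 s f := by
  simp only [z1_def, z2_def, map_add, map_sub, map_neg, Derivation.leibniz, smul_eq_mul, S.Θcs, S.Θct,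
    S.Φcs, S.Φct, S.comm, der_ii, der_intCast, S.Θsφ, S.Θcφ, S.Φsφ, S.Φcφ, neg_mul]
  ring

theorem Φ_dg (n : ℤ) (f : A) : S.Φ (S.dg n f) = S.dg n (S.Φ f) := by
  simp only [dg, map_add, map_sub, Derivation.leibniz, smul_eq_mul, S.Φcs, S.Φct, S.comm, der_ii,
    der_intCast]
  ring

theorem Φ_ed (n : ℤ) (f : A) : S.Φ (S.ed n f) = S.ed n (S.Φ f) := by
  simp only [ed, map_add, map_sub, Derivation.leibniz, smul_eq_mul, S.Φcs, S.Φct, S.comm, der_ii,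
    der_intCast]
  ring

/-- Linear maps which commute with `∂_ϑ`, `∂_φ` and multiplication by the angular functions. -/
structure AngularLinear (P : A →ₗ[ℂ] A) : Prop where
  Θ : ∀ f, P (S.Θ f) = S.Θ (P f)
  Φ : ∀ f, P (S.Φ f) = S.Φ (P f)
  sn : ∀ f, P (S.sn * f) = S.sn * P f
  cs : ∀ f, P (S.cs * f) = S.cs * P f
  ct : ∀ f, P (S.ct * f) = S.ct * P f
  sφ : ∀ f, P (S.sφ * f) = S.sφ * P f
  cφ : ∀ f, P (S.cφ * f) = S.cφ * P f

theorem linear_algebraMap_mul (P : A →ₗ[ℂ] A) (c : ℂ) (f : A) :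
    P (algebraMap ℂ A c * f) = algebraMap ℂ A c * P f := by
  rw [← Algebra.smul_def, map_smul, Algebra.smul_def]

theorem linear_ii_mul (P : A →ₗ[ℂ] A) (f : A) : P (ii A * f) = ii A * P f :=
  linear_algebraMap_mul P _ f

theorem linear_intCast_mul (P : A →ₗ[ℂ] A) (n : ℤ) (f : A) : P ((n : A) * f) = n * P f := by
  simpa using linear_algebraMap_mul P (n : ℂ) f

theorem linear_ofNat_mul (P : A →ₗ[ℂ] A) (n : ℕ) [n.AtLeastTwo] (f : A) :
    P ((OfNat.ofNat n : A) * f) = OfNat.ofNat n * P f := by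
  have h := linear_algebraMap_mul P (OfNat.ofNat n : ℂ) f
  rwa [map_ofNat] at h

namespace AngularLinear

variable {S} {P Q : A →ₗ[ℂ] A}

theorem comp (hP : S.AngularLinear P) (hQ : S.AngularLinear Q) : S.AngularLinear (P ∘ₗ Q) where
  Θ f := by simp [hP.Θ, hQ.Θ]
  Φ f := by simp [hP.Φ, hQ.Φ]
  sn f := by simp [hP.sn, hQ.sn]
  cs f := by simp [hP.cs, hQ.cs]
  ct f := by simp [hP.ct, hQ.ct]
  sφ f := by simp [hP.sφ, hQ.sφ]
  cφ f := by simp [hP.cφ, hQ.cφ]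

theorem add (hP : S.AngularLinear P) (hQ : S.AngularLinear Q) : S.AngularLinear (P + Q) where
  Θ f := by simp [hP.Θ, hQ.Θ]
  Φ f := by simp [hP.Φ, hQ.Φ]
  sn f := by simp [hP.sn, hQ.sn, mul_add]
  cs f := by simp [hP.cs, hQ.cs, mul_add]
  ct f := by simp [hP.ct, hQ.ct, mul_add]
  sφ f := by simp [hP.sφ, hQ.sφ, mul_add]
  cφ f := by simp [hP.cφ, hQ.cφ, mul_add]

theorem sub (hP : S.AngularLinear P) (hQ : S.AngularLinear Q) : S.AngularLinear (P - Q) where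
  Θ f := by simp [hP.Θ, hQ.Θ]
  Φ f := by simp [hP.Φ, hQ.Φ]
  sn f := by simp [hP.sn, hQ.sn, mul_sub]
  cs f := by simp [hP.cs, hQ.cs, mul_sub]
  ct f := by simp [hP.ct, hQ.ct, mul_sub]
  sφ f := by simp [hP.sφ, hQ.sφ, mul_sub]
  cφ f := by simp [hP.cφ, hQ.cφ, mul_sub]

theorem mulLeft {g : A} (h1 : S.Θ g = 0) (h2 : S.Φ g = 0) :
    S.AngularLinear (LinearMap.mulLeft ℂ g) where
  Θ f := by simp [h1]
  Φ f := by simp [h2]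
  sn f := by simp; ring
  cs f := by simp; ring
  ct f := by simp; ring
  sφ f := by simp; ring
  cφ f := by simp; ring

theorem derivation {T : Derivation ℂ A A} (h1 : ∀ f, T (S.Θ f) = S.Θ (T f))
    (h2 : ∀ f, T (S.Φ f) = S.Φ (T f)) (hsn : T S.sn = 0) (hcs : T S.cs = 0) (hct : T S.ct = 0)
    (hsφ : T S.sφ = 0) (hcφ : T S.cφ = 0) : S.AngularLinear T.toLinearMap where
  Θ f := h1 f
  Φ f := h2 f
  sn f := by simp [hsn]
  cs f := by simp [hcs]
  ct f := by simp [hct]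
  sφ f := by simp [hsφ]
  cφ f := by simp [hcφ]

theorem ed (hP : S.AngularLinear P) (n : ℤ) (f : A) : P (S.ed n f) = S.ed n (P f) := by
  simp only [SphereCalc.ed, map_add, mul_assoc, linear_ii_mul, linear_intCast_mul, hP.Θ, hP.Φ,
    hP.cs, hP.ct]

theorem lap (hP : S.AngularLinear P) (s : ℤ) (f : A) : P (S.lap s f) = S.lap s (P f) := by
  simp only [lap_def, map_add, map_sub, map_neg, mul_assoc, linear_ii_mul, linear_intCast_mul,
    linear_ofNat_mul P 2, linear_ofNat_mul P 4, hP.Θ, hP.Φ, hP.cs, hP.ct, hP.sn, pow_two]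

theorem lapLap (hP : S.AngularLinear P) (s : ℤ) (f : A) :
    P (S.lapLap s f) = S.lapLap s (P f) := by
  rw [SphereCalc.lapLap, SphereCalc.lapLap, hP.lap, map_sub, hP.lap, linear_ofNat_mul]

theorem z1 (hP : S.AngularLinear P) (s : ℤ) (f : A) : P (S.z1 s f) = S.z1 s (P f) := by
  simp only [z1_def, map_add, map_sub, map_neg, mul_assoc, linear_ii_mul, linear_intCast_mul,
    hP.Θ, hP.Φ, hP.cs, hP.ct, hP.sφ, hP.cφ, neg_mul]

theorem z2 (hP : S.AngularLinear P) (s : ℤ) (f : A) : P (S.z2 s f) = S.z2 s (P f) := by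
  simp only [z2_def, map_add, map_sub, map_neg, mul_assoc, linear_ii_mul, linear_intCast_mul,
    hP.Θ, hP.Φ, hP.cs, hP.ct, hP.sφ, hP.cφ, neg_mul]

end AngularLinear

/-- A complex conjugation for which the angular derivations and functions are real. -/
structure IsConj (cj : A →+* A) : Prop where
  ii : cj (ii A) = -SphereCalc.ii A
  Θ : ∀ f, cj (S.Θ f) = S.Θ (cj f)
  Φ : ∀ f, cj (S.Φ f) = S.Φ (cj f)
  sn : cj S.sn = S.sn
  cs : cj S.cs = S.cs
  ct : cj S.ct = S.ct
  sφ : cj S.sφ = S.sφ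
  cφ : cj S.cφ = S.cφ

namespace IsConj

variable {S} {cj : A →+* A}

theorem ed (h : S.IsConj cj) (n : ℤ) (f : A) : cj (S.ed n f) = S.dg n (cj f) := by
  simp only [SphereCalc.ed, SphereCalc.dg, map_add, map_mul, map_intCast, h.ii, h.Θ, h.Φ, h.cs,
    h.ct]
  ring

theorem dg (h : S.IsConj cj) (n : ℤ) (f : A) : cj (S.dg n f) = S.ed n (cj f) := by
  simp only [SphereCalc.ed, SphereCalc.dg, map_add, map_sub, map_mul, map_intCast, h.ii, h.Θ, h.Φ,
    h.cs, h.ct]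
  ring

theorem lap (h : S.IsConj cj) (s : ℤ) (f : A) : cj (S.lap s f) = S.lap (-s) (cj f) := by
  simp only [lap_def, map_add, map_sub, map_neg, map_mul, map_pow, map_intCast, map_ofNat, h.ii,
    h.Θ, h.Φ, h.sn, h.cs, h.ct]
  push_cast
  ring

theorem lapLap (h : S.IsConj cj) (s : ℤ) (f : A) :
    cj (S.lapLap s f) = S.lapLap (-s) (cj f) := by
  rw [SphereCalc.lapLap, SphereCalc.lapLap, h.lap, map_sub, h.lap, map_mul, map_ofNat]

theorem z1 (h : S.IsConj cj) (s : ℤ) (f : A) : cj (S.z1 s f) = S.z1 (-s) (cj f) := by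
  simp only [z1_def, map_add, map_sub, map_neg, map_mul, map_intCast, h.ii,
    h.Θ, h.Φ, h.sφ, h.cφ, h.cs, h.ct]
  push_cast
  ring

theorem z2 (h : S.IsConj cj) (s : ℤ) (f : A) : cj (S.z2 s f) = S.z2 (-s) (cj f) := by
  simp only [z2_def, map_add, map_sub, map_neg, map_mul, map_intCast, h.ii,
    h.Θ, h.Φ, h.sφ, h.cφ, h.cs, h.ct]
  push_cast
  ring

theorem dg_dg_ed_ed (h : S.IsConj cj) (f : A) : cj (S.dg 1 (S.dg 2 (S.ed (-1) (S.ed 0 f))))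
    = S.dg 1 (S.dg 2 (S.ed (-1) (S.ed 0 (cj f)))) := by
  have h1 : ∀ g, cj (S.dg 1 (S.ed 0 g)) = S.dg 1 (S.ed 0 (cj g)) := by
    intro g
    simp only [dg_one_ed, map_add, map_mul, map_pow, h.Θ, h.Φ, h.ct, h.cs]
  rw [SphereCalc.dg_dg_ed_ed, SphereCalc.dg_dg_ed_ed, map_add, map_mul, map_ofNat, h1, h1]

end IsConj

end SphereCalc

/-! ### Reordering of words in three generators of a Lie algebra -/

section Reorder

variable {V : Type*} [AddCommGroup V] [Module ℂ V] (x y z : V →ₗ[ℂ] V)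

/-- The span of the ordered monomials of total degree at most `n`, applied to `f`. -/
def orderedSpan (f : V) (n : ℕ) : Submodule ℂ V :=
  Submodule.span ℂ {g | ∃ a b c : ℕ, a + b + c ≤ n ∧ g = (x ^ a) ((y ^ b) ((z ^ c) f))}

theorem orderedSpan_mono (f : V) {n m : ℕ} (h : n ≤ m) :
    orderedSpan x y z f n ≤ orderedSpan x y z f m := by
  apply Submodule.span_mono
  rintro g ⟨a, b, c, habc, rfl⟩
  exact ⟨a, b, c, habc.trans h, rfl⟩

theorem map_orderedSpan_le (p : V →ₗ[ℂ] V) (f : V) (n m : ℕ)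
    (h : ∀ a b c : ℕ, a + b + c ≤ n → p ((x ^ a) ((y ^ b) ((z ^ c) f))) ∈ orderedSpan x y z f m)
    {g : V} (hg : g ∈ orderedSpan x y z f n) : p g ∈ orderedSpan x y z f m := by
  have : orderedSpan x y z f n ≤ (orderedSpan x y z f m).comap p := by
    apply Submodule.span_le.2
    rintro g ⟨a, b, c, habc, rfl⟩
    exact h a b c habc
  exact this hg

theorem monomial_mem_orderedSpan (f : V) {n a b c : ℕ} (h : a + b + c ≤ n) :
    (x ^ a) ((y ^ b) ((z ^ c) f)) ∈ orderedSpan x y z f n :=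
  Submodule.subset_span ⟨a, b, c, h, rfl⟩

/-- A Poincaré-Birkhoff-Witt argument: moving a letter to its place past the first letter of an
ordered monomial costs a commutator, which is a single generator applied to a monomial of lower
degree. It is needed because smoothness is prescribed only for ordered words Z̃₁^a Z̃₂^b Z̃₃^c,
whereas stability under the spin operators calls for all words. -/
theorem orderedSpan_stable (hxy : ∀ f, x (y f) - y (x f) = z f)
    (hzx : ∀ f, z (x f) - x (z f) = y f) (hzy : ∀ f, z (y f) - y (z f) = -x f) (f : V) (n : ℕ) : ∀ g ∈ orderedSpan x y z f n,
    x g ∈ orderedSpan x y z f (n + 1) ∧ y g ∈ orderedSpan x y z f (n + 1) ∧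
      z g ∈ orderedSpan x y z f (n + 1) := by
  induction n using Nat.strong_induction_on with
  | _ n ih =>
    have hx : ∀ g ∈ orderedSpan x y z f n, x g ∈ orderedSpan x y z f (n + 1) := fun g hg =>
      map_orderedSpan_le x y z x f n (n + 1) (fun a b c habc => by
        rw [← Module.End.mul_apply x, ← pow_succ']
        exact monomial_mem_orderedSpan x y z f (by omega)) hg
    have hy : ∀ g ∈ orderedSpan x y z f n, y g ∈ orderedSpan x y z f (n + 1) := fun g hg =>
      map_orderedSpan_le x y z y f n (n + 1) (fun a b c habc => by
        cases a with
        | zero =>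
          rw [pow_zero, Module.End.one_apply, ← Module.End.mul_apply y, ← pow_succ']
          simpa using monomial_mem_orderedSpan x y z f (a := 0) (b := b + 1) (c := c)
            (n := n + 1) (by omega)
        | succ a =>
          obtain ⟨m, rfl⟩ : ∃ m, n = m + 1 := ⟨n - 1, by omega⟩
          have h0 := monomial_mem_orderedSpan x y z f (n := m) (a := a) (b := b) (c := c) (by omega)
          obtain ⟨-, h2, h3⟩ := ih m (by omega) _ h0
          -- Here `y x = x y - z`, and by induction both `y` and `z` applied to the shorter monomial
          -- are already ordered.
          rw [pow_succ', Module.End.mul_apply, ← sub_eq_iff_eq_add'.2 (sub_eq_iff_eq_add.1 (hxy _))]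
          exact Submodule.sub_mem _ (hx _ h2) (orderedSpan_mono x y z f (by omega) h3)) hg
    refine fun g hg => ⟨hx g hg, hy g hg, map_orderedSpan_le x y z z f n (n + 1)
      (fun a b c habc => ?_) hg⟩
    cases a with
    | zero =>
      cases b with
      | zero =>
        simp only [pow_zero, Module.End.one_apply]
        rw [← Module.End.mul_apply z, ← pow_succ']
        simpa using monomial_mem_orderedSpan x y z f (a := 0) (b := 0) (c := c + 1)
            (n := n + 1) (by omega)
      | succ b =>
        obtain ⟨m, rfl⟩ : ∃ m, n = m + 1 := ⟨n - 1, by omega⟩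
        have h0 := monomial_mem_orderedSpan x y z f (n := m) (a := 0) (b := b) (c := c) (by omega)
        simp only [pow_zero, Module.End.one_apply] at h0 ⊢
        obtain ⟨h1, -, h3⟩ := ih m (by omega) _ h0
        rw [pow_succ', Module.End.mul_apply, sub_eq_iff_eq_add.1 (hzy _)]
        exact Submodule.add_mem _ (Submodule.neg_mem _ (orderedSpan_mono x y z f (by omega) h1))
          (hy _ h3)
    | succ a =>
      obtain ⟨m, rfl⟩ : ∃ m, n = m + 1 := ⟨n - 1, by omega⟩
      have h0 := monomial_mem_orderedSpan x y z f (n := m) (a := a) (b := b) (c := c) (by omega)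
      obtain ⟨-, h2, h3⟩ := ih m (by omega) _ h0
      rw [pow_succ', Module.End.mul_apply, sub_eq_iff_eq_add.1 (hzx _)]
      exact Submodule.add_mem _ (orderedSpan_mono x y z f (by omega) h2) (hx _ h3)

end Reorder

/-! ### The exterior region -/

/-- Standing assumptions on the parameters and the time interval. -/
class Exterior (M k : ℝ) (I : Set ℝ) : Prop where
  M_pos : 0 < M
  k_pos : 0 < k
  time : I = Set.univ ∨ ∃ t₀ : ℝ, I = Set.Ici t₀

variable {M k : ℝ} {I : Set ℝ}

theorem zeros_bddAbove [h : Exterior M k I] : BddAbove {r : ℝ | delta M k r = 0} := by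
  have hk := h.k_pos
  have hM := h.M_pos
  refine ⟨2 * M + 1, fun r hr => ?_⟩
  by_contra! hlt
  have hr0 : 0 < r := by linarith
  have : 0 < delta M k r := by
    have : delta M k r = r * (r - 2 * M) + k ^ 2 * r ^ 4 := by unfold delta; ring
    rw [this]
    have : 0 < r * (r - 2 * M) := mul_pos hr0 (by linarith)
    positivity
  exact this.ne' hr

theorem rPlus_nonneg (M k : ℝ) (I : Set ℝ) [Exterior M k I] : 0 ≤ rPlus M k :=
  le_csSup (zeros_bddAbove (I := I)) (by simp [delta])

/-- Δ is positive for large r, so a nonpositive value beyond r₊ would give a zero larger than r₊ by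
the intermediate value theorem. -/
theorem delta_pos (M k : ℝ) (I : Set ℝ) [h : Exterior M k I] {r : ℝ} (hr : rPlus M k < r) :
    0 < delta M k r := by
  have hk := h.k_pos
  have hM := h.M_pos
  have hr0 : 0 < r := (rPlus_nonneg M k I).trans_lt hr
  by_contra! hle
  -- A radius at least `r` and larger than `2 M`, where both summands of Δ = r (r - 2M) + k² r⁴ are
  -- positive.
  set b := max r (2 * M + 1)
  have hb : 0 ≤ delta M k b := by
    have h1 : 2 * M + 1 ≤ b := le_max_right _ _
    have : delta M k b = b * (b - 2 * M) + k ^ 2 * b ^ 4 := by unfold delta; ring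
    rw [this]
    have : 0 < b * (b - 2 * M) := mul_pos (by linarith) (by linarith)
    positivity
  have hc : ContinuousOn (delta M k) (Set.Icc r b) := by unfold delta; fun_prop
  obtain ⟨c, hc1, hc2⟩ := intermediate_value_Icc (le_max_left r (2 * M + 1)) hc ⟨hle, hb⟩
  have := le_csSup (zeros_bddAbove (I := I)) (show c ∈ {r | delta M k r = 0} from hc2)
  have h3 : c ≤ rPlus M k := this
  linarith [hc1.1]

theorem region_eq_prod : region M k I
    = I ×ˢ (Set.Ioi (rPlus M k) ×ˢ (Set.Ioo 0 Real.pi ×ˢ (Set.univ : Set ℝ))) := by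
  ext p; simp [region, Set.mem_prod]

instance [h : Exterior M k I] : SmoothDomain (region M k I) where
  uniqueDiff := by
    rw [region_eq_prod]
    refine UniqueDiffOn.prod ?_ (isOpen_Ioi.uniqueDiffOn.prod
      (isOpen_Ioo.uniqueDiffOn.prod uniqueDiffOn_univ))
    rcases h.time with rfl | ⟨t₀, rfl⟩
    · exact uniqueDiffOn_univ
    · exact uniqueDiffOn_Ici t₀
  dense := by
    rw [region_eq_prod, interior_prod_eq, interior_prod_eq, interior_prod_eq, closure_prod_eq,
      isOpen_Ioi.interior_eq, isOpen_Ioo.interior_eq, interior_univ]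
    refine Set.prod_mono ?_ subset_closure
    rcases h.time with rfl | ⟨t₀, rfl⟩
    · simp
    · simp

section
variable {p : Pt}

theorem r_pos [Exterior M k I] (hp : p ∈ region M k I) : 0 < p.2.1 :=
  (rPlus_nonneg M k I).trans_lt hp.2.1

theorem delta_pos_of_mem [Exterior M k I] (hp : p ∈ region M k I) : 0 < delta M k p.2.1 :=
  delta_pos M k I hp.2.1

theorem wt_pos_of_mem [Exterior M k I] (hp : p ∈ region M k I) : 0 < wt M k p.2.1 :=
  div_pos (delta_pos_of_mem hp) (pow_pos (r_pos hp) 4)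

theorem sin_pos_of_mem (hp : p ∈ region M k I) : 0 < Real.sin p.2.2.1 :=
  Real.sin_pos_of_mem_Ioo hp.2.2

end

theorem contDiffOn_div_pow (M k : ℝ) (I : Set ℝ) [Exterior M k I] (g : ℝ → ℝ) (hg : ContDiff ℝ ∞ g) (n : ℕ) :
    ContDiffOn ℝ ∞ (fun r => g r / r ^ n) (Set.Ioi (rPlus M k)) :=
  hg.contDiffOn.div (contDiff_id.pow n).contDiffOn fun _ hr =>
    pow_ne_zero _ ((rPlus_nonneg M k I).trans_lt hr).ne'

theorem contDiff_delta (M k : ℝ) : ContDiff ℝ ∞ (delta M k) := by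
  unfold delta
  fun_prop

theorem contDiffOn_wt (M k : ℝ) (I : Set ℝ) [Exterior M k I] : ContDiffOn ℝ ∞ (wt M k) (Set.Ioi (rPlus M k)) :=
  contDiffOn_div_pow M k I _ (contDiff_delta M k) 4

theorem contDiffOn_rb (M k : ℝ) (I : Set ℝ) [Exterior M k I] :
    ContDiffOn ℝ ∞ (fun r => r ^ 2 / delta M k r - 1 / (1 + k ^ 2 * r ^ 2))
      (Set.Ioi (rPlus M k)) :=
  ((contDiff_id.pow 2).contDiffOn.div (contDiff_delta M k).contDiffOn
      fun _ hr => (delta_pos M k I hr).ne').sub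
    (contDiffOn_const.div (by fun_prop) fun _ _ => by positivity)

theorem contDiffOn_wt_inv (M k : ℝ) (I : Set ℝ) [Exterior M k I] :
    ContDiffOn ℝ ∞ (fun r => (wt M k r)⁻¹) (Set.Ioi (rPlus M k)) :=
  (contDiffOn_wt M k I).inv fun _ hr => (div_pos (delta_pos M k I hr)
    (pow_pos ((rPlus_nonneg M k I).trans_lt hr) 4)).ne'

/-! ### Functions of a single coordinate -/

/-- The coordinate `r`. -/
def coordR : Pt →L[ℝ] ℝ := (ContinuousLinearMap.fst ℝ ℝ (ℝ × ℝ)).comp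
  (ContinuousLinearMap.snd ℝ ℝ (ℝ × ℝ × ℝ))

/-- The coordinate `ϑ`. -/
def coordTh : Pt →L[ℝ] ℝ := ((ContinuousLinearMap.fst ℝ ℝ ℝ).comp
  (ContinuousLinearMap.snd ℝ ℝ (ℝ × ℝ))).comp (ContinuousLinearMap.snd ℝ ℝ (ℝ × ℝ × ℝ))

/-- The coordinate `φ`. -/
def coordPh : Pt →L[ℝ] ℝ := ((ContinuousLinearMap.snd ℝ ℝ ℝ).comp
  (ContinuousLinearMap.snd ℝ ℝ (ℝ × ℝ))).comp (ContinuousLinearMap.snd ℝ ℝ (ℝ × ℝ × ℝ))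

@[simp] theorem coordR_apply (p : Pt) : coordR p = p.2.1 := rfl
@[simp] theorem coordTh_apply (p : Pt) : coordTh p = p.2.2.1 := rfl
@[simp] theorem coordPh_apply (p : Pt) : coordPh p = p.2.2.2 := rfl

namespace SmoothFn

section
variable {D : Set Pt}

theorem contDiffOn_ofCoord (l : Pt →L[ℝ] ℝ) (g : ℝ → ℝ) (hg : ContDiffOn ℝ ∞ g (l '' D)) :
    ContDiffOn ℝ ∞ (fun p => (g (l p) : ℂ)) D :=
  Complex.ofRealCLM.contDiff.comp_contDiffOn
    (hg.comp l.contDiff.contDiffOn (fun _ hp => Set.mem_image_of_mem l hp))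

/-- A real function of one linear coordinate. -/
def ofCoord (l : Pt →L[ℝ] ℝ) (g : ℝ → ℝ) (hg : ContDiffOn ℝ ∞ g (l '' D)) : SmoothFn D :=
  ofFun (fun p => (g (l p) : ℂ)) (contDiffOn_ofCoord l g hg)

theorem ofCoord_apply (l : Pt →L[ℝ] ℝ) (g : ℝ → ℝ) (hg : ContDiffOn ℝ ∞ g (l '' D)) {p : Pt}
    (hp : p ∈ D) : ofCoord l g hg p = (g (l p) : ℂ) :=
  ofFun_apply _ _ hp

theorem pd_ofCoord [hD : SmoothDomain D] (l : Pt →L[ℝ] ℝ) (g : ℝ → ℝ)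
    (hg : ContDiffOn ℝ ∞ g (l '' D)) (v : Pt) {p : Pt} (hp : p ∈ D) {g' : ℝ}
    (h : HasDerivAt g g' (l p)) : pd v (ofCoord l g hg) p = (l v * g' : ℝ) := by
  rw [ofCoord, pd_ofFun _ _ _ hp]
  have h1 := (Complex.ofRealCLM.hasFDerivAt (x := g (l p))).comp p
    (h.hasFDerivAt.comp p (l.hasFDerivAt (x := p)))
  have h2 := (h1.hasFDerivWithinAt (s := D)).fderivWithin (hD.uniqueDiff p hp)
  have h3 : fderivWithin ℝ (fun q => ((g (l q) : ℝ) : ℂ)) D p = _ := h2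
  rw [h3]
  simp

/-- No derivative of `g` has to be known: whatever its derivative within the image is, the chain
rule evaluates it at `l v = 0`. -/
theorem pd_ofCoord_eq_zero [hD : SmoothDomain D] (l : Pt →L[ℝ] ℝ) (g : ℝ → ℝ)
    (hg : ContDiffOn ℝ ∞ g (l '' D)) (v : Pt) (hv : l v = 0) : pd v (ofCoord l g hg) = 0 := by
  apply ext_on
  intro p hp
  have hd : DifferentiableWithinAt ℝ g (l '' D) (l p) :=
    (hg.differentiableOn (by simp)) _ (Set.mem_image_of_mem l hp)
  rw [ofCoord, pd_ofFun _ _ _ hp, zero_apply]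
  have h0 : HasFDerivWithinAt g (fderivWithin ℝ g (l '' D) (l p)) (l '' D) (l p) :=
    hd.hasFDerivWithinAt
  have h1 := (Complex.ofRealCLM.hasFDerivAt (x := g (l p))).comp_hasFDerivWithinAt p
    (h0.comp p (l.hasFDerivAt (x := p)).hasFDerivWithinAt (Set.mapsTo_image l D))
  have h3 : fderivWithin ℝ (fun q => ((g (l q) : ℝ) : ℂ)) D p = _ :=
    h1.fderivWithin (hD.uniqueDiff p hp)
  rw [h3]
  simp [hv]

theorem conj_ofCoord (l : Pt →L[ℝ] ℝ) (g : ℝ → ℝ) (hg : ContDiffOn ℝ ∞ g (l '' D)) :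
    conj (ofCoord l g hg) = ofCoord l g hg :=
  ext_on fun p hp => by rw [conj_apply _ hp, ofCoord_apply _ _ _ hp, Complex.conj_ofReal]

end

/-! ### The angular calculus and the radial functions on the exterior -/

section
variable (M k I)

theorem coordTh_image_subset : coordTh '' region M k I ⊆ Set.Ioo 0 Real.pi := by
  rintro _ ⟨p, hp, rfl⟩
  exact hp.2.2

theorem coordR_image_subset : coordR '' region M k I ⊆ Set.Ioi (rPlus M k) := by
  rintro _ ⟨p, hp, rfl⟩
  exact hp.2.1

theorem sin_ne_zero_of_mem_image {x : ℝ} (hx : x ∈ coordTh '' region M k I) : Real.sin x ≠ 0 :=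
  (Real.sin_pos_of_mem_Ioo (coordTh_image_subset M k I hx)).ne'

variable [Exterior M k I]

/-- `∂_t`. -/
def dt : Derivation ℂ (SmoothFn (region M k I)) (SmoothFn (region M k I)) := pd (1, 0, 0, 0)

/-- `∂_r` at constant `t⋆`. -/
def dr : Derivation ℂ (SmoothFn (region M k I)) (SmoothFn (region M k I)) := pd (0, 1, 0, 0)

theorem hasDerivAt_csc {x : ℝ} (hx : Real.sin x ≠ 0) :
    HasDerivAt (fun x => 1 / Real.sin x) (-(Real.cos x / Real.sin x ^ 2)) x := by
  have h := (Real.hasDerivAt_sin x).fun_inv hx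
  simp only [one_div]
  exact h.congr_deriv (by rw [neg_div])

theorem hasDerivAt_cot {x : ℝ} (hx : Real.sin x ≠ 0) :
    HasDerivAt (fun x => Real.cos x / Real.sin x) (-(1 / Real.sin x ^ 2)) x := by
  have h := (Real.hasDerivAt_cos x).fun_div (Real.hasDerivAt_sin x) hx
  refine h.congr_deriv ?_
  rw [← neg_div]
  congr 1
  linarith [Real.sin_sq_add_cos_sq x]

theorem contDiffOn_csc :
    ContDiffOn ℝ ∞ (fun x => 1 / Real.sin x) (coordTh '' region M k I) :=
  contDiffOn_const.div Real.contDiff_sin.contDiffOn fun _ hx => sin_ne_zero_of_mem_image M k I hx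

theorem contDiffOn_cot :
    ContDiffOn ℝ ∞ (fun x => Real.cos x / Real.sin x) (coordTh '' region M k I) :=
  Real.contDiff_cos.contDiffOn.div Real.contDiff_sin.contDiffOn
    fun _ hx => sin_ne_zero_of_mem_image M k I hx

/-- The angular calculus on the exterior region. -/
def sphere : SphereCalc (SmoothFn (region M k I)) where
  Θ := pd (0, 0, 1, 0)
  Φ := pd (0, 0, 0, 1)
  sn := ofCoord coordTh Real.sin Real.contDiff_sin.contDiffOn
  cs := ofCoord coordTh (fun x => 1 / Real.sin x) (contDiffOn_csc M k I)
  ct := ofCoord coordTh (fun x => Real.cos x / Real.sin x) (contDiffOn_cot M k I)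
  sφ := ofCoord coordPh Real.sin Real.contDiff_sin.contDiffOn
  cφ := ofCoord coordPh Real.cos Real.contDiff_cos.contDiffOn
  comm := pd_comm _ _
  sn_cs := ext_on fun p hp => by
    have := (sin_pos_of_mem hp).ne'
    rw [mul_apply _ _ hp, ofCoord_apply _ _ _ hp, ofCoord_apply _ _ _ hp, one_apply hp]
    norm_cast
    rw [coordTh_apply]
    field_simp
  cs_sq := ext_on fun p hp => by
    have := (sin_pos_of_mem hp).ne'
    rw [add_apply _ _ hp, pow_apply _ _ hp, pow_apply _ _ hp, ofCoord_apply _ _ _ hp,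
      ofCoord_apply _ _ _ hp, one_apply hp]
    norm_cast
    rw [coordTh_apply]
    field_simp
    linarith [Real.sin_sq_add_cos_sq p.2.2.1]
  sφ_sq := ext_on fun p hp => by
    rw [add_apply _ _ hp, pow_apply _ _ hp, pow_apply _ _ hp, ofCoord_apply _ _ _ hp,
      ofCoord_apply _ _ _ hp, one_apply hp]
    norm_cast
    exact Real.sin_sq_add_cos_sq _
  Θsn := ext_on fun p hp => by
    have := (sin_pos_of_mem hp).ne'
    rw [pd_ofCoord _ _ _ _ hp (Real.hasDerivAt_sin _), mul_apply _ _ hp, ofCoord_apply _ _ _ hp,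
      ofCoord_apply _ _ _ hp]
    norm_cast
    simp only [coordTh_apply]
    field_simp
  Θcs := ext_on fun p hp => by
    have := (sin_pos_of_mem hp).ne'
    rw [pd_ofCoord coordTh _ _ _ hp (hasDerivAt_csc (x := coordTh p) this),
      neg_apply _ hp, mul_apply _ _ hp, ofCoord_apply _ _ _ hp, ofCoord_apply _ _ _ hp]
    norm_cast
    simp only [coordTh_apply]
    field_simp
  Θct := ext_on fun p hp => by
    have := (sin_pos_of_mem hp).ne'
    rw [pd_ofCoord coordTh _ _ _ hp (hasDerivAt_cot (x := coordTh p) this),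
      neg_apply _ hp, pow_apply _ _ hp, ofCoord_apply _ _ _ hp]
    norm_cast
    simp only [coordTh_apply]
    field_simp
  Θsφ := pd_ofCoord_eq_zero _ _ Real.contDiff_sin.contDiffOn _ (by simp)
  Θcφ := pd_ofCoord_eq_zero _ _ Real.contDiff_cos.contDiffOn _ (by simp)
  Φsn := pd_ofCoord_eq_zero _ _ Real.contDiff_sin.contDiffOn _ (by simp)
  Φcs := pd_ofCoord_eq_zero _ _ _ _ (by simp)
  Φct := pd_ofCoord_eq_zero _ _ _ _ (by simp)
  Φsφ := ext_on fun p hp => by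
    rw [pd_ofCoord _ _ _ _ hp (Real.hasDerivAt_sin _), ofCoord_apply _ _ _ hp]
    simp
  Φcφ := ext_on fun p hp => by
    rw [pd_ofCoord _ _ _ _ hp (Real.hasDerivAt_cos _), neg_apply _ hp, ofCoord_apply _ _ _ hp]
    simp

theorem sphere_isConj : (sphere M k I).IsConj conj where
  ii := by rw [SphereCalc.ii, conj_algebraMap, Complex.conj_I, map_neg]
  Θ := conj_pd _
  Φ := conj_pd _
  sn := conj_ofCoord _ _ Real.contDiff_sin.contDiffOn
  cs := conj_ofCoord _ _ _
  ct := conj_ofCoord _ _ _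
  sφ := conj_ofCoord _ _ Real.contDiff_sin.contDiffOn
  cφ := conj_ofCoord _ _ Real.contDiff_cos.contDiffOn

/-- A function of `r`. -/
def ofR (g : ℝ → ℝ) (hg : ContDiffOn ℝ ∞ g (Set.Ioi (rPlus M k))) : SmoothFn (region M k I) :=
  ofCoord coordR g (hg.mono (coordR_image_subset M k I))

variable {M k I}

theorem ofR_apply (g : ℝ → ℝ) (hg : ContDiffOn ℝ ∞ g (Set.Ioi (rPlus M k))) {p : Pt}
    (hp : p ∈ region M k I) : ofR M k I g hg p = (g p.2.1 : ℂ) :=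
  ofCoord_apply _ _ _ hp

theorem dr_ofR (g : ℝ → ℝ) (hg : ContDiffOn ℝ ∞ g (Set.Ioi (rPlus M k))) {p : Pt}
    (hp : p ∈ region M k I) {g' : ℝ} (h : HasDerivAt g g' p.2.1) :
    dr M k I (ofR M k I g hg) p = (g' : ℂ) := by
  rw [dr, ofR, pd_ofCoord _ _ _ _ hp h]
  simp

theorem dt_ofR (g : ℝ → ℝ) (hg : ContDiffOn ℝ ∞ g (Set.Ioi (rPlus M k))) :
    dt M k I (ofR M k I g hg) = 0 := pd_ofCoord_eq_zero _ _ _ _ (by simp)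

theorem Θ_ofR (g : ℝ → ℝ) (hg : ContDiffOn ℝ ∞ g (Set.Ioi (rPlus M k))) :
    (sphere M k I).Θ (ofR M k I g hg) = 0 := pd_ofCoord_eq_zero _ _ _ _ (by simp)

theorem Φ_ofR (g : ℝ → ℝ) (hg : ContDiffOn ℝ ∞ g (Set.Ioi (rPlus M k))) :
    (sphere M k I).Φ (ofR M k I g hg) = 0 := pd_ofCoord_eq_zero _ _ _ _ (by simp)

theorem dt_angularLinear : (sphere M k I).AngularLinear (dt M k I).toLinearMap :=
  .derivation (pd_comm _ _) (pd_comm _ _) (pd_ofCoord_eq_zero _ _ Real.contDiff_sin.contDiffOn _ (by simp))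
    (pd_ofCoord_eq_zero _ _ _ _ (by simp)) (pd_ofCoord_eq_zero _ _ _ _ (by simp))
    (pd_ofCoord_eq_zero _ _ Real.contDiff_sin.contDiffOn _ (by simp)) (pd_ofCoord_eq_zero _ _ Real.contDiff_cos.contDiffOn _ (by simp))

theorem dr_angularLinear : (sphere M k I).AngularLinear (dr M k I).toLinearMap :=
  .derivation (pd_comm _ _) (pd_comm _ _) (pd_ofCoord_eq_zero _ _ Real.contDiff_sin.contDiffOn _ (by simp))
    (pd_ofCoord_eq_zero _ _ _ _ (by simp)) (pd_ofCoord_eq_zero _ _ _ _ (by simp))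
    (pd_ofCoord_eq_zero _ _ Real.contDiff_sin.contDiffOn _ (by simp)) (pd_ofCoord_eq_zero _ _ Real.contDiff_cos.contDiffOn _ (by simp))

theorem dt_dr (f : SmoothFn (region M k I)) : dt M k I (dr M k I f) = dr M k I (dt M k I f) :=
  pd_comm _ _ _

variable (M k I)

/-- The weight `w`. -/
def rw : SmoothFn (region M k I) := ofR M k I (wt M k) (contDiffOn_wt M k I)

/-- The function `w⁻¹`. -/
def rv : SmoothFn (region M k I) :=
  ofR M k I (fun r => (wt M k r)⁻¹) (contDiffOn_wt_inv M k I)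

/-- The function `Δ/r²`. -/
def ra : SmoothFn (region M k I) := ofR M k I (fun r => delta M k r / r ^ 2)
  (contDiffOn_div_pow M k I _ (contDiff_delta M k) 2)

/-- The coefficient of `∂_{t⋆}` in `∂_r` at constant `t`. -/
def rb : SmoothFn (region M k I) :=
  ofR M k I (fun r => r ^ 2 / delta M k r - 1 / (1 + k ^ 2 * r ^ 2)) (contDiffOn_rb M k I)

/-- The logarithmic derivative of `w` by `∂_{r⋆}`. -/
def ru : SmoothFn (region M k I) := ofR M k I (fun r => (6 * M - 2 * r) / r ^ 2)
  (contDiffOn_div_pow M k I (fun r => 6 * M - 2 * r) (by fun_prop) 2)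

/-- The function `6M/r`. -/
def rq : SmoothFn (region M k I) := ofR M k I (fun r => 6 * M / r ^ 1)
  (contDiffOn_div_pow M k I (fun _ => 6 * M) contDiff_const 1)

/-- The constant `6M`. -/
def rc : SmoothFn (region M k I) := algebraMap ℂ _ (6 * M : ℂ)

/-- `∂_{r⋆}`. -/
def dx : Derivation ℂ (SmoothFn (region M k I)) (SmoothFn (region M k I)) :=
  ra M k I • dr M k I + (ra M k I * rb M k I) • dt M k I

variable {M k I}

theorem dx_apply (f : SmoothFn (region M k I)) :
    dx M k I f = ra M k I * (dr M k I f + rb M k I * dt M k I f) := by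
  simp only [dx, Derivation.add_apply, Derivation.smul_apply, smul_eq_mul]
  ring

theorem dt_dx (f : SmoothFn (region M k I)) : dt M k I (dx M k I f) = dx M k I (dt M k I f) := by
  have ha : dt M k I (ra M k I) = 0 := dt_ofR _ _
  have hb : dt M k I (rb M k I) = 0 := dt_ofR _ _
  simp only [dx_apply, Derivation.leibniz, map_add, smul_eq_mul, ha, hb, dt_dr]
  ring

theorem rw_mul_rv : rw M k I * rv M k I = 1 := ext_on fun p hp => by
  have := (wt_pos_of_mem hp).ne'
  rw [rw, rv, mul_apply _ _ hp, ofR_apply _ _ hp, ofR_apply _ _ hp, one_apply hp]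
  norm_cast
  field_simp

theorem dx_ofR (g : ℝ → ℝ) (hg : ContDiffOn ℝ ∞ g (Set.Ioi (rPlus M k))) {p : Pt}
    (hp : p ∈ region M k I) {g' : ℝ} (h : HasDerivAt g g' p.2.1) :
    dx M k I (ofR M k I g hg) p = (delta M k p.2.1 / p.2.1 ^ 2 * g' : ℝ) := by
  rw [dx_apply, dt_ofR, mul_zero, add_zero, mul_apply _ _ hp, dr_ofR g hg hp h, ra,
    ofR_apply _ _ hp]
  push_cast
  rfl

theorem hasDerivAt_delta (M k r : ℝ) :
    HasDerivAt (delta M k) (2 * r + 4 * k ^ 2 * r ^ 3 - 2 * M) r := by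
  have h := (((hasDerivAt_pow 2 r).add ((hasDerivAt_pow 4 r).const_mul (k ^ 2))).sub
    ((hasDerivAt_id r).const_mul (2 * M)))
  refine h.congr_deriv ?_
  push_cast
  ring

/-- This and the next three identities are the only facts about Δ that `chandrasekhar_inversion`
needs. The parameter `k` enters through `w` alone, because the k²-term of w = r⁻² + k² - 2M r⁻³ is
constant. -/
theorem dx_rw : dx M k I (rw M k I) = ru M k I * rw M k I := ext_on fun p hp => by
  have hr := (r_pos hp).ne'
  have h : HasDerivAt (wt M k) _ p.2.1 :=
    (hasDerivAt_delta M k p.2.1).fun_div (hasDerivAt_pow 4 p.2.1) (pow_ne_zero 4 hr)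
  rw [rw, ru, dx_ofR _ _ hp h, mul_apply _ _ hp, ofR_apply _ _ hp, ofR_apply _ _ hp,
    ← Complex.ofReal_mul]
  congr 1
  simp only [wt]
  field_simp
  simp only [delta]
  push_cast
  ring

theorem dx_ru : dx M k I (ru M k I) = rw M k I * (2 - 2 * rq M k I) := ext_on fun p hp => by
  have hr := (r_pos hp).ne'
  have h0 : HasDerivAt (fun r => 6 * M - 2 * r) (-2) p.2.1 := by
    simpa using ((hasDerivAt_id p.2.1).const_mul 2).const_sub (6 * M)
  have h := h0.fun_div (hasDerivAt_pow 2 p.2.1) (pow_ne_zero 2 hr)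
  rw [ru, dx_ofR _ _ hp h, mul_apply _ _ hp, sub_apply _ _ hp, mul_apply _ _ hp, rw, rq,
    ofR_apply _ _ hp, ofR_apply _ _ hp, ofNat_apply 2 hp]
  have hr2 : (p.2.1 : ℂ) ≠ 0 := by exact_mod_cast hr
  simp only [wt]
  push_cast
  field_simp
  simp only [delta]
  push_cast
  field_simp
  ring

theorem dx_rq : dx M k I (rq M k I) = -(rc M k I * rw M k I) := ext_on fun p hp => by
  have hr := (r_pos hp).ne'
  have h := (hasDerivAt_const p.2.1 (6 * M)).fun_div (hasDerivAt_pow 1 p.2.1) (pow_ne_zero 1 hr)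
  rw [rq, dx_ofR _ _ hp h, neg_apply _ hp, mul_apply _ _ hp, rw, rc, algebraMap_apply _ hp,
    ofR_apply _ _ hp]
  norm_cast
  simp only [wt]
  push_cast
  field_simp
  ring

theorem rc_mul_ru : rc M k I * ru M k I = rq M k I ^ 2 - 2 * rq M k I := ext_on fun p hp => by
  have hr := (r_pos hp).ne'
  rw [sub_apply _ _ hp, mul_apply _ _ hp, mul_apply _ _ hp, pow_apply _ _ hp, ru, rc, rq,
    ofR_apply _ _ hp, ofR_apply _ _ hp, ofNat_apply 2 hp, algebraMap_apply _ hp]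
  have hr2 : (p.2.1 : ℂ) ≠ 0 := by exact_mod_cast hr
  push_cast
  field_simp

theorem dx_angularLinear : (sphere M k I).AngularLinear (dx M k I).toLinearMap := by
  have h1 := (SphereCalc.AngularLinear.mulLeft (S := sphere M k I) (g := ra M k I)
    (Θ_ofR _ _) (Φ_ofR _ _))
  have h2 := (SphereCalc.AngularLinear.mulLeft (S := sphere M k I) (g := rb M k I)
    (Θ_ofR _ _) (Φ_ofR _ _))
  have h := (h1.comp dr_angularLinear).add ((h1.comp h2).comp dt_angularLinear)
  convert h using 1
  ext f : 1
  simp [dx_apply, mul_add]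

end

end SmoothFn

/-! ### Functions all of whose angular momentum derivatives lie in a given algebra -/

namespace SphereCalc

variable {A : Type*} [CommRing A] [Algebra ℂ A] (S : SphereCalc A)

/-- The angular momentum operators for spin `s`. -/
def zop (s : ℤ) : Fin 3 → A →ₗ[ℂ] A := ![S.z1 s, S.z2 s, S.Φ.toLinearMap]

theorem zop_dg (s : ℤ) (i : Fin 3) (f : A) : S.zop (s - 1) i (S.dg s f) = S.dg s (S.zop s i f) := by
  fin_cases i
  · exact S.z1_dg s f
  · exact S.z2_dg s f
  · exact S.Φ_dg s f

theorem zop_ed (s : ℤ) (i : Fin 3) (f : A) :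
    S.zop (s + 1) i (S.ed (-s) f) = S.ed (-s) (S.zop s i f) := by
  fin_cases i
  · exact S.z1_ed s f
  · exact S.z2_ed s f
  · exact S.Φ_ed (-s) f

theorem AngularLinear.zop {S : SphereCalc A} {P : A →ₗ[ℂ] A} (hP : S.AngularLinear P) (s : ℤ)
    (i : Fin 3) (f : A) : P (S.zop s i f) = S.zop s i (P f) := by
  fin_cases i
  · exact hP.z1 s f
  · exact hP.z2 s f
  · exact hP.Φ f

theorem IsConj.zop {S : SphereCalc A} {cj : A →+* A} (h : S.IsConj cj) (s : ℤ)
    (i : Fin 3) (f : A) : cj (S.zop s i f) = S.zop (-s) i (cj f) := by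
  fin_cases i
  · exact h.z1 s f
  · exact h.z2 s f
  · exact h.Φ f

/-- In terms of the rotation generators, the singular coefficients 1/sin ϑ and cot ϑ disappear: i
cos ϑ (-i s/sin ϑ - cot ϑ ∂_φ) - i sin ϑ ∂_φ = s cot ϑ - (i/sin ϑ) ∂_φ. Only the functions of
`ContainsAngular` remain as coefficients, so spin lowering preserves boundedness. -/
theorem dg_eq_zop (s : ℤ) (f : A) : S.dg s f = -(S.sφ * S.z1 s f + S.cφ * S.z2 s f)
    + ii A * (S.ct * S.sn) * (S.cφ * S.z1 s f - S.sφ * S.z2 s f) - ii A * S.sn * S.Φ f := by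
  simp only [dg, z1_def, z2_def]
  linear_combination (-S.Θ f + ii A * (S.ct * S.sn) * (ii A * s * S.cs * f + S.ct * S.Φ f)) * S.sφ_sq
    + (s * S.ct * f * (ii A ^ 2 * 1) + ii A * S.cs * S.Φ f) * S.sn_cs
    + s * S.ct * f * ii_sq (A := A) - ii A * S.sn * S.Φ f * S.cs_sq

theorem ed_eq_zop (s : ℤ) (f : A) : S.ed (-s) f = -(S.sφ * S.z1 s f + S.cφ * S.z2 s f)
    - ii A * (S.ct * S.sn) * (S.cφ * S.z1 s f - S.sφ * S.z2 s f) + ii A * S.sn * S.Φ f := by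
  have h1 : S.ed (-s) f = 2 * S.Θ f - S.dg s f := by
    simp only [ed, dg]; push_cast; ring
  have h2 : S.Θ f = -(S.sφ * S.z1 s f + S.cφ * S.z2 s f) := by
    simp only [z1_def, z2_def]
    linear_combination (-S.Θ f) * S.sφ_sq
  rw [h1, dg_eq_zop]
  linear_combination 2 * h2

/-- The functions all of whose derivatives by the spin-`s` angular momentum operators lie in `B`. -/
def spinSpace (B : Subalgebra ℂ A) (s : ℤ) : Submodule ℂ A where
  carrier := {f | ∀ l : List (Fin 3), l.foldr (fun i g => S.zop s i g) f ∈ B}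
  add_mem' := by
    intro f g hf hg l
    have : l.foldr (fun i g => S.zop s i g) (f + g)
        = l.foldr (fun i g => S.zop s i g) f + l.foldr (fun i g => S.zop s i g) g := by
      induction l with
      | nil => rfl
      | cons i l ih => simp only [List.foldr_cons, ih, map_add]
    rw [this]
    exact B.add_mem (hf l) (hg l)
  zero_mem' := by
    intro l
    have : l.foldr (fun i g => S.zop s i g) (0 : A) = 0 := by
      induction l with
      | nil => rfl
      | cons i l ih => simp only [List.foldr_cons, ih, map_zero]
    rw [this]
    exact B.zero_mem
  smul_mem' := by
    intro c f hf l
    have : l.foldr (fun i g => S.zop s i g) (c • f)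
        = c • l.foldr (fun i g => S.zop s i g) f := by
      induction l with
      | nil => rfl
      | cons i l ih => simp only [List.foldr_cons, ih, map_smul]
    rw [this]
    exact B.smul_mem (hf l) c

variable {S} {B : Subalgebra ℂ A} {s : ℤ} {f : A}

theorem mem_of_mem_spinSpace (hf : f ∈ S.spinSpace B s) : f ∈ B := hf []

theorem map_mem_spinSpace {P : A →ₗ[ℂ] A} (hP : S.AngularLinear P) (hB : ∀ g ∈ B, P g ∈ B)
    (hf : f ∈ S.spinSpace B s) : P f ∈ S.spinSpace B s := by
  intro l
  have : l.foldr (fun i g => S.zop s i g) (P f) = P (l.foldr (fun i g => S.zop s i g) f) := by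
    induction l with
    | nil => rfl
    | cons i l ih => simp only [List.foldr_cons, ih, hP.zop]
  rw [this]
  exact hB _ (hf l)

theorem conj_mem_spinSpace {cj : A →+* A} (h : S.IsConj cj) (hB : ∀ g ∈ B, cj g ∈ B)
    (hf : f ∈ S.spinSpace B s) : cj f ∈ S.spinSpace B (-s) := by
  intro l
  have : l.foldr (fun i g => S.zop (-s) i g) (cj f) = cj (l.foldr (fun i g => S.zop s i g) f) := by
    induction l with
    | nil => rfl
    | cons i l ih => simp only [List.foldr_cons, ih, h.zop]
  rw [this]
  exact hB _ (hf l)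

/-- The algebra contains the angular functions which are smooth on the sphere or only depend
on `φ`. -/
structure ContainsAngular (S : SphereCalc A) (B : Subalgebra ℂ A) : Prop where
  sn : S.sn ∈ B
  cos : S.ct * S.sn ∈ B
  sφ : S.sφ ∈ B
  cφ : S.cφ ∈ B

theorem ii_mem (B : Subalgebra ℂ A) : ii A ∈ B := B.algebraMap_mem _

theorem dg_mem_spinSpace (hB : ContainsAngular S B) (hf : f ∈ S.spinSpace B s) {s' : ℤ}
    (hs : s' = s - 1) : S.dg s f ∈ S.spinSpace B s' := by
  subst hs
  intro l
  have : l.foldr (fun i g => S.zop (s - 1) i g) (S.dg s f)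
      = S.dg s (l.foldr (fun i g => S.zop s i g) f) := by
    induction l with
    | nil => rfl
    | cons i l ih => simp only [List.foldr_cons, ih, zop_dg]
  rw [this, dg_eq_zop]
  have h1 := hf (0 :: l)
  have h2 := hf (1 :: l)
  have h3 := hf (2 :: l)
  exact B.sub_mem (B.add_mem (B.neg_mem (B.add_mem (B.mul_mem hB.sφ h1) (B.mul_mem hB.cφ h2)))
    (B.mul_mem (B.mul_mem (ii_mem B) hB.cos)
      (B.sub_mem (B.mul_mem hB.cφ h1) (B.mul_mem hB.sφ h2))))
    (B.mul_mem (B.mul_mem (ii_mem B) hB.sn) h3)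

theorem ed_mem_spinSpace (hB : ContainsAngular S B) (hf : f ∈ S.spinSpace B s) {n s' : ℤ}
    (hn : n = -s) (hs : s' = s + 1) : S.ed n f ∈ S.spinSpace B s' := by
  subst hn hs
  intro l
  have : l.foldr (fun i g => S.zop (s + 1) i g) (S.ed (-s) f)
      = S.ed (-s) (l.foldr (fun i g => S.zop s i g) f) := by
    induction l with
    | nil => rfl
    | cons i l ih => simp only [List.foldr_cons, ih, zop_ed]
  rw [this, ed_eq_zop]
  have h1 := hf (0 :: l)
  have h2 := hf (1 :: l)
  have h3 := hf (2 :: l)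
  exact B.add_mem (B.sub_mem (B.neg_mem (B.add_mem (B.mul_mem hB.sφ h1) (B.mul_mem hB.cφ h2)))
    (B.mul_mem (B.mul_mem (ii_mem B) hB.cos)
      (B.sub_mem (B.mul_mem hB.cφ h1) (B.mul_mem hB.sφ h2))))
    (B.mul_mem (B.mul_mem (ii_mem B) hB.sn) h3)

/-- Every word in the generators is a linear combination of ordered ones, and `B` is a linear space.
-/
theorem mem_spinSpace_of_ordered
    (h : ∀ a b c : ℕ, (S.z1 s ^ a) ((S.z2 s ^ b) ((S.Φ.toLinearMap ^ c) f)) ∈ B) :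
    f ∈ S.spinSpace B s := by
  have key : ∀ l : List (Fin 3), l.foldr (fun i g => S.zop s i g) f
      ∈ orderedSpan (S.z1 s) (S.z2 s) S.Φ.toLinearMap f l.length := by
    intro l
    induction l with
    | nil =>
      simpa using monomial_mem_orderedSpan (S.z1 s) (S.z2 s) S.Φ.toLinearMap f (n := 0) (a := 0)
        (b := 0) (c := 0) le_rfl
    | cons i l ih =>
      obtain ⟨h1, h2, h3⟩ := orderedSpan_stable (S.z1 s) (S.z2 s) S.Φ.toLinearMap (S.z1_z2 s)
        (S.Φ_z1 s) (S.Φ_z2 s) f l.length _ ih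
      simp only [List.foldr_cons, List.length_cons]
      fin_cases i
      · exact h1
      · exact h2
      · exact h3
  intro l
  have hle : orderedSpan (S.z1 s) (S.z2 s) S.Φ.toLinearMap f l.length
      ≤ Subalgebra.toSubmodule B := by
    apply Submodule.span_le.2
    rintro g ⟨a, b, c, -, rfl⟩
    exact h a b c
  exact hle (key l)

end SphereCalc

namespace SmoothFn

variable {M k : ℝ} {I : Set ℝ}

/-! ### Functions on the exterior which are periodic and bounded near the poles -/

/-- The `2π`-periodic functions which on each sphere are bounded near the poles. -/
def tame (M k : ℝ) (I : Set ℝ) : Subalgebra ℂ (SmoothFn (region M k I)) where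
  carrier := {f | (∀ t r θ φ : ℝ, (t, r, θ, φ) ∈ region M k I →
      f (t, r, θ, φ + 2 * Real.pi) = f (t, r, θ, φ)) ∧
    ∀ t ∈ I, ∀ r, rPlus M k < r → ∃ C ε : ℝ, 0 < ε ∧ ∀ θ ∈ Set.Ioo 0 Real.pi,
      (θ < ε ∨ Real.pi - ε < θ) → ∀ φ : ℝ, ‖f (t, r, θ, φ)‖ ≤ C}
  mul_mem' := by
    rintro f g ⟨hf, hf'⟩ ⟨hg, hg'⟩
    refine ⟨fun t r θ φ hp => ?_, fun t ht r hr => ?_⟩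
    · have hp' : (t, r, θ, φ + 2 * Real.pi) ∈ region M k I := hp
      rw [mul_apply _ _ hp, mul_apply _ _ hp', hf t r θ φ hp, hg t r θ φ hp]
    · obtain ⟨C, ε, hε, h⟩ := hf' t ht r hr
      obtain ⟨C', ε', hε', h'⟩ := hg' t ht r hr
      refine ⟨C * C', min ε ε', lt_min hε hε', fun θ hθ hc φ => ?_⟩
      have hp : (t, r, θ, φ) ∈ region M k I := ⟨ht, hr, hθ⟩
      have h1 := h θ hθ (by
        rcases hc with hc | hc
        · exact Or.inl (hc.trans_le (min_le_left _ _))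
        · exact Or.inr (by linarith [min_le_left ε ε'])) φ
      have h2 := h' θ hθ (by
        rcases hc with hc | hc
        · exact Or.inl (hc.trans_le (min_le_right _ _))
        · exact Or.inr (by linarith [min_le_right ε ε'])) φ
      rw [mul_apply _ _ hp, norm_mul]
      exact mul_le_mul h1 h2 (norm_nonneg _) ((norm_nonneg _).trans h1)
  add_mem' := by
    rintro f g ⟨hf, hf'⟩ ⟨hg, hg'⟩
    refine ⟨fun t r θ φ hp => ?_, fun t ht r hr => ?_⟩
    · have hp' : (t, r, θ, φ + 2 * Real.pi) ∈ region M k I := hp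
      rw [add_apply _ _ hp, add_apply _ _ hp', hf t r θ φ hp, hg t r θ φ hp]
    · obtain ⟨C, ε, hε, h⟩ := hf' t ht r hr
      obtain ⟨C', ε', hε', h'⟩ := hg' t ht r hr
      refine ⟨C + C', min ε ε', lt_min hε hε', fun θ hθ hc φ => ?_⟩
      have hp : (t, r, θ, φ) ∈ region M k I := ⟨ht, hr, hθ⟩
      have h1 := h θ hθ (by
        rcases hc with hc | hc
        · exact Or.inl (hc.trans_le (min_le_left _ _))
        · exact Or.inr (by linarith [min_le_left ε ε'])) φ
      have h2 := h' θ hθ (by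
        rcases hc with hc | hc
        · exact Or.inl (hc.trans_le (min_le_right _ _))
        · exact Or.inr (by linarith [min_le_right ε ε'])) φ
      rw [add_apply _ _ hp]
      exact (norm_add_le _ _).trans (add_le_add h1 h2)
  algebraMap_mem' := by
    intro c
    refine ⟨fun t r θ φ hp => ?_, fun t ht r hr => ⟨‖c‖, 1, one_pos, fun θ hθ _ φ => ?_⟩⟩
    · have hp' : (t, r, θ, φ + 2 * Real.pi) ∈ region M k I := hp
      rw [algebraMap_apply _ hp, algebraMap_apply _ hp']
    · have hp : (t, r, θ, φ) ∈ region M k I := ⟨ht, hr, hθ⟩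
      rw [algebraMap_apply _ hp]

/-- Bounds near the poles, unlike the limits of e^{±isφ} f, do not refer to the spin weight. One
algebra thus serves all weights and is closed under conjugation. -/
theorem conj_mem_tame {f : SmoothFn (region M k I)} (hf : f ∈ tame M k I) :
    conj f ∈ tame M k I := by
  refine ⟨fun t r θ φ hp => ?_, fun t ht r hr => ?_⟩
  · have hp' : (t, r, θ, φ + 2 * Real.pi) ∈ region M k I := hp
    rw [conj_apply _ hp, conj_apply _ hp', hf.1 t r θ φ hp]
  · obtain ⟨C, ε, hε, h⟩ := hf.2 t ht r hr
    refine ⟨C, ε, hε, fun θ hθ hc φ => ?_⟩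
    have hp : (t, r, θ, φ) ∈ region M k I := ⟨ht, hr, hθ⟩
    rw [conj_apply _ hp, Complex.norm_conj]
    exact h θ hθ hc φ

section

variable [Exterior M k I]

theorem sn_apply {p : Pt} (hp : p ∈ region M k I) :
    (sphere M k I).sn p = (Real.sin p.2.2.1 : ℂ) :=
  ofCoord_apply coordTh Real.sin Real.contDiff_sin.contDiffOn hp

theorem cs_apply {p : Pt} (hp : p ∈ region M k I) :
    (sphere M k I).cs p = ((1 / Real.sin p.2.2.1 : ℝ) : ℂ) :=
  ofCoord_apply coordTh (fun x => 1 / Real.sin x) (contDiffOn_csc M k I) hp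

theorem ct_apply {p : Pt} (hp : p ∈ region M k I) :
    (sphere M k I).ct p = ((Real.cos p.2.2.1 / Real.sin p.2.2.1 : ℝ) : ℂ) :=
  ofCoord_apply coordTh (fun x => Real.cos x / Real.sin x) (contDiffOn_cot M k I) hp

theorem sφ_apply {p : Pt} (hp : p ∈ region M k I) :
    (sphere M k I).sφ p = (Real.sin p.2.2.2 : ℂ) :=
  ofCoord_apply coordPh Real.sin Real.contDiff_sin.contDiffOn hp

theorem cφ_apply {p : Pt} (hp : p ∈ region M k I) :
    (sphere M k I).cφ p = (Real.cos p.2.2.2 : ℂ) :=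
  ofCoord_apply coordPh Real.cos Real.contDiff_cos.contDiffOn hp

theorem mem_tame_of_eq_ofReal {f : SmoothFn (region M k I)} (g : ℝ → ℝ → ℝ)
    (hfg : ∀ p ∈ region M k I, f p = (g p.2.2.1 p.2.2.2 : ℂ))
    (hg : ∀ θ φ, g θ (φ + 2 * Real.pi) = g θ φ) (hb : ∀ θ φ, |g θ φ| ≤ 1) : f ∈ tame M k I := by
  refine ⟨fun t r θ φ hp => ?_, fun t ht r hr => ⟨1, 1, one_pos, fun θ hθ _ φ => ?_⟩⟩
  · have hp' : (t, r, θ, φ + 2 * Real.pi) ∈ region M k I := hp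
    rw [hfg _ hp, hfg _ hp', hg]
  · have hp : (t, r, θ, φ) ∈ region M k I := ⟨ht, hr, hθ⟩
    rw [hfg _ hp, Complex.norm_real]
    exact hb _ _

theorem tame_containsAngular : (sphere M k I).ContainsAngular (tame M k I) where
  sn := mem_tame_of_eq_ofReal (fun θ _ => Real.sin θ) (fun _ hp => sn_apply hp) (fun _ _ => rfl)
    (fun _ _ => Real.abs_sin_le_one _)
  cos := by
    refine mem_tame_of_eq_ofReal (fun θ _ => Real.cos θ) (fun p hp => ?_) (fun _ _ => rfl)
      (fun _ _ => Real.abs_cos_le_one _)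
    have := (sin_pos_of_mem hp).ne'
    rw [mul_apply _ _ hp, ct_apply hp, sn_apply hp]
    norm_cast
    field_simp
  sφ := mem_tame_of_eq_ofReal (fun _ φ => Real.sin φ) (fun _ hp => sφ_apply hp)
    (fun _ _ => Real.sin_add_two_pi _) (fun _ _ => Real.abs_sin_le_one _)
  cφ := mem_tame_of_eq_ofReal (fun _ φ => Real.cos φ) (fun _ hp => cφ_apply hp)
    (fun _ _ => Real.cos_add_two_pi _) (fun _ _ => Real.abs_cos_le_one _)

theorem ofR_mem_tame (g : ℝ → ℝ) (hg : ContDiffOn ℝ ∞ g (Set.Ioi (rPlus M k))) :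
    ofR M k I g hg ∈ tame M k I := by
  refine ⟨fun t r θ φ hp => ?_, fun t ht r hr => ⟨|g r|, 1, one_pos, fun θ hθ _ φ => ?_⟩⟩
  · have hp' : (t, r, θ, φ + 2 * Real.pi) ∈ region M k I := hp
    rw [ofR_apply _ _ hp, ofR_apply _ _ hp']
  · have hp : (t, r, θ, φ) ∈ region M k I := ⟨ht, hr, hθ⟩
    rw [ofR_apply _ _ hp, Complex.norm_real, Real.norm_eq_abs]

open scoped Pointwise in
/-- Periodicity is inherited by derivatives. -/
theorem pd_periodic (v : Pt) {f : SmoothFn (region M k I)}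
    (hf : ∀ t r θ φ : ℝ, (t, r, θ, φ) ∈ region M k I →
      f (t, r, θ, φ + 2 * Real.pi) = f (t, r, θ, φ)) :
    ∀ t r θ φ : ℝ, (t, r, θ, φ) ∈ region M k I →
      pd v f (t, r, θ, φ + 2 * Real.pi) = pd v f (t, r, θ, φ) := by
  intro t r θ φ hp
  have hp' : (t, r, θ, φ + 2 * Real.pi) ∈ region M k I := hp
  -- Translation by `a` maps the region onto itself, hence commutes with `fderivWithin`.
  set a : Pt := (0, 0, 0, 2 * Real.pi) with ha
  have hadd : ∀ q : Pt, q + a = (q.1, q.2.1, q.2.2.1, q.2.2.2 + 2 * Real.pi) := by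
    intro q; simp [ha, Prod.ext_iff]
  have hset : a +ᵥ region M k I = region M k I := by
    ext q
    rw [Set.mem_vadd_set_iff_neg_vadd_mem]
    simp [region, ha]
  rw [pd_apply _ _ hp, pd_apply _ _ hp']
  have h1 := fderivWithin_comp_add_right (𝕜 := ℝ) (f := (f : Pt → ℂ)) (s := region M k I)
    (x := (t, r, θ, φ)) a
  rw [hset, hadd] at h1
  simp only at h1
  rw [← h1]
  congr 1
  exact fderivWithin_congr (fun q hq => by
    rw [hadd]; exact hf q.1 q.2.1 q.2.2.1 q.2.2.2 hq) (by rw [hadd]; exact hf t r θ φ hp)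

/-! ### Representation of the coordinate operators -/

namespace Rep

variable {f : Pt → ℂ} {a : SmoothFn (region M k I)}

theorem dT (h : Rep f a) : Rep (RWTS.dT (region M k I) f) (dt M k I a) := h.fderivWithin _

theorem dR (h : Rep f a) : Rep (RWTS.dR (region M k I) f) (dr M k I a) := h.fderivWithin _

theorem dTh (h : Rep f a) : Rep (RWTS.dTh (region M k I) f) ((sphere M k I).Θ a) :=
  h.fderivWithin _

theorem dPh (h : Rep f a) : Rep (RWTS.dPh (region M k I) f) ((sphere M k I).Φ a) :=
  h.fderivWithin _

theorem conjF (h : Rep f a) : Rep (RWTS.conjF f) (conj a) := fun p hp => by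
  rw [conj_apply _ hp, ← h p hp]; rfl

theorem dRstar (h : Rep f a) : Rep (RWTS.dRstar M k (region M k I) f) (dx M k I a) := by
  intro p hp
  rw [dx_apply, mul_apply _ _ hp, add_apply _ _ hp, mul_apply _ _ hp, ← h.dR p hp, ← h.dT p hp,
    ra, rb, ofR_apply _ _ hp, ofR_apply _ _ hp]
  rfl

theorem opL (h : Rep f a) : Rep (RWTS.opL M k (region M k I) f) (dt M k I a + dx M k I a) := by
  intro p hp
  rw [add_apply _ _ hp, ← h.dT p hp, ← h.dRstar p hp]
  rfl

theorem opLbar (h : Rep f a) :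
    Rep (RWTS.opLbar M k (region M k I) f) (dt M k I a - dx M k I a) := by
  intro p hp
  rw [sub_apply _ _ hp, ← h.dT p hp, ← h.dRstar p hp]
  rfl

theorem winvL (h : Rep f a) :
    Rep (RWTS.winvL M k (region M k I) f) (rv M k I * (dt M k I a + dx M k I a)) := by
  intro p hp
  rw [mul_apply _ _ hp, ← h.opL p hp, rv, ofR_apply _ _ hp]
  rfl

theorem winvLbar (h : Rep f a) :
    Rep (RWTS.winvLbar M k (region M k I) f) (rv M k I * (dt M k I a - dx M k I a)) := by
  intro p hp
  rw [mul_apply _ _ hp, ← h.opLbar p hp, rv, ofR_apply _ _ hp]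
  rfl

theorem angL (h : Rep f a) (s : ℤ) :
    Rep (RWTS.angL s (region M k I) f) ((sphere M k I).lap s a) := by
  intro p hp
  have h1 : Rep (fun q => (Real.sin q.2.2.1 : ℂ) * RWTS.dTh (region M k I) f q)
      ((sphere M k I).sn * (sphere M k I).Θ a) := fun q hq => by
    rw [mul_apply _ _ hq, sn_apply hq, ← h.dTh q hq]
  rw [SphereCalc.lap_def, neg_apply _ hp, sub_apply _ _ hp, sub_apply _ _ hp, add_apply _ _ hp,
    add_apply _ _ hp]
  simp only [mul_apply _ _ hp, pow_apply _ _ hp, cs_apply hp, ct_apply hp, ofNat_apply 2 hp,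
    ofNat_apply 4 hp, intCast_apply _ hp, ← h.dPh p hp, ← h.dPh.dPh p hp, ← h1.dTh p hp, ← h p hp,
    SphereCalc.ii, algebraMap_apply _ hp, RWTS.angL]
  push_cast
  ring

theorem angLL (h : Rep f a) (s : ℤ) :
    Rep (RWTS.angLL s (region M k I) f) ((sphere M k I).lapLap s a) := by
  refine Rep.angL (fun p hp => ?_) s
  rw [sub_apply _ _ hp, mul_apply _ _ hp, ofNat_apply 2 hp, ← h.angL s p hp, ← h p hp]

theorem edth (h : Rep f a) (n : ℤ) :
    Rep (RWTS.edth n (region M k I) f) ((sphere M k I).ed n a) := by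
  intro p hp
  rw [SphereCalc.ed_def, add_apply _ _ hp, add_apply _ _ hp]
  simp only [mul_apply _ _ hp, cs_apply hp, ct_apply hp, intCast_apply _ hp, ← h.dPh p hp,
    ← h.dTh p hp, ← h p hp, SphereCalc.ii, algebraMap_apply _ hp, RWTS.edth]

theorem edthDag (h : Rep f a) (n : ℤ) :
    Rep (RWTS.edthDag n (region M k I) f) ((sphere M k I).dg n a) := by
  intro p hp
  rw [SphereCalc.dg_def, add_apply _ _ hp, sub_apply _ _ hp]
  simp only [mul_apply _ _ hp, cs_apply hp, ct_apply hp, intCast_apply _ hp, ← h.dPh p hp,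
    ← h.dTh p hp, ← h p hp, SphereCalc.ii, algebraMap_apply _ hp, RWTS.edthDag]

theorem Z1 (h : Rep f a) (s : ℤ) : Rep (RWTS.Z1 s (region M k I) f) ((sphere M k I).z1 s a) := by
  intro p hp
  rw [SphereCalc.z1_def, add_apply _ _ hp]
  simp only [mul_apply _ _ hp, neg_apply _ hp, sub_apply _ _ hp, cs_apply hp, ct_apply hp,
    sφ_apply hp, cφ_apply hp, intCast_apply _ hp, ← h.dPh p hp,
    ← h.dTh p hp, ← h p hp, SphereCalc.ii, algebraMap_apply _ hp, RWTS.Z1]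
  ring

theorem Z2 (h : Rep f a) (s : ℤ) : Rep (RWTS.Z2 s (region M k I) f) ((sphere M k I).z2 s a) := by
  intro p hp
  rw [SphereCalc.z2_def, sub_apply _ _ hp]
  simp only [mul_apply _ _ hp, neg_apply _ hp, sub_apply _ _ hp, cs_apply hp, ct_apply hp,
    sφ_apply hp, cφ_apply hp, intCast_apply _ hp, ← h.dPh p hp,
    ← h.dTh p hp, ← h p hp, SphereCalc.ii, algebraMap_apply _ hp, RWTS.Z2]
  ring

theorem iterate {F : (Pt → ℂ) → Pt → ℂ} {P : SmoothFn (region M k I) →ₗ[ℂ] SmoothFn (region M k I)}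
    (hF : ∀ g b, Rep g b → Rep (F g) (P b)) (n : ℕ) (h : Rep f a) : Rep (F^[n] f) ((P ^ n) a) := by
  induction n with
  | zero => simpa using h
  | succ n ih =>
    rw [Function.iterate_succ_apply', pow_succ', Module.End.mul_apply]
    exact hF _ _ ih

theorem Zs (h : Rep f a) (s : ℤ) (i j l : ℕ) : Rep (RWTS.Zs s (region M k I) i j l f)
    (((sphere M k I).z1 s ^ i) (((sphere M k I).z2 s ^ j)
      (((sphere M k I).Φ.toLinearMap ^ l) a))) :=
  iterate (P := (sphere M k I).z1 s) (fun _ _ hg => hg.Z1 s) i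
    (iterate (P := (sphere M k I).z2 s) (fun _ _ hg => hg.Z2 s) j
      (iterate (P := (sphere M k I).Φ.toLinearMap) (fun _ _ hg => hg.dPh) l h))

end Rep

/-! ### Smooth spin-weighted functions -/

/-- The phases e^{±isφ} have modulus one, so the two limits bound `f` itself near each pole. -/
theorem exists_bound_of_poleLimits {s : ℤ} {t r : ℝ} (ht : t ∈ I) {f : Pt → ℂ}
    (hf : PoleLimits s (𝓝[I] t) (𝓝 r) f) : ∃ C ε : ℝ, 0 < ε ∧ ∀ θ ∈ Set.Ioo 0 Real.pi,
      (θ < ε ∨ Real.pi - ε < θ) → ∀ φ : ℝ, ‖f (t, r, θ, φ)‖ ≤ C := by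
  obtain ⟨⟨c, hc⟩, ⟨d, hd⟩⟩ := hf
  have key : ∀ (l : Filter ℝ) (e : ℝ → ℂ) (c : ℂ), (∀ φ, ‖e φ‖ = 1) →
      Tendsto (fun p : Pt => e p.2.2.2 * f p) (𝓝[I] t ×ˢ 𝓝 r ×ˢ l ×ˢ (⊤ : Filter ℝ)) (𝓝 c) →
      ∀ᶠ θ in l, ∀ φ : ℝ, ‖f (t, r, θ, φ)‖ ≤ ‖c‖ + 1 := by
    intro l e c he h
    have h1 : ∀ᶠ p : Pt in 𝓝[I] t ×ˢ 𝓝 r ×ˢ l ×ˢ (⊤ : Filter ℝ), ‖f p‖ ≤ ‖c‖ + 1 := by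
      filter_upwards [h.norm.eventually (ge_mem_nhds (lt_add_one ‖c‖))] with p hp
      rwa [norm_mul, he, one_mul] at hp
    -- Since `t ∈ I`, the estimate may be evaluated at the exact values of `t` and `r`. The filter
    -- `⊤` in φ then makes the bound uniform in φ.
    have h2 : ∀ᶠ q : ℝ × ℝ in l ×ˢ (⊤ : Filter ℝ), ‖f (t, r, q)‖ ≤ ‖c‖ + 1 :=
      ((h1.curry.self_of_nhdsWithin ht).curry).self_of_nhds
    rw [Filter.eventually_prod_iff] at h2
    obtain ⟨pa, hpa, pb, hpb, hab⟩ := h2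
    filter_upwards [hpa] with θ hθ φ
    exact hab hθ (Filter.eventually_top.1 hpb φ)
  have hn : ∀ x : ℝ, ‖Complex.exp (Complex.I * s * (x : ℂ))‖ = 1 := fun x => by
    have : Complex.I * s * (x : ℂ) = ((s * x : ℝ) : ℂ) * Complex.I := by push_cast; ring
    rw [this, Complex.norm_exp_ofReal_mul_I]
  have hn' : ∀ x : ℝ, ‖Complex.exp (-(Complex.I * s * (x : ℂ)))‖ = 1 := fun x => by
    rw [Complex.exp_neg, norm_inv, hn, inv_one]
  have e1 := key _ _ c hn hc
  have e2 := key _ _ d hn' hd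
  obtain ⟨ε, hε, h1⟩ := (mem_nhdsGT_iff_exists_Ioo_subset).1 e1
  obtain ⟨δ, hδ, h2⟩ := (mem_nhdsLT_iff_exists_Ioo_subset).1 e2
  refine ⟨max (‖c‖ + 1) (‖d‖ + 1), min ε (Real.pi - δ), lt_min hε (sub_pos.2 hδ), ?_⟩
  rintro θ hθ (h | h) φ
  · exact (h1 ⟨hθ.1, h.trans_le (min_le_left _ _)⟩ φ).trans (le_max_left _ _)
  · refine (h2 ⟨?_, hθ.2⟩ φ).trans (le_max_right _ _)
    linarith [min_le_right ε (Real.pi - δ)]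

/-- The derivatives by `∂_{t⋆}` and `∂_r` of a smooth spin-weighted function have tame angular
derivatives. -/
theorem mem_spinSpace_of_isSmoothSpin {s : ℤ} {f : Pt → ℂ} (hf : IsSmoothSpin M k I s f)
    {a : SmoothFn (region M k I)} (ha : Rep f a) (i j : ℕ) :
    ((dt M k I).toLinearMap ^ i) (((dr M k I).toLinearMap ^ j) a)
      ∈ (sphere M k I).spinSpace (tame M k I) s := by
  have hpow : ∀ (P : SmoothFn (region M k I) →ₗ[ℂ] SmoothFn (region M k I)),
      (sphere M k I).AngularLinear P → ∀ n, (sphere M k I).AngularLinear (P ^ n) := by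
    intro P hP n
    induction n with
    | zero => exact ⟨fun _ => rfl, fun _ => rfl, fun _ => rfl, fun _ => rfl, fun _ => rfl,
        fun _ => rfl, fun _ => rfl⟩
    | succ n ih => rw [pow_succ']; exact hP.comp ih
  set P := ((dt M k I).toLinearMap ^ i) ∘ₗ ((dr M k I).toLinearMap ^ j) with hP
  have hPA : (sphere M k I).AngularLinear P :=
    (hpow _ dt_angularLinear i).comp (hpow _ dr_angularLinear j)
  have hcomm : ∀ (Z : SmoothFn (region M k I) →ₗ[ℂ] SmoothFn (region M k I)),
      (∀ g, P (Z g) = Z (P g)) → ∀ n g, P ((Z ^ n) g) = (Z ^ n) (P g) := by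
    intro Z hZ n g
    induction n with
    | zero => rfl
    | succ n ih => rw [pow_succ', Module.End.mul_apply, Module.End.mul_apply, hZ, ih]
  show P a ∈ _
  refine SphereCalc.mem_spinSpace_of_ordered fun m n l => ?_
  -- The pole condition has ∂_{t⋆} and ∂_r outermost, the spin space has the rotation generators
  -- outermost; they commute.
  rw [← hcomm _ hPA.Φ, ← hcomm _ (hPA.z2 s), ← hcomm _ (hPA.z1 s)]
  have hrep : Rep ((RWTS.dT (region M k I))^[i] ((RWTS.dR (region M k I))^[j]
      (Zs s (region M k I) m n l f))) (P (((sphere M k I).z1 s ^ m) (((sphere M k I).z2 s ^ n)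
      (((sphere M k I).Φ.toLinearMap ^ l) a)))) :=
    Rep.iterate (P := (dt M k I).toLinearMap) (fun _ _ hg => hg.dT) i
      (Rep.iterate (P := (dr M k I).toLinearMap) (fun _ _ hg => hg.dR) j (ha.Zs s m n l))
  have hperpow : ∀ (Z : SmoothFn (region M k I) →ₗ[ℂ] SmoothFn (region M k I))
      (Q : SmoothFn (region M k I) → Prop) (_ : ∀ g, Q g → Q (Z g)) (n : ℕ) (g), Q g →
      Q ((Z ^ n) g) := by
    intro Z Q hZ n g hg
    induction n with
    | zero => exact hg
    | succ n ih => rw [pow_succ', Module.End.mul_apply]; exact hZ _ ih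
  constructor
  · set Q : SmoothFn (region M k I) → Prop := fun g => ∀ t r θ φ : ℝ, (t, r, θ, φ) ∈ region M k I →
      g (t, r, θ, φ + 2 * Real.pi) = g (t, r, θ, φ) with hQ
    have hpd : ∀ v g, Q g → Q (pd v g) := fun v g hg => pd_periodic v hg
    have hz : ∀ g, Q g → Q ((sphere M k I).z1 s g) ∧ Q ((sphere M k I).z2 s g) := by
      intro g hg
      constructor
      · intro t r θ φ hp
        have hp' : (t, r, θ, φ + 2 * Real.pi) ∈ region M k I := hp
        have h1 : (sphere M k I).Θ g (t, r, θ, φ + 2 * Real.pi) = _ := hpd _ g hg t r θ φ hp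
        have h2 : (sphere M k I).Φ g (t, r, θ, φ + 2 * Real.pi) = _ := hpd _ g hg t r θ φ hp
        simp only [SphereCalc.z1_def, add_apply _ _ hp, mul_apply _ _ hp, sub_apply _ _ hp,
          neg_apply _ hp, sφ_apply hp, cφ_apply hp, cs_apply hp, ct_apply hp, add_apply _ _ hp',
          mul_apply _ _ hp', sub_apply _ _ hp', neg_apply _ hp', sφ_apply hp', cφ_apply hp',
          cs_apply hp', ct_apply hp', h1, h2, hg t r θ φ hp, Real.sin_add_two_pi,
          Real.cos_add_two_pi, SphereCalc.ii, algebraMap_apply _ hp, algebraMap_apply _ hp',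
          intCast_apply _ hp, intCast_apply _ hp']
        rfl
      · intro t r θ φ hp
        have hp' : (t, r, θ, φ + 2 * Real.pi) ∈ region M k I := hp
        have h1 : (sphere M k I).Θ g (t, r, θ, φ + 2 * Real.pi) = _ := hpd _ g hg t r θ φ hp
        have h2 : (sphere M k I).Φ g (t, r, θ, φ + 2 * Real.pi) = _ := hpd _ g hg t r θ φ hp
        simp only [SphereCalc.z2_def, add_apply _ _ hp, mul_apply _ _ hp, sub_apply _ _ hp,
          neg_apply _ hp, sφ_apply hp, cφ_apply hp, cs_apply hp, ct_apply hp, add_apply _ _ hp',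
          mul_apply _ _ hp', sub_apply _ _ hp', neg_apply _ hp', sφ_apply hp', cφ_apply hp',
          cs_apply hp', ct_apply hp', h1, h2, hg t r θ φ hp, Real.sin_add_two_pi,
          Real.cos_add_two_pi, SphereCalc.ii, algebraMap_apply _ hp, algebraMap_apply _ hp',
          intCast_apply _ hp, intCast_apply _ hp']
        rfl
    exact hperpow (dt M k I).toLinearMap Q (fun g hg => hpd _ g hg) i _
      (hperpow (dr M k I).toLinearMap Q (fun g hg => hpd _ g hg) j _
      (hperpow _ Q (fun g hg => (hz g hg).1) m _ (hperpow _ Q (fun g hg => (hz g hg).2) n _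
      (hperpow _ Q (fun g hg => hpd _ g hg) l _ (fun t r θ φ hp => by
        have hp' : (t, r, θ, φ + 2 * Real.pi) ∈ region M k I := hp
        rw [← ha _ hp, ← ha _ hp', hf.periodic t r θ φ hp])))))
  · intro t ht r hr
    obtain ⟨C, ε, hε, h⟩ := exists_bound_of_poleLimits ht (hf.poles i j m n l t ht r hr)
    exact ⟨C, ε, hε, fun θ hθ hc φ => by rw [← hrep _ ⟨ht, hr, hθ⟩]; exact h θ hθ hc φ⟩

end

end SmoothFn

/-! ### Bounded functions on `(0, π)` -/

/-- Boundedness on `(0, π)`. -/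
def BddIoo (h : ℝ → ℂ) : Prop := ∃ C : ℝ, ∀ θ ∈ Set.Ioo 0 Real.pi, ‖h θ‖ ≤ C

theorem BddIoo.mul {g h : ℝ → ℂ} (hg : BddIoo g) (hh : BddIoo h) :
    BddIoo (fun θ => g θ * h θ) := by
  obtain ⟨C, hC⟩ := hg
  obtain ⟨C', hC'⟩ := hh
  refine ⟨C * C', fun θ hθ => ?_⟩
  rw [norm_mul]
  exact mul_le_mul (hC θ hθ) (hC' θ hθ) (norm_nonneg _) ((norm_nonneg _).trans (hC θ hθ))

theorem BddIoo.sub {g h : ℝ → ℂ} (hg : BddIoo g) (hh : BddIoo h) :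
    BddIoo (fun θ => g θ - h θ) := by
  obtain ⟨C, hC⟩ := hg
  obtain ⟨C', hC'⟩ := hh
  exact ⟨C + C', fun θ hθ => (norm_sub_le _ _).trans (add_le_add (hC θ hθ) (hC' θ hθ))⟩

theorem BddIoo.conj {h : ℝ → ℂ} (hh : BddIoo h) :
    BddIoo (fun θ => (starRingEnd ℂ) (h θ)) := by
  obtain ⟨C, hC⟩ := hh
  exact ⟨C, fun θ hθ => by rw [Complex.norm_conj]; exact hC θ hθ⟩

theorem bddIoo_of_continuous {h : ℝ → ℂ} (hh : Continuous h) : BddIoo h := by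
  obtain ⟨C, hC⟩ := (isCompact_Icc (a := 0) (b := Real.pi)).exists_bound_of_continuousOn
    hh.continuousOn
  exact ⟨C, fun θ hθ => hC θ (Set.Ioo_subset_Icc_self hθ)⟩

/-- This disposes of all boundary terms at the poles: the area element sin ϑ beats any bounded
function. -/
theorem BddIoo.tendsto_sin_mul {h : ℝ → ℂ} (hh : BddIoo h) :
    Tendsto (fun θ => (Real.sin θ : ℂ) * h θ) (𝓝[>] 0) (𝓝 0) ∧
    Tendsto (fun θ => (Real.sin θ : ℂ) * h θ) (𝓝[<] Real.pi) (𝓝 0) := by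
  obtain ⟨C, hC⟩ := hh
  have hpi := Real.pi_pos
  have aux : ∀ (l : Filter ℝ) (x : ℝ), l ≤ 𝓝 x → Real.sin x = 0 → Set.Ioo 0 Real.pi ∈ l →
      Tendsto (fun θ => (Real.sin θ : ℂ) * h θ) l (𝓝 0) := by
    intro l x hl hx hm
    have h1 : Tendsto (fun θ => |Real.sin θ| * C) l (𝓝 0) := by
      have h2 : Tendsto (fun θ => |Real.sin θ| * C) (𝓝 x) (𝓝 (|Real.sin x| * C)) :=
        (by fun_prop : Continuous fun θ => |Real.sin θ| * C).tendsto x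
      rw [hx, abs_zero, zero_mul] at h2
      exact h2.mono_left hl
    refine squeeze_zero_norm' ?_ h1
    filter_upwards [hm] with θ hθ
    rw [norm_mul, Complex.norm_real, Real.norm_eq_abs]
    exact mul_le_mul_of_nonneg_left (hC θ hθ) (abs_nonneg _)
  exact ⟨aux _ 0 nhdsWithin_le_nhds Real.sin_zero (Ioo_mem_nhdsGT hpi),
    aux _ Real.pi nhdsWithin_le_nhds Real.sin_pi (Ioo_mem_nhdsLT hpi)⟩

theorem BddIoo.intervalIntegrable {h : ℝ → ℂ} (hh : BddIoo h)
    (hc : ContinuousOn h (Set.Ioo 0 Real.pi)) :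
    IntervalIntegrable h MeasureTheory.volume 0 Real.pi := by
  obtain ⟨C, hC⟩ := hh
  rw [intervalIntegrable_iff_integrableOn_Ioo_of_le Real.pi_pos.le]
  exact MeasureTheory.IntegrableOn.of_bound (by simp)
    (hc.aestronglyMeasurable measurableSet_Ioo) C
    ((MeasureTheory.ae_restrict_iff' measurableSet_Ioo).2 (Filter.Eventually.of_forall hC))

/-! ### Azimuthal modes -/

/-- The `m`-th azimuthal mode of `f` on the sphere of constant `(t⋆, r)`. -/
def mode (f : Pt → ℂ) (t r : ℝ) (m : ℤ) (θ : ℝ) : ℂ :=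
  ∫ φ in (0 : ℝ)..(2 * Real.pi), f (t, r, θ, φ) * Complex.exp (-(Complex.I * m * (φ : ℂ)))

namespace SmoothFn

variable {M k : ℝ} {I : Set ℝ} {t r : ℝ}

theorem continuousOn_slice (a : SmoothFn (region M k I)) (ht : t ∈ I) (hr : rPlus M k < r) :
    ContinuousOn (fun q : ℝ × ℝ => a (t, r, q.1, q.2)) (Set.Ioo 0 Real.pi ×ˢ Set.univ) :=
  (smooth a).continuousOn.comp (by fun_prop) (fun q hq => ⟨ht, hr, hq.1⟩)

theorem continuous_slice (a : SmoothFn (region M k I)) (ht : t ∈ I) (hr : rPlus M k < r) {θ : ℝ}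
    (hθ : θ ∈ Set.Ioo 0 Real.pi) : Continuous (fun φ : ℝ => a (t, r, θ, φ)) := by
  rw [← continuousOn_univ]
  exact (continuousOn_slice a ht hr).comp (f := fun φ : ℝ => (θ, φ)) (by fun_prop)
    (fun φ _ => ⟨hθ, trivial⟩)

theorem hasDerivAt_slice [Exterior M k I] (a : SmoothFn (region M k I)) (ht : t ∈ I)
    (hr : rPlus M k < r) {θ : ℝ} (hθ : θ ∈ Set.Ioo 0 Real.pi) (φ : ℝ) :
    HasDerivAt (fun x => a (t, r, x, φ)) ((sphere M k I).Θ a (t, r, θ, φ)) θ := by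
  have hp : (t, r, θ, φ) ∈ region M k I := ⟨ht, hr, hθ⟩
  have h1 := (SmoothFn.differentiableWithinAt a hp).hasFDerivWithinAt
  have h2 : HasDerivWithinAt (fun x : ℝ => ((t, r, x, φ) : Pt)) (0, 0, 1, 0) (Set.Ioo 0 Real.pi) θ :=
    (hasDerivWithinAt_const _ _ _).prodMk ((hasDerivWithinAt_const _ _ _).prodMk
      ((hasDerivWithinAt_id _ _).prodMk (hasDerivWithinAt_const _ _ _)))
  have h3 := h1.comp_hasDerivWithinAt θ h2
    (fun x hx => show (t, r, x, φ) ∈ region M k I from ⟨ht, hr, hx⟩)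
  have h4 : (sphere M k I).Θ a (t, r, θ, φ) = fderivWithin ℝ a (region M k I) (t, r, θ, φ)
      (0, 0, 1, 0) := pd_apply _ _ hp
  rw [h4]
  exact h3.hasDerivAt (isOpen_Ioo.mem_nhds hθ)

theorem hasDerivAt_slice_φ [Exterior M k I] (a : SmoothFn (region M k I)) (ht : t ∈ I)
    (hr : rPlus M k < r) {θ : ℝ} (hθ : θ ∈ Set.Ioo 0 Real.pi) (φ : ℝ) :
    HasDerivAt (fun x => a (t, r, θ, x)) ((sphere M k I).Φ a (t, r, θ, φ)) φ := by
  have hp : (t, r, θ, φ) ∈ region M k I := ⟨ht, hr, hθ⟩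
  have h1 := (SmoothFn.differentiableWithinAt a hp).hasFDerivWithinAt
  have h2 : HasDerivWithinAt (fun x : ℝ => ((t, r, θ, x) : Pt)) (0, 0, 0, 1) Set.univ φ :=
    (hasDerivWithinAt_const _ _ _).prodMk ((hasDerivWithinAt_const _ _ _).prodMk
      ((hasDerivWithinAt_const _ _ _).prodMk (hasDerivWithinAt_id _ _)))
  have h3 := h1.comp_hasDerivWithinAt φ h2
    (fun x _ => show (t, r, θ, x) ∈ region M k I from ⟨ht, hr, hθ⟩)
  have h4 : (sphere M k I).Φ a (t, r, θ, φ) = fderivWithin ℝ a (region M k I) (t, r, θ, φ)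
      (0, 0, 0, 1) := pd_apply _ _ hp
  rw [h4]
  exact h3.hasDerivAt univ_mem

theorem norm_exp_mode (m : ℤ) (φ : ℝ) : ‖Complex.exp (-(Complex.I * m * (φ : ℂ)))‖ = 1 := by
  have : -(Complex.I * m * (φ : ℂ)) = ((-(m * φ) : ℝ) : ℂ) * Complex.I := by push_cast; ring
  rw [this, Complex.norm_exp_ofReal_mul_I]

theorem continuous_mode_integrand (a : SmoothFn (region M k I)) (ht : t ∈ I) (hr : rPlus M k < r)
    (m : ℤ) {θ : ℝ} (hθ : θ ∈ Set.Ioo 0 Real.pi) :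
    Continuous (fun φ : ℝ => a (t, r, θ, φ) * Complex.exp (-(Complex.I * m * (φ : ℂ)))) :=
  (continuous_slice a ht hr hθ).mul (by fun_prop)

/-- Differentiation under the integral sign. On a closed ball inside (0, π) times [0, 2π] the
ϑ-derivative is bounded by compactness, and the phase has modulus one. -/
theorem hasDerivAt_mode [Exterior M k I] (a : SmoothFn (region M k I)) (ht : t ∈ I)
    (hr : rPlus M k < r) (m : ℤ) {θ : ℝ} (hθ : θ ∈ Set.Ioo 0 Real.pi) :
    HasDerivAt (mode a t r m) (mode ((sphere M k I).Θ a) t r m θ) θ := by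
  obtain ⟨δ, hδ, hball⟩ := Metric.isOpen_iff.1 (isOpen_Ioo (a := 0) (b := Real.pi)) θ hθ
  have hsub : Metric.closedBall θ (δ / 2) ⊆ Set.Ioo 0 Real.pi :=
    (Metric.closedBall_subset_ball (half_lt_self hδ)).trans hball
  obtain ⟨C, hC⟩ := ((isCompact_closedBall θ (δ / 2)).prod
    (isCompact_Icc (a := (0 : ℝ)) (b := 2 * Real.pi))).exists_bound_of_continuousOn
    ((continuousOn_slice ((sphere M k I).Θ a) ht hr).mono (Set.prod_mono hsub (Set.subset_univ _)))
  have h2pi : (0 : ℝ) ≤ 2 * Real.pi := by positivity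
  refine (intervalIntegral.hasDerivAt_integral_of_dominated_loc_of_deriv_le
    (F := fun x φ => a (t, r, x, φ) * Complex.exp (-(Complex.I * m * (φ : ℂ))))
    (F' := fun x φ => (sphere M k I).Θ a (t, r, x, φ) * Complex.exp (-(Complex.I * m * (φ : ℂ))))
    (s := Metric.closedBall θ (δ / 2)) (bound := fun _ => C)
    (Metric.closedBall_mem_nhds θ (half_pos hδ)) ?_ ?_ ?_ ?_ ?_ ?_).2
  · filter_upwards [isOpen_Ioo.mem_nhds hθ] with x hx
    exact (continuous_mode_integrand a ht hr m hx).aestronglyMeasurable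
  · exact (continuous_mode_integrand a ht hr m hθ).intervalIntegrable _ _
  · exact (continuous_mode_integrand _ ht hr m hθ).aestronglyMeasurable
  · refine Filter.Eventually.of_forall fun φ hφ x hx => ?_
    rw [norm_mul, norm_exp_mode, mul_one]
    rw [Set.uIoc_of_le h2pi] at hφ
    exact hC (x, φ) ⟨hx, Set.Ioc_subset_Icc_self hφ⟩
  · exact intervalIntegrable_const
  · refine Filter.Eventually.of_forall fun φ _ x hx => ?_
    exact (hasDerivAt_slice a ht hr (hsub hx) φ).mul_const _

theorem continuousOn_mode [Exterior M k I] (a : SmoothFn (region M k I)) (ht : t ∈ I)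
    (hr : rPlus M k < r) (m : ℤ) : ContinuousOn (mode a t r m) (Set.Ioo 0 Real.pi) :=
  fun _ hθ => (hasDerivAt_mode a ht hr m hθ).continuousAt.continuousWithinAt

theorem mode_mul_left {f g : Pt → ℂ} {c : ℂ} {θ : ℝ}
    (h : ∀ φ, f (t, r, θ, φ) = c * g (t, r, θ, φ)) (m : ℤ) :
    mode f t r m θ = c * mode g t r m θ := by
  simp only [mode, h, mul_assoc]
  rw [intervalIntegral.integral_const_mul]

/-- Integration by parts in φ; periodicity of `a` and of the phase cancels the boundary terms. -/
theorem mode_Φ [Exterior M k I] {a : SmoothFn (region M k I)} (ha : a ∈ tame M k I) (ht : t ∈ I)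
    (hr : rPlus M k < r) (m : ℤ) {θ : ℝ} (hθ : θ ∈ Set.Ioo 0 Real.pi) :
    mode ((sphere M k I).Φ a) t r m θ = Complex.I * m * mode a t r m θ := by
  have he : ∀ φ : ℝ, HasDerivAt (fun φ : ℝ => Complex.exp (-(Complex.I * m * (φ : ℂ))))
      (-(Complex.I * m) * Complex.exp (-(Complex.I * m * (φ : ℂ)))) φ := by
    intro φ
    have h1 : HasDerivAt (fun φ : ℝ => -(Complex.I * m * (φ : ℂ))) (-(Complex.I * m * 1)) φ :=
      ((Complex.ofRealCLM.hasDerivAt (x := φ)).const_mul (Complex.I * m)).fun_neg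
    exact h1.cexp.congr_deriv (by ring)
  have h1 := intervalIntegral.integral_eq_sub_of_hasDerivAt (a := 0) (b := 2 * Real.pi)
    (fun φ _ => (hasDerivAt_slice_φ a ht hr hθ φ).fun_mul (he φ))
    (Continuous.intervalIntegrable (by
      refine Continuous.add (continuous_mode_integrand _ ht hr m hθ)
        ((continuous_slice a ht hr hθ).mul ?_)
      fun_prop) _ _)
  have hper : a (t, r, θ, 2 * Real.pi) = a (t, r, θ, 0) := by
    simpa using ha.1 t r θ 0 ⟨ht, hr, hθ⟩
  have hexp : Complex.exp (-(Complex.I * m * ((2 * Real.pi : ℝ) : ℂ)))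
      = Complex.exp (-(Complex.I * m * ((0 : ℝ) : ℂ))) := by
    have : -(Complex.I * m * ((2 * Real.pi : ℝ) : ℂ))
        = ((-m : ℤ) : ℂ) * (2 * Real.pi * Complex.I) := by
      push_cast; ring
    rw [this, Complex.exp_int_mul_two_pi_mul_I]
    simp
  have hc2 : Continuous fun φ : ℝ => a (t, r, θ, φ)
      * (-(Complex.I * m) * Complex.exp (-(Complex.I * m * (φ : ℂ)))) :=
    (continuous_slice a ht hr hθ).mul (by fun_prop)
  rw [hper, hexp, sub_self, intervalIntegral.integral_add
    ((continuous_mode_integrand _ ht hr m hθ).intervalIntegrable _ _)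
    (hc2.intervalIntegrable _ _)] at h1
  have h2 : (∫ φ in (0 : ℝ)..(2 * Real.pi), a (t, r, θ, φ)
      * (-(Complex.I * m) * Complex.exp (-(Complex.I * m * (φ : ℂ)))))
      = -(Complex.I * m) * mode a t r m θ := by
    rw [mode, ← intervalIntegral.integral_const_mul]
    congr 1
    ext φ
    ring
  rw [h2] at h1
  rw [mode]
  linear_combination h1

theorem mode_add {a b : SmoothFn (region M k I)} (ht : t ∈ I)
    (hr : rPlus M k < r) (m : ℤ) {θ : ℝ} (hθ : θ ∈ Set.Ioo 0 Real.pi) :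
    mode (a + b : SmoothFn _) t r m θ = mode a t r m θ + mode b t r m θ := by
  rw [mode, mode, mode, ← intervalIntegral.integral_add
    ((continuous_mode_integrand a ht hr m hθ).intervalIntegrable _ _)
    ((continuous_mode_integrand b ht hr m hθ).intervalIntegrable _ _)]
  congr 1
  ext φ
  rw [add_apply _ _ (show (t, r, θ, φ) ∈ region M k I from ⟨ht, hr, hθ⟩)]
  ring

theorem mode_neg {a : SmoothFn (region M k I)} (ht : t ∈ I)
    (hr : rPlus M k < r) (m : ℤ) {θ : ℝ} (hθ : θ ∈ Set.Ioo 0 Real.pi) :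
    mode (-a : SmoothFn _) t r m θ = -mode a t r m θ := by
  rw [mode_mul_left (c := -1) (g := a) (fun φ => by rw [neg_apply _ (show (t, r, θ, φ) ∈ region M k I from ⟨ht, hr, hθ⟩)]; ring)]
  ring

/-- Tameness gives the bound near the poles, compactness the bound on the remaining closed interval.
-/
theorem bddIoo_mode [Exterior M k I] {a : SmoothFn (region M k I)} (ha : a ∈ tame M k I)
    (ht : t ∈ I) (hr : rPlus M k < r) (m : ℤ) : BddIoo (mode a t r m) := by
  obtain ⟨C, ε, hε, hC⟩ := ha.2 t ht r hr
  have hpi := Real.pi_pos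
  -- Halving makes `δ < ε`, so that every ϑ outside the closed interval [δ, π - δ] lies in the range
  -- of the tame bound.
  set δ := min ε (Real.pi / 2) / 2 with hδ
  have hδ0 : 0 < δ := half_pos (lt_min hε (by positivity))
  have hδε : δ < ε := by
    have := min_le_left ε (Real.pi / 2)
    have := lt_min hε (half_pos hpi)
    linarith
  obtain ⟨C', hC'⟩ := (isCompact_Icc (a := δ) (b := Real.pi - δ)).exists_bound_of_continuousOn
    ((continuousOn_mode a ht hr m).mono (fun x hx => ⟨hδ0.trans_le hx.1, by linarith [hx.2]⟩))
  refine ⟨max (C * |2 * Real.pi - 0|) C', fun θ hθ => ?_⟩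
  by_cases hmid : θ ∈ Set.Icc δ (Real.pi - δ)
  · exact (hC' θ hmid).trans (le_max_right _ _)
  · refine le_trans ?_ (le_max_left _ _)
    apply intervalIntegral.norm_integral_le_of_norm_le_const
    intro φ _
    rw [norm_mul, norm_exp_mode, mul_one]
    refine hC θ hθ ?_ φ
    by_contra! hcon
    exact hmid ⟨by linarith [hcon.1], by linarith [hcon.2]⟩

/-- The derivative of a mode in terms of the mode of `𝓛_n`. -/
theorem hasDerivAt_mode_ed [Exterior M k I] {a : SmoothFn (region M k I)} (ha : a ∈ tame M k I)
    (n : ℤ) (ht : t ∈ I) (hr : rPlus M k < r) (m : ℤ) {θ : ℝ} (hθ : θ ∈ Set.Ioo 0 Real.pi) :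
    HasDerivAt (mode a t r m) (mode ((sphere M k I).ed n a) t r m θ
      + ((m / Real.sin θ - n * (Real.cos θ / Real.sin θ) : ℝ) : ℂ) * mode a t r m θ) θ := by
  have h := hasDerivAt_mode a ht hr m hθ
  convert h using 1
  have hp : ∀ φ, (t, r, θ, φ) ∈ region M k I := fun φ => ⟨ht, hr, hθ⟩
  rw [SphereCalc.ed_def, mode_add ht hr m hθ, mode_add ht hr m hθ,
    mode_mul_left (f := (SphereCalc.ii _ * (sphere M k I).cs * (sphere M k I).Φ a :
        SmoothFn (region M k I))) (c := Complex.I * ((1 / Real.sin θ : ℝ) : ℂ)) (g := (sphere M k I).Φ a)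
      (fun φ => by rw [mul_apply _ _ (hp φ), mul_apply _ _ (hp φ), cs_apply (hp φ), SphereCalc.ii,
        algebraMap_apply _ (hp φ)]),
    mode_mul_left (f := (n * (sphere M k I).ct * a : SmoothFn (region M k I)))
      (c := n * ((Real.cos θ / Real.sin θ : ℝ) : ℂ)) (g := a)
      (fun φ => by rw [mul_apply _ _ (hp φ), mul_apply _ _ (hp φ), ct_apply (hp φ),
        intCast_apply _ (hp φ)]), mode_Φ ha ht hr m hθ]
  push_cast
  linear_combination (1 / Complex.sin θ) * m * mode a t r m θ * Complex.I_sq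

/-- The derivative of a mode in terms of the mode of `𝓛_n^†`. -/
theorem hasDerivAt_mode_dg [Exterior M k I] {a : SmoothFn (region M k I)} (ha : a ∈ tame M k I)
    (n : ℤ) (ht : t ∈ I) (hr : rPlus M k < r) (m : ℤ) {θ : ℝ} (hθ : θ ∈ Set.Ioo 0 Real.pi) :
    HasDerivAt (mode a t r m) (mode ((sphere M k I).dg n a) t r m θ
      + ((-m / Real.sin θ - n * (Real.cos θ / Real.sin θ) : ℝ) : ℂ) * mode a t r m θ) θ := by
  have h := hasDerivAt_mode a ht hr m hθ
  convert h using 1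
  have hp : ∀ φ, (t, r, θ, φ) ∈ region M k I := fun φ => ⟨ht, hr, hθ⟩
  rw [SphereCalc.dg_def, sub_eq_add_neg, mode_add ht hr m hθ, mode_add ht hr m hθ,
    mode_neg ht hr m hθ,
    mode_mul_left (f := (SphereCalc.ii _ * (sphere M k I).cs * (sphere M k I).Φ a :
        SmoothFn (region M k I))) (c := Complex.I * ((1 / Real.sin θ : ℝ) : ℂ)) (g := (sphere M k I).Φ a)
      (fun φ => by rw [mul_apply _ _ (hp φ), mul_apply _ _ (hp φ), cs_apply (hp φ), SphereCalc.ii,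
        algebraMap_apply _ (hp φ)]),
    mode_mul_left (f := (n * (sphere M k I).ct * a : SmoothFn (region M k I)))
      (c := n * ((Real.cos θ / Real.sin θ : ℝ) : ℂ)) (g := a)
      (fun φ => by rw [mul_apply _ _ (hp φ), mul_apply _ _ (hp φ), ct_apply (hp φ),
        intCast_apply _ (hp φ)]), mode_Φ ha ht hr m hθ]
  push_cast
  linear_combination -(1 / Complex.sin θ) * m * mode a t r m θ * Complex.I_sq

/-- A periodic function is determined by its azimuthal modes. -/
theorem eq_zero_of_mode_eq_zero {a : SmoothFn (region M k I)} (ha : a ∈ tame M k I)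
    (h : ∀ t ∈ I, ∀ r, rPlus M k < r → ∀ m : ℤ, ∀ θ ∈ Set.Ioo 0 Real.pi, mode a t r m θ = 0) :
    a = 0 := by
  apply ext_on
  rintro ⟨t, r, θ, φ⟩ hp
  obtain ⟨ht, hr, hθ⟩ := hp
  rw [zero_apply]
  have : Fact (0 < 2 * Real.pi) := ⟨by positivity⟩
  set g : ℝ → ℂ := fun φ => a (t, r, θ, φ) with hg
  have hper : Function.Periodic g (2 * Real.pi) := fun φ => ha.1 t r θ φ ⟨ht, hr, hθ⟩
  have hcont : Continuous g := continuous_slice a ht hr hθ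
  set F : C(AddCircle (2 * Real.pi), ℂ) := ⟨hper.lift, continuous_quot_lift _ hcont⟩ with hF
  have hFx : ∀ x : ℝ, F (x : AddCircle (2 * Real.pi)) = g x := fun x => hper.lift_coe x
  have hco : ∀ m : ℤ, fourierCoeff F m = 0 := by
    intro m
    rw [fourierCoeff_eq_intervalIntegral F m 0]
    have h1 : (∫ x in (0 : ℝ)..(0 + 2 * Real.pi), (fourier (-m) (x : AddCircle (2 * Real.pi)))
        • F x) = mode a t r m θ := by
      rw [mode, zero_add]
      congr 1
      ext φ
      rw [hFx, fourier_coe_apply, smul_eq_mul, mul_comm]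
      congr 2
      have : (Real.pi : ℂ) ≠ 0 := by exact_mod_cast Real.pi_ne_zero
      push_cast
      field_simp
    rw [h1, h t ht r hr m θ hθ, smul_zero]
  -- Summable coefficients make the Fourier series converge to the continuous function `F`; here all
  -- coefficients are zero, so `F = 0`.
  have hsum : Summable (fourierCoeff F) := by
    have : fourierCoeff F = 0 := funext hco
    rw [this]
    exact summable_zero
  have h2 := hasSum_fourier_series_of_summable hsum
  simp only [hco, zero_smul] at h2
  have h3 : F = 0 := h2.unique hasSum_zero
  have h4 := hFx φ
  rw [h3] at h4
  exact h4.symm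

end SmoothFn
namespace SmoothFn

variable {M k : ℝ} {I : Set ℝ} [Exterior M k I]

/-! ### Injectivity of `𝓛(𝓛-2)` on spin weight `2` -/

theorem spinSpace_le_tame {s : ℤ} {a : SmoothFn (region M k I)}
    (ha : a ∈ (sphere M k I).spinSpace (tame M k I) s) : a ∈ tame M k I :=
  SphereCalc.mem_of_mem_spinSpace ha

/-- The eigenvalues of `𝓛` on spin weight `2` are at least `6`. -/
theorem eq_zero_of_lap_eq {h : SmoothFn (region M k I)}
    (hs : h ∈ (sphere M k I).spinSpace (tame M k I) 2) (c : ℝ) (hc : c < 6)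
    (hlap : (sphere M k I).lap 2 h = algebraMap ℂ _ (c : ℂ) * h) : h = 0 := by
  have hs2 : (sphere M k I).ed (-2) h ∈ (sphere M k I).spinSpace (tame M k I) 3 :=
    SphereCalc.ed_mem_spinSpace tame_containsAngular hs rfl rfl
  refine eq_zero_of_mode_eq_zero (spinSpace_le_tame hs) fun t ht r hr m θ₀ hθ₀ => ?_
  set H := mode h t r m with hH
  set K := mode ((sphere M k I).ed (-2) h : SmoothFn (region M k I)) t r m with hK
  have hN : (sphere M k I).dg 3 ((sphere M k I).ed (-2) h)
      = algebraMap ℂ _ ((6 - c : ℝ) : ℂ) * h := by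
    have h1 := (sphere M k I).lap_two_eq_lower_raise h
    rw [hlap] at h1
    rw [Complex.ofReal_sub, map_sub, Complex.ofReal_ofNat, map_ofNat]
    linear_combination h1
  have hdH : ∀ θ ∈ Set.Ioo 0 Real.pi, HasDerivAt H (K θ
      + ((m / Real.sin θ + 2 * (Real.cos θ / Real.sin θ) : ℝ) : ℂ) * H θ) θ := fun θ hθ => by
    have h1 := hasDerivAt_mode_ed (spinSpace_le_tame hs) (-2) ht hr m hθ
    convert h1 using 1
    push_cast
    ring
  have hdK : ∀ θ ∈ Set.Ioo 0 Real.pi, HasDerivAt K ((6 - c : ℝ) * H θ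
      + ((-m / Real.sin θ - 3 * (Real.cos θ / Real.sin θ) : ℝ) : ℂ) * K θ) θ := fun θ hθ => by
    have h1 := hasDerivAt_mode_dg (spinSpace_le_tame hs2) 3 ht hr m hθ
    rw [hN, mode_mul_left (c := ((6 - c : ℝ) : ℂ)) (g := h) (fun φ => by
      have hp : (t, r, θ, φ) ∈ region M k I := ⟨ht, hr, hθ⟩
      rw [mul_apply _ _ hp, algebraMap_apply _ hp])] at h1
    convert h1 using 1
    push_cast
    ring
  -- `W` is the boundary term in pairing `(6 - c) h = dg 3 (ed (-2) h)` with `h`. In its derivative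
  -- the terms in `m` and cot ϑ cancel against cos ϑ, which leaves a nonnegative density when `c <
  -- 6`.
  set W : ℝ → ℂ := fun θ => (Real.sin θ : ℂ) * ((starRingEnd ℂ) (H θ) * K θ) with hW
  have hdW : ∀ θ ∈ Set.Ioo 0 Real.pi, HasDerivAt (fun θ => (W θ).re)
      (Real.sin θ * (‖K θ‖ ^ 2 + (6 - c) * ‖H θ‖ ^ 2)) θ := fun θ hθ => by
    have hsin : (Real.sin θ : ℂ) ≠ 0 := by exact_mod_cast (Real.sin_pos_of_mem_Ioo hθ).ne'
    have hs' : HasDerivAt (fun θ : ℝ => (Real.sin θ : ℂ)) (Real.cos θ : ℂ) θ :=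
      (Real.hasDerivAt_sin θ).ofReal_comp
    have h1 := hs'.fun_mul ((hdH θ hθ).star.fun_mul (hdK θ hθ))
    have h2 := Complex.reCLM.hasFDerivAt.comp_hasDerivAt θ h1
    refine HasDerivAt.congr_deriv h2 ?_
    have key : (Real.cos θ : ℂ) * (star (H θ) * K θ) + (Real.sin θ : ℂ) *
        (star (K θ + ((m / Real.sin θ + 2 * (Real.cos θ / Real.sin θ) : ℝ) : ℂ) * H θ) * K θ
        + star (H θ) * ((6 - c : ℝ) * H θ
          + ((-m / Real.sin θ - 3 * (Real.cos θ / Real.sin θ) : ℝ) : ℂ) * K θ))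
        = ((Real.sin θ * (‖K θ‖ ^ 2 + (6 - c) * ‖H θ‖ ^ 2) : ℝ) : ℂ) := by
      have e1 : star (K θ) * K θ = ((‖K θ‖ ^ 2 : ℝ) : ℂ) := by
        rw [Complex.star_def, Complex.conj_mul']; push_cast; rfl
      have e2 : star (H θ) * H θ = ((‖H θ‖ ^ 2 : ℝ) : ℂ) := by
        rw [Complex.star_def, Complex.conj_mul']; push_cast; rfl
      have e3 : star (((m / Real.sin θ + 2 * (Real.cos θ / Real.sin θ) : ℝ) : ℂ))
          = ((m / Real.sin θ + 2 * (Real.cos θ / Real.sin θ) : ℝ) : ℂ) := by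
        rw [Complex.star_def, Complex.conj_ofReal]
      have e4 : ((Real.sin θ * (‖K θ‖ ^ 2 + (6 - c) * ‖H θ‖ ^ 2) : ℝ) : ℂ)
          = Real.sin θ * (star (K θ) * K θ + (6 - c) * (star (H θ) * H θ)) := by
        rw [e1, e2]; push_cast; ring
      rw [star_add, star_mul', e3, e4]
      push_cast at hsin ⊢
      field_simp
      ring
    simp only [Complex.reCLM_apply]
    rw [key, Complex.ofReal_re]
  have hbdd : BddIoo (fun θ => (starRingEnd ℂ) (H θ) * K θ) :=
    (bddIoo_mode (spinSpace_le_tame hs) ht hr m).conj.mul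
      (bddIoo_mode (spinSpace_le_tame hs2) ht hr m)
  obtain ⟨lim0, limπ⟩ := hbdd.tendsto_sin_mul
  have lim0' : Tendsto (fun θ => (W θ).re) (𝓝[>] 0) (𝓝 0) := by
    have h1 := (Complex.continuous_re.tendsto 0).comp lim0
    rwa [Complex.zero_re] at h1
  have limπ' : Tendsto (fun θ => (W θ).re) (𝓝[<] Real.pi) (𝓝 0) := by
    have h1 := (Complex.continuous_re.tendsto 0).comp limπ
    rwa [Complex.zero_re] at h1
  have hnn : ∀ θ ∈ Set.Ioo 0 Real.pi, 0 ≤ Real.sin θ * (‖K θ‖ ^ 2 + (6 - c) * ‖H θ‖ ^ 2) :=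
    fun θ hθ => by
      have h1 := (Real.sin_pos_of_mem_Ioo hθ).le
      have h2 : 0 ≤ 6 - c := by linarith
      positivity
  have hmono : MonotoneOn (fun θ => (W θ).re) (Set.Ioo 0 Real.pi) := by
    refine monotoneOn_of_deriv_nonneg (convex_Ioo 0 Real.pi)
      (fun θ hθ => (hdW θ hθ).continuousAt.continuousWithinAt)
      (fun θ hθ => ?_) (fun θ hθ => ?_)
    · rw [interior_Ioo] at hθ
      exact (hdW θ hθ).differentiableAt.differentiableWithinAt
    · rw [interior_Ioo] at hθ
      rw [(hdW θ hθ).deriv]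
      exact hnn θ hθ
  -- A monotone function with limit 0 at both ends vanishes, and then so does its derivative, hence
  -- both nonnegative terms of the density.
  have hzero : ∀ θ ∈ Set.Ioo 0 Real.pi, (W θ).re = 0 := by
    intro θ hθ
    apply le_antisymm
    · refine ge_of_tendsto limπ' ?_
      filter_upwards [Ioo_mem_nhdsLT hθ.2] with x hx
      exact hmono hθ ⟨hθ.1.trans hx.1, hx.2⟩ hx.1.le
    · refine le_of_tendsto lim0' ?_
      filter_upwards [Ioo_mem_nhdsGT hθ.1] with x hx
      exact hmono ⟨hx.1, hx.2.trans hθ.2⟩ hθ hx.2.le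
  have hd0 : HasDerivAt (fun θ => (W θ).re) 0 θ₀ :=
    (hasDerivAt_const θ₀ (0 : ℝ)).congr_of_eventuallyEq
      (by filter_upwards [isOpen_Ioo.mem_nhds hθ₀] with x hx using hzero x hx)
  have h0 := hd0.unique (hdW θ₀ hθ₀)
  have hsin := Real.sin_pos_of_mem_Ioo hθ₀
  have h1 : ‖K θ₀‖ ^ 2 + (6 - c) * ‖H θ₀‖ ^ 2 = 0 := by
    rcases mul_eq_zero.1 h0.symm with h | h
    · exact absurd h hsin.ne'
    · exact h
  have h2 : (6 - c) * ‖H θ₀‖ ^ 2 = 0 :=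
    le_antisymm (by nlinarith [sq_nonneg ‖K θ₀‖]) (mul_nonneg (by linarith) (sq_nonneg _))
  have h3 : ‖H θ₀‖ ^ 2 = 0 := by
    rcases mul_eq_zero.1 h2 with h | h
    · linarith
    · exact h
  exact norm_eq_zero.1 (pow_eq_zero_iff (two_ne_zero) |>.1 h3)

theorem lap_two_mem_spinSpace {h : SmoothFn (region M k I)}
    (hs : h ∈ (sphere M k I).spinSpace (tame M k I) 2) :
    (sphere M k I).lap 2 h ∈ (sphere M k I).spinSpace (tame M k I) 2 := by
  rw [SphereCalc.lap_two_eq_raise_lower, two_mul]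
  have h1 : (sphere M k I).dg 2 h ∈ (sphere M k I).spinSpace (tame M k I) 1 :=
    SphereCalc.dg_mem_spinSpace tame_containsAngular hs rfl
  exact Submodule.sub_mem _ (Submodule.add_mem _ hs hs)
    (SphereCalc.ed_mem_spinSpace tame_containsAngular h1 rfl rfl)

/-- A function in the kernel would give eigenfunctions of 𝓛 with eigenvalue 0 or 2, both below 6.
This uniqueness transfers properties of Ψ^D to G. -/
theorem eq_zero_of_lapLap_eq_zero {h : SmoothFn (region M k I)}
    (hs : h ∈ (sphere M k I).spinSpace (tame M k I) 2)
    (h0 : (sphere M k I).lapLap 2 h = 0) : h = 0 := by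
  have hs1 := lap_two_mem_spinSpace hs
  have h1 : (sphere M k I).lap 2 h - 2 * h = 0 := by
    refine eq_zero_of_lap_eq (Submodule.sub_mem _ hs1 ?_) 0 (by norm_num) ?_
    · rw [two_mul]; exact Submodule.add_mem _ hs hs
    · rw [Complex.ofReal_zero, map_zero, zero_mul]; exact h0
  refine eq_zero_of_lap_eq hs 2 (by norm_num) ?_
  rw [Complex.ofReal_ofNat, map_ofNat]
  exact sub_eq_zero.1 h1

end SmoothFn

/-! ### Legendre functions -/

section
open Polynomial

theorem natDegree_iterate_derivative_eq (p : ℝ[X]) (n : ℕ) :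
    (derivative^[n] p).natDegree = p.natDegree - n := by
  induction n with
  | zero => simp
  | succ n ih => rw [Function.iterate_succ_apply', natDegree_derivative, ih, Nat.sub_sub]

theorem natDegree_legendre (ℓ : ℕ) : (legendre ℓ).natDegree = ℓ := by
  have h1 : ((X ^ 2 - 1 : ℝ[X])).natDegree = 2 := by
    simpa using natDegree_X_pow_sub_C (n := 2) (r := (1 : ℝ))
  rw [legendre, natDegree_C_mul (by positivity), natDegree_iterate_derivative_eq, natDegree_pow, h1]
  omega

theorem legendre_ne_zero (ℓ : ℕ) : legendre ℓ ≠ 0 := by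
  rcases Nat.eq_zero_or_pos ℓ with rfl | h
  · simp [legendre]
  · intro h0
    have := natDegree_legendre ℓ
    rw [h0, natDegree_zero] at this
    omega

/-- The exact degree makes these polynomials a triangular family, hence spanning. -/
theorem degree_iterate_derivative_legendre (i j : ℕ) :
    (derivative^[j] (legendre (i + j))).degree = i := by
  have hd : (derivative^[j] (legendre (i + j))).natDegree = i := by
    rw [natDegree_iterate_derivative_eq, natDegree_legendre, Nat.add_sub_cancel]
  -- `natDegree` cannot detect vanishing when `i = 0`. The coefficient of degree `i` is a nonzero
  -- descending factorial times the leading coefficient of the Legendre polynomial.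
  have hne : derivative^[j] (legendre (i + j)) ≠ 0 := by
    intro h0
    have h1 := congrArg (fun p => coeff p i) h0
    simp only [coeff_iterate_derivative, coeff_zero, nsmul_eq_mul] at h1
    rcases mul_eq_zero.1 h1 with h2 | h2
    · have h3 : (i + j).descFactorial j = 0 := by exact_mod_cast h2
      rw [Nat.descFactorial_eq_zero_iff_lt] at h3
      omega
    · have h3 := leadingCoeff_ne_zero.2 (legendre_ne_zero (i + j))
      rw [leadingCoeff, natDegree_legendre] at h3
      exact h3 h2
  rw [degree_eq_natDegree hne, hd]

/-- The polynomials `P_ℓ^{(j)}`, `ℓ ≥ j`, span all polynomials. -/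
theorem span_iterate_derivative_legendre (j : ℕ) :
    Submodule.span ℝ (Set.range fun i => derivative^[j] (legendre (i + j))) = ⊤ := by
  let S : Sequence ℝ := ⟨fun i => derivative^[j] (legendre (i + j)), fun i =>
    degree_iterate_derivative_legendre i j⟩
  exact S.span fun i => (leadingCoeff_ne_zero.2 (S.ne_zero i)).isUnit

/-- A continuous function on `[0, π]` which is orthogonal to all polynomials in `cos ϑ` vanishes. -/
theorem eq_zero_of_integral_cos_eq_zero {u : ℝ → ℝ} (hu : ContinuousOn u (Set.Icc 0 Real.pi))
    (h : ∀ P : ℝ[X], ∫ θ in (0 : ℝ)..Real.pi, u θ * P.eval (Real.cos θ) = 0) :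
    ∀ θ ∈ Set.Icc 0 Real.pi, u θ = 0 := by
  have hpi := Real.pi_pos
  have hui : ∀ {v : ℝ → ℝ}, ContinuousOn v (Set.Icc 0 Real.pi) →
      IntervalIntegrable v MeasureTheory.volume 0 Real.pi := fun hv =>
    ContinuousOn.intervalIntegrable (by rwa [Set.uIcc_of_le hpi.le])
  have hw : ContinuousOn (fun x => u (Real.arccos x)) (Set.Icc (-1) 1) :=
    hu.comp Real.continuous_arccos.continuousOn
      (fun x _ => ⟨Real.arccos_nonneg x, Real.arccos_le_pi x⟩)
  obtain ⟨C, hC⟩ := isCompact_Icc.exists_bound_of_continuousOn hu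
  have hC0 : 0 ≤ C := (norm_nonneg _).trans (hC 0 ⟨le_rfl, hpi.le⟩)
  -- The function `u ∘ arccos` is approximated within `ε` by a polynomial on [-1, 1] (Weierstrass).
  -- Subtracting the vanishing pairing of `u` with that polynomial leaves an integrand at most `C
  -- ε`.
  have hsq : ∀ ε > 0, ∫ θ in (0 : ℝ)..Real.pi, u θ * u θ ≤ C * ε * Real.pi := by
    intro ε hε
    obtain ⟨P, hP⟩ := exists_polynomial_near_of_continuousOn (-1) 1 _ hw ε hε
    have hPc : ContinuousOn (fun θ => u θ * P.eval (Real.cos θ)) (Set.Icc 0 Real.pi) :=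
      hu.mul (P.continuous.comp Real.continuous_cos).continuousOn
    have e1 : ∫ θ in (0 : ℝ)..Real.pi, u θ * u θ
        = ∫ θ in (0 : ℝ)..Real.pi, (u θ * u θ - u θ * P.eval (Real.cos θ)) := by
      rw [intervalIntegral.integral_sub (hui (hu.fun_mul hu)) (hui hPc), h P, sub_zero]
    rw [e1]
    have e2 : ∀ θ ∈ Set.Icc 0 Real.pi,
        u θ * u θ - u θ * P.eval (Real.cos θ) ≤ C * ε := by
      intro θ hθ
      have h1 := hP (Real.cos θ) ⟨Real.neg_one_le_cos θ, Real.cos_le_one θ⟩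
      rw [Real.arccos_cos hθ.1 hθ.2, abs_sub_comm] at h1
      have h2 := hC θ hθ
      rw [Real.norm_eq_abs] at h2
      calc u θ * u θ - u θ * P.eval (Real.cos θ) = u θ * (u θ - P.eval (Real.cos θ)) := by ring
        _ ≤ |u θ * (u θ - P.eval (Real.cos θ))| := le_abs_self _
        _ = |u θ| * |u θ - P.eval (Real.cos θ)| := abs_mul _ _
        _ ≤ C * ε := mul_le_mul h2 h1.le (abs_nonneg _) hC0
    calc _ ≤ ∫ _ in (0 : ℝ)..Real.pi, C * ε :=
          intervalIntegral.integral_mono_on hpi.le (hui ((hu.fun_mul hu).fun_sub hPc))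
            (by simp) e2
      _ = C * ε * Real.pi := by simp; ring
  have hle : ∫ θ in (0 : ℝ)..Real.pi, u θ * u θ ≤ 0 := by
    refine ge_of_tendsto (f := fun ε : ℝ => C * ε * Real.pi) (x := 𝓝[>] 0) ?_
      (eventually_nhdsWithin_of_forall hsq)
    have : Tendsto (fun ε : ℝ => C * ε * Real.pi) (𝓝 0) (𝓝 (C * 0 * Real.pi)) :=
      (by fun_prop : Continuous fun ε : ℝ => C * ε * Real.pi).tendsto 0
    rw [mul_zero, zero_mul] at this
    exact this.mono_left nhdsWithin_le_nhds
  intro θ hθ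
  by_contra hne
  refine absurd (intervalIntegral.integral_pos hpi (hu.fun_mul hu) (fun x _ => mul_self_nonneg _)
    ⟨θ, hθ, mul_self_pos.2 hne⟩) hle.not_gt

/-- The associated Legendre functions of a fixed order are complete. -/
theorem eq_zero_of_integral_assocLegendre_eq_zero {K : ℝ → ℂ} (hb : BddIoo K)
    (hc : ContinuousOn K (Set.Ioo 0 Real.pi)) (j : ℕ)
    (h : ∀ ℓ, j ≤ ℓ → ∫ θ in (0 : ℝ)..Real.pi, Real.sin θ * (K θ * assocLegendre ℓ j θ) = 0) :
    ∀ θ ∈ Set.Ioo 0 Real.pi, K θ = 0 := by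
  have hpi := Real.pi_pos
  -- The factor sin^j turns the pairing with the associated Legendre function into one with a
  -- polynomial in cos ϑ. The remaining factor sin ϑ makes `V` extend continuously by zero to the
  -- poles, although `K` is only bounded.
  set V : ℝ → ℂ := fun θ => Real.sin θ * (Real.sin θ ^ j * K θ) with hV
  have hbj : BddIoo (fun θ => (Real.sin θ : ℂ) ^ j * K θ) :=
    BddIoo.mul (bddIoo_of_continuous (by fun_prop)) hb
  have hVc : ContinuousOn V (Set.Ioo 0 Real.pi) :=
    ContinuousOn.mul (by fun_prop) (ContinuousOn.mul (by fun_prop) hc)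
  set u := extendFrom (Set.Ioo 0 Real.pi) V with hu
  have huc : ContinuousOn u (Set.Icc 0 Real.pi) :=
    continuousOn_Icc_extendFrom_Ioo hVc hbj.tendsto_sin_mul.1 hbj.tendsto_sin_mul.2
  have huV : ∀ θ ∈ Set.Ioo 0 Real.pi, u θ = V θ := extendFrom_extends hVc
  have hint : ∀ P : ℝ[X], IntervalIntegrable (fun θ => u θ * (P.eval (Real.cos θ) : ℝ))
      MeasureTheory.volume 0 Real.pi := fun P =>
    ContinuousOn.intervalIntegrable (by
      rw [Set.uIcc_of_le hpi.le]
      exact huc.mul (Complex.continuous_ofReal.comp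
        (P.continuous.comp Real.continuous_cos)).continuousOn)
  have hall : ∀ P : ℝ[X], ∫ θ in (0 : ℝ)..Real.pi, u θ * (P.eval (Real.cos θ) : ℝ) = 0 := by
    intro P
    have hP : P ∈ Submodule.span ℝ (Set.range fun i => derivative^[j] (legendre (i + j))) := by
      rw [span_iterate_derivative_legendre]; trivial
    induction hP using Submodule.span_induction with
    | mem P hP =>
      obtain ⟨i, rfl⟩ := hP
      rw [← h (i + j) (by omega)]
      refine intervalIntegral.integral_congr_Ioo_of_le hpi.le fun θ hθ => ?_
      simp only
      rw [huV θ hθ, hV, assocLegendre]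
      push_cast
      ring
    | zero => simp
    | add P Q _ _ hP hQ =>
      simp only [eval_add, Complex.ofReal_add, mul_add]
      rw [intervalIntegral.integral_add (hint P) (hint Q), hP, hQ, add_zero]
    | smul c P _ hP =>
      have : ∀ θ, u θ * (((c • P).eval (Real.cos θ) : ℝ) : ℂ)
          = c * (u θ * (P.eval (Real.cos θ) : ℝ)) := fun θ => by
        rw [eval_smul, smul_eq_mul]; push_cast; ring
      simp only [this]
      rw [intervalIntegral.integral_const_mul, hP, mul_zero]
  have hre := eq_zero_of_integral_cos_eq_zero (Complex.continuous_re.comp_continuousOn huc)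
    (fun P => by
      have h1 := Complex.reCLM.intervalIntegral_comp_comm (hint P)
      rw [hall P, map_zero] at h1
      rw [← h1]
      congr 1; ext θ
      simp)
  have him := eq_zero_of_integral_cos_eq_zero (Complex.continuous_im.comp_continuousOn huc)
    (fun P => by
      have h1 := Complex.imCLM.intervalIntegral_comp_comm (hint P)
      rw [hall P, map_zero] at h1
      rw [← h1]
      congr 1; ext θ
      simp)
  intro θ hθ
  have h0 : u θ = 0 := Complex.ext (hre θ (Set.Ioo_subset_Icc_self hθ))
    (him θ (Set.Ioo_subset_Icc_self hθ))
  rw [huV θ hθ] at h0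
  have hs : (Real.sin θ : ℂ) ≠ 0 := by exact_mod_cast (Real.sin_pos_of_mem_Ioo hθ).ne'
  exact ((mul_eq_zero.1 h0).resolve_left hs |> mul_eq_zero.1).resolve_left (pow_ne_zero _ hs)

/-- Raising the spin of `sin^j ϑ Q(cos ϑ)` twice gives bounded functions. -/
theorem exists_raise (Q : ℝ[X]) (m : ℤ) : ∃ a b : ℝ → ℝ, Continuous a ∧ Continuous b ∧
    (∀ θ ∈ Set.Ioo 0 Real.pi,
      HasDerivAt (fun x => Real.sin x ^ m.natAbs * Q.eval (Real.cos x))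
        (a θ + m / Real.sin θ * (Real.sin θ ^ m.natAbs * Q.eval (Real.cos θ))) θ ∧
      HasDerivAt a (b θ + (m / Real.sin θ + Real.cos θ / Real.sin θ) * a θ) θ) ∧
    (Q.natDegree + m.natAbs ≤ 1 → ∀ θ, b θ = 0) := by
  have hd : ∀ (n : ℕ) (P : ℝ[X]), ∀ θ ∈ Set.Ioo 0 Real.pi,
      HasDerivAt (fun x => Real.sin x ^ n * P.eval (Real.cos x))
        (Real.sin θ ^ n * (n * Real.cos θ / Real.sin θ * P.eval (Real.cos θ)
          - Real.sin θ * (derivative P).eval (Real.cos θ))) θ := by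
    intro n P θ hθ
    have hs := (Real.sin_pos_of_mem_Ioo hθ).ne'
    have h1 := (Real.hasDerivAt_sin θ).fun_pow n
    have h2 := (P.hasDerivAt (Real.cos θ)).comp θ (Real.hasDerivAt_cos θ)
    refine (h1.fun_mul h2).congr_deriv ?_
    rcases n with _ | n
    · simp; ring
    · rw [Nat.add_sub_cancel, pow_succ, Function.comp]
      field_simp
      ring
  have hc : ∀ (n : ℕ) (P : ℝ[X]), Continuous fun x => Real.sin x ^ n * P.eval (Real.cos x) :=
    fun n P => (Real.continuous_sin.pow n).mul (P.continuous.comp Real.continuous_cos)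
  have hsq : ∀ θ, Real.sin θ ^ 2 = 1 - Real.cos θ ^ 2 := Real.sin_sq
  -- The factor sin^|m| absorbs both divisions by sin ϑ only if |m| ≥ 2. For |m| = 1 the second one
  -- is absorbed since (cos ϑ + m)(cos ϑ - m) = -sin² ϑ; for m = 0 the derivative of Q(cos ϑ)
  -- supplies a factor sin ϑ and the cot-terms cancel.
  rcases hj : m.natAbs with _ | _ | i
  · have hm : m = 0 := Int.natAbs_eq_zero.1 hj
    subst hm
    refine ⟨fun x => Real.sin x ^ 1 * (-derivative Q).eval (Real.cos x),
      fun x => Real.sin x ^ 2 * (derivative (derivative Q)).eval (Real.cos x), hc _ _, hc _ _,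
      fun θ hθ => ⟨?_, ?_⟩, fun hQ θ => ?_⟩
    · refine (hd 0 Q θ hθ).congr_deriv ?_
      have hs := (Real.sin_pos_of_mem_Ioo hθ).ne'
      simp
    · refine (hd 1 _ θ hθ).congr_deriv ?_
      have hs := (Real.sin_pos_of_mem_Ioo hθ).ne'
      simp
      field_simp
      ring
    · have : derivative (derivative Q) = 0 := by
        have := iterate_derivative_eq_zero (p := Q) (x := 2) (by omega)
        simpa using this
      simp [this]
  · have hm : (m : ℝ) ^ 2 = 1 := by
      have h1 : m ^ 2 = 1 := by rw [← Int.natAbs_sq, hj]; rfl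
      exact_mod_cast h1
    refine ⟨fun x => Real.sin x ^ 0 * ((X - C (m : ℝ)) * Q - (1 - X ^ 2) * derivative Q).eval
        (Real.cos x),
      fun x => Real.sin x ^ 1 * ((2 * C (m : ℝ) - 2 * X) * derivative Q
        + (1 - X ^ 2) * derivative (derivative Q)).eval (Real.cos x), hc _ _, hc _ _,
      fun θ hθ => ⟨?_, ?_⟩, fun hQ θ => ?_⟩
    · refine (hd 1 Q θ hθ).congr_deriv ?_
      have hs := (Real.sin_pos_of_mem_Ioo hθ).ne'
      simp
      field_simp
      linear_combination -(derivative Q).eval (Real.cos θ) * hsq θ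
    · refine (hd 0 _ θ hθ).congr_deriv ?_
      have hs := (Real.sin_pos_of_mem_Ioo hθ).ne'
      simp
      field_simp
      linear_combination -(Q.eval (Real.cos θ) + (Real.cos θ + m) *
        (derivative Q).eval (Real.cos θ)) * hsq θ + Q.eval (Real.cos θ) * hm
    · have : derivative Q = 0 := by
        have := iterate_derivative_eq_zero (p := Q) (x := 1) (by omega)
        simpa using this
      simp [this]
  · refine ⟨fun x => Real.sin x ^ (i + 1) *
        (((i + 2 : ℝ) • X - C (m : ℝ)) * Q - (1 - X ^ 2) * derivative Q).eval (Real.cos x),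
      fun x => Real.sin x ^ i * (((i : ℝ) • X - C (m : ℝ)) *
        (((i + 2 : ℝ) • X - C (m : ℝ)) * Q - (1 - X ^ 2) * derivative Q) - (1 - X ^ 2) *
        derivative (((i + 2 : ℝ) • X - C (m : ℝ)) * Q - (1 - X ^ 2) * derivative Q)).eval
        (Real.cos x), hc _ _, hc _ _,
      fun θ hθ => ⟨?_, ?_⟩, fun hQ θ => by omega⟩
    · refine (hd (i + 2) Q θ hθ).congr_deriv ?_
      have hs := (Real.sin_pos_of_mem_Ioo hθ).ne'
      simp
      field_simp
      linear_combination -(Real.sin θ ^ (i + 2)) * (derivative Q).eval (Real.cos θ) * hsq θ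
    · generalize (((i + 2 : ℝ) • X - C (m : ℝ)) * Q - (1 - X ^ 2) * derivative Q) = R
      refine (hd (i + 1) R θ hθ).congr_deriv ?_
      have hs := (Real.sin_pos_of_mem_Ioo hθ).ne'
      simp
      field_simp
      linear_combination -(Real.sin θ ^ (i + 1)) * (derivative R).eval (Real.cos θ) * hsq θ

end

/-! ### The conjugacy operator -/

/-- Spin lowering is adjoint to spin raising, on azimuthal modes. -/
theorem integral_raise_eq_integral_lower {F F₁ F₂ : ℝ → ℂ} {A a b : ℝ → ℝ} (m : ℝ)
    (hF : BddIoo F) (hF₁ : BddIoo F₁) (hF₂ : BddIoo F₂) (hF₂c : ContinuousOn F₂ (Set.Ioo 0 Real.pi))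
    (hA : Continuous A) (ha : Continuous a) (hb : Continuous b)
    (hdF : ∀ θ ∈ Set.Ioo 0 Real.pi, HasDerivAt F (F₁ θ
      + ((-m / Real.sin θ - 2 * (Real.cos θ / Real.sin θ) : ℝ) : ℂ) * F θ) θ)
    (hdF₁ : ∀ θ ∈ Set.Ioo 0 Real.pi, HasDerivAt F₁ (F₂ θ
      + ((-m / Real.sin θ - Real.cos θ / Real.sin θ : ℝ) : ℂ) * F₁ θ) θ)
    (hdA : ∀ θ ∈ Set.Ioo 0 Real.pi, HasDerivAt A (a θ + m / Real.sin θ * A θ) θ)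
    (hda : ∀ θ ∈ Set.Ioo 0 Real.pi, HasDerivAt a
      (b θ + (m / Real.sin θ + Real.cos θ / Real.sin θ) * a θ) θ) :
    ∫ θ in (0 : ℝ)..Real.pi, Real.sin θ * (F θ * b θ)
      = ∫ θ in (0 : ℝ)..Real.pi, Real.sin θ * (F₂ θ * A θ) := by
  have hpi := Real.pi_pos
  have real_bdd : ∀ {u : ℝ → ℝ}, Continuous u → BddIoo fun θ => (u θ : ℂ) := fun hu =>
    bddIoo_of_continuous (Complex.continuous_ofReal.comp hu)
  -- The antiderivative is `sin (F a - F₁ A)`: differentiating, the terms `F₁ a` and all terms in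
  -- cot ϑ and `m` cancel, and what is left is the difference of the two integrands.
  have hW := ((hF.mul (real_bdd ha)).sub (hF₁.mul (real_bdd hA))).tendsto_sin_mul
  have real_cont : ∀ {u : ℝ → ℝ}, Continuous u →
      ContinuousOn (fun θ => (u θ : ℂ)) (Set.Ioo 0 Real.pi) := fun hu =>
    (Complex.continuous_ofReal.comp hu).continuousOn
  have hFc : ContinuousOn F (Set.Ioo 0 Real.pi) := fun θ hθ =>
    (hdF θ hθ).continuousAt.continuousWithinAt
  have hi1 : IntervalIntegrable (fun θ => Real.sin θ * (F θ * b θ)) MeasureTheory.volume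
      0 Real.pi :=
    BddIoo.intervalIntegrable ((real_bdd Real.continuous_sin).mul (hF.mul (real_bdd hb)))
      ((real_cont Real.continuous_sin).mul (hFc.mul (real_cont hb)))
  have hi2 : IntervalIntegrable (fun θ => Real.sin θ * (F₂ θ * A θ)) MeasureTheory.volume
      0 Real.pi :=
    BddIoo.intervalIntegrable ((real_bdd Real.continuous_sin).mul (hF₂.mul (real_bdd hA)))
      ((real_cont Real.continuous_sin).mul (hF₂c.mul (real_cont hA)))
  have h1 := intervalIntegral.integral_eq_sub_of_hasDerivAt_of_tendsto hpi
    (f' := fun θ => Real.sin θ * (F θ * b θ) - Real.sin θ * (F₂ θ * A θ)) (fun θ hθ => ?_)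
    (hi1.sub hi2) hW.1 hW.2
  · rw [intervalIntegral.integral_sub hi1 hi2, sub_self] at h1
    exact sub_eq_zero.1 h1
  · have hs : (Real.sin θ : ℂ) ≠ 0 := by exact_mod_cast (Real.sin_pos_of_mem_Ioo hθ).ne'
    have h2 := (Real.hasDerivAt_sin θ).ofReal_comp.fun_mul
      (((hdF θ hθ).fun_mul (hda θ hθ).ofReal_comp).fun_sub
        ((hdF₁ θ hθ).fun_mul (hdA θ hθ).ofReal_comp))
    refine h2.congr_deriv ?_
    push_cast at hs ⊢
    field_simp
    ring

/-- The normalisation of `spinS`. -/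
def spinNorm (ℓ j : ℕ) : ℝ :=
  Real.sqrt ((2 * ℓ + 1) / (4 * Real.pi)
      * ((Nat.factorial (ℓ - j) : ℝ) / (Nat.factorial (ℓ + j) : ℝ))
      * ((Nat.factorial (ℓ - 2) : ℝ) / (Nat.factorial (ℓ + 2) : ℝ)))

theorem spinNorm_pos (ℓ j : ℕ) : 0 < spinNorm ℓ j := by
  have := Real.pi_pos
  exact Real.sqrt_pos.2 (by positivity)

theorem edthMode_eq {n m : ℤ} {g : ℝ → ℝ} {g' θ : ℝ} (h : HasDerivAt g g' θ) :
    edthMode n m g θ = g' - m / Real.sin θ * g θ + n * (Real.cos θ / Real.sin θ) * g θ := by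
  rw [edthMode, h.deriv]

/-- `spinS` applies `edthMode` to a function which is identified only on (0, π); openness suffices
to compare derivatives. -/
theorem edthMode_congr {n m : ℤ} {g h : ℝ → ℝ} {s : Set ℝ} (hs : IsOpen s)
    (hgh : ∀ θ ∈ s, g θ = h θ) {θ : ℝ} (hθ : θ ∈ s) : edthMode n m g θ = edthMode n m h θ := by
  have : g =ᶠ[𝓝 θ] h := by
    filter_upwards [hs.mem_nhds hθ] with x hx using hgh x hx
  rw [edthMode, edthMode, this.deriv_eq, hgh θ hθ]

theorem spinS_eq {m : ℤ} {ℓ : ℕ} {a b : ℝ → ℝ}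
    (h : ∀ θ ∈ Set.Ioo 0 Real.pi,
      HasDerivAt (assocLegendre ℓ m.natAbs)
        (a θ + m / Real.sin θ * assocLegendre ℓ m.natAbs θ) θ ∧
      HasDerivAt a (b θ + (m / Real.sin θ + Real.cos θ / Real.sin θ) * a θ) θ)
    {θ : ℝ} (hθ : θ ∈ Set.Ioo 0 Real.pi) : spinS m ℓ θ = spinNorm ℓ m.natAbs * b θ := by
  have h1 : ∀ x ∈ Set.Ioo 0 Real.pi, edthMode 0 m (assocLegendre ℓ m.natAbs) x = a x :=
    fun x hx => by
      rw [edthMode_eq (h x hx).1]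
      push_cast
      ring
  rw [spinS, edthMode_congr isOpen_Ioo h1 hθ, edthMode_eq (h θ hθ).2, spinNorm]
  push_cast
  ring

namespace SmoothFn

variable {M k : ℝ} {I : Set ℝ} [Exterior M k I] {t r : ℝ}

theorem continuous_assocLegendre (ℓ j : ℕ) : Continuous (assocLegendre ℓ j) :=
  (Real.continuous_sin.pow j).mul ((Polynomial.continuous _).comp Real.continuous_cos)

theorem integral_inner_eq {f : Pt → ℂ} {a : SmoothFn (region M k I)} (hf : Rep f a) (ht : t ∈ I)
    (hr : rPlus M k < r) (m : ℤ) {S b : ℝ → ℝ} {N : ℝ}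
    (hS : ∀ θ ∈ Set.Ioo 0 Real.pi, S θ = N * b θ) :
    (∫ θ in (0 : ℝ)..Real.pi, ∫ φ in (0 : ℝ)..(2 * Real.pi),
      f (t, r, θ, φ) * ((S θ : ℂ) * Complex.exp (-(Complex.I * m * (φ : ℂ))))
        * (Real.sin θ : ℂ))
      = N * ∫ θ in (0 : ℝ)..Real.pi, Real.sin θ * (mode a t r m θ * b θ) := by
  rw [← intervalIntegral.integral_const_mul]
  refine intervalIntegral.integral_congr_Ioo_of_le Real.pi_pos.le fun θ hθ => ?_
  rw [mode, mul_left_comm (N : ℂ), mul_comm _ (b θ : ℂ), ← mul_assoc (N : ℂ), ← mul_assoc,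
    ← intervalIntegral.integral_const_mul]
  congr 1
  ext φ
  rw [hf _ ⟨ht, hr, hθ⟩, hS θ hθ]
  push_cast
  ring

section
variable {a : SmoothFn (region M k I)}

/-- The harmonic is a twice raised scalar one, so the two raisings are moved onto `f` by integration
by parts and become lowerings to spin 0. For ℓ ≤ 1 raising gives zero, which supplies the missing
conditions: completeness of Legendre functions needs every ℓ ≥ |m|, not only ℓ ≥ 2. -/
theorem coeffPlus_eq {f : Pt → ℂ} (hf : Rep f a)
    (ha : a ∈ (sphere M k I).spinSpace (tame M k I) 2) (ht : t ∈ I) (hr : rPlus M k < r) (m : ℤ)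
    (ℓ : ℕ) : coeffPlus f t r m ℓ = spinNorm ℓ m.natAbs * ∫ θ in (0 : ℝ)..Real.pi,
      Real.sin θ * (mode ((sphere M k I).dg 1 ((sphere M k I).dg 2 a) : SmoothFn (region M k I)) t r m θ
        * assocLegendre ℓ m.natAbs θ) ∧
    (ℓ ≤ 1 → m.natAbs ≤ ℓ → ∫ θ in (0 : ℝ)..Real.pi,
      Real.sin θ * (mode ((sphere M k I).dg 1 ((sphere M k I).dg 2 a) : SmoothFn (region M k I)) t r m θ
        * assocLegendre ℓ m.natAbs θ) = 0) := by
  have h1 : (sphere M k I).dg 2 a ∈ (sphere M k I).spinSpace (tame M k I) 1 :=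
    SphereCalc.dg_mem_spinSpace tame_containsAngular ha rfl
  have h2 : (sphere M k I).dg 1 ((sphere M k I).dg 2 a) ∈
      (sphere M k I).spinSpace (tame M k I) 0 :=
    SphereCalc.dg_mem_spinSpace tame_containsAngular h1 rfl
  obtain ⟨u, b, hu, hb, hd, h0⟩ :=
    exists_raise (Polynomial.derivative^[m.natAbs] (legendre ℓ)) m
  have key := integral_raise_eq_integral_lower (m : ℝ) (bddIoo_mode (spinSpace_le_tame ha) ht hr m)
    (bddIoo_mode (spinSpace_le_tame h1) ht hr m) (bddIoo_mode (spinSpace_le_tame h2) ht hr m)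
    (continuousOn_mode _ ht hr m) (continuous_assocLegendre ℓ m.natAbs) hu hb
    (fun θ hθ => by
      simpa using hasDerivAt_mode_dg (spinSpace_le_tame ha) 2 ht hr m hθ)
    (fun θ hθ => by
      simpa using hasDerivAt_mode_dg (spinSpace_le_tame h1) 1 ht hr m hθ)
    (fun θ hθ => (hd θ hθ).1) (fun θ hθ => (hd θ hθ).2)
  rw [← key]
  refine ⟨integral_inner_eq hf ht hr m fun θ hθ => spinS_eq hd hθ, fun hℓ hm => ?_⟩
  -- The degree ℓ - |m| of the polynomial factor plus |m| equals ℓ, which is at most 1.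
  have hb0 := h0 (by rw [natDegree_iterate_derivative_eq, natDegree_legendre]; omega)
  simp [hb0]

/-- The index `-m` compensates the phase e^{-imφ} of the spin -2 basis, so that the same azimuthal
mode `m`, the same Legendre function and the same normalisation occur as in `coeffPlus_eq`. Equality
of coefficients thus becomes equality of spin-0 pairings. -/
theorem coeffMinus_eq {f : Pt → ℂ} (hf : Rep f a)
    (ha : a ∈ (sphere M k I).spinSpace (tame M k I) (-2)) (ht : t ∈ I) (hr : rPlus M k < r) (m : ℤ)
    (ℓ : ℕ) : coeffMinus f t r (-m) ℓ = spinNorm ℓ m.natAbs * ∫ θ in (0 : ℝ)..Real.pi,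
      Real.sin θ * (mode ((sphere M k I).ed 1 ((sphere M k I).ed 2 a) : SmoothFn (region M k I)) t r m θ
        * assocLegendre ℓ m.natAbs θ) ∧
    (ℓ ≤ 1 → m.natAbs ≤ ℓ → ∫ θ in (0 : ℝ)..Real.pi,
      Real.sin θ * (mode ((sphere M k I).ed 1 ((sphere M k I).ed 2 a) : SmoothFn (region M k I)) t r m θ
        * assocLegendre ℓ m.natAbs θ) = 0) := by
  have h1 : (sphere M k I).ed 2 a ∈ (sphere M k I).spinSpace (tame M k I) (-1) :=
    SphereCalc.ed_mem_spinSpace tame_containsAngular ha rfl rfl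
  have h2 : (sphere M k I).ed 1 ((sphere M k I).ed 2 a) ∈
      (sphere M k I).spinSpace (tame M k I) 0 :=
    SphereCalc.ed_mem_spinSpace tame_containsAngular h1 rfl rfl
  -- On mode `m`, `ed` has the azimuthal sign that `dg` has on mode `-m`, so the adjointness lemma
  -- is used with `-m`.
  rw [← Int.natAbs_neg m]
  obtain ⟨u, b, hu, hb, hd, h0⟩ :=
    exists_raise (Polynomial.derivative^[(-m).natAbs] (legendre ℓ)) (-m)
  have key := integral_raise_eq_integral_lower ((-m : ℤ) : ℝ)
    (bddIoo_mode (spinSpace_le_tame ha) ht hr m)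
    (bddIoo_mode (spinSpace_le_tame h1) ht hr m) (bddIoo_mode (spinSpace_le_tame h2) ht hr m)
    (continuousOn_mode _ ht hr m) (continuous_assocLegendre ℓ (-m).natAbs) hu hb
    (fun θ hθ => by
      simpa using hasDerivAt_mode_ed (spinSpace_le_tame ha) 2 ht hr m hθ)
    (fun θ hθ => by
      simpa using hasDerivAt_mode_ed (spinSpace_le_tame h1) 1 ht hr m hθ)
    (fun θ hθ => (hd θ hθ).1) (fun θ hθ => (hd θ hθ).2)
  rw [← key]
  refine ⟨?_, fun hℓ hm => ?_⟩
  · rw [← integral_inner_eq hf ht hr m fun θ hθ => spinS_eq hd hθ, coeffMinus]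
    simp
  · have hb0 := h0 (by rw [natDegree_iterate_derivative_eq, natDegree_legendre]; omega)
    simp [hb0]

/-- The conjugacy operator is local after lowering the spin to `0`. -/
theorem ed_ed_eq_dg_dg_of_isConjugacy {f g : Pt → ℂ} {b : SmoothFn (region M k I)} (hf : Rep f a)
    (ha : a ∈ (sphere M k I).spinSpace (tame M k I) 2) (hg : Rep g b) (h : IsConjugacy M k I f g) :
    (sphere M k I).ed 1 ((sphere M k I).ed 2 b) = (sphere M k I).dg 1 ((sphere M k I).dg 2 a) := by
  have hb : b ∈ (sphere M k I).spinSpace (tame M k I) (-2) :=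
    mem_spinSpace_of_isSmoothSpin h.1 hg 0 0
  have e1 : (sphere M k I).ed 1 ((sphere M k I).ed 2 b) ∈
      (sphere M k I).spinSpace (tame M k I) 0 :=
    SphereCalc.ed_mem_spinSpace tame_containsAngular
      (SphereCalc.ed_mem_spinSpace (s' := -1) tame_containsAngular hb rfl rfl) rfl rfl
  have e2 : (sphere M k I).dg 1 ((sphere M k I).dg 2 a) ∈
      (sphere M k I).spinSpace (tame M k I) 0 :=
    SphereCalc.dg_mem_spinSpace tame_containsAngular
      (SphereCalc.dg_mem_spinSpace (s' := 1) tame_containsAngular ha rfl) rfl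
  rw [← sub_eq_zero, sub_eq_add_neg]
  refine eq_zero_of_mode_eq_zero (spinSpace_le_tame
    (Submodule.add_mem _ e1 (Submodule.neg_mem _ e2))) fun t ht r hr m θ hθ => ?_
  rw [mode_add ht hr m hθ, mode_neg ht hr m hθ, ← sub_eq_add_neg]
  have be1 := bddIoo_mode (spinSpace_le_tame e1) ht hr m
  have be2 := bddIoo_mode (spinSpace_le_tame e2) ht hr m
  refine eq_zero_of_integral_assocLegendre_eq_zero (be1.sub be2)
    ((continuousOn_mode _ ht hr m).sub (continuousOn_mode _ ht hr m)) m.natAbs (fun ℓ hℓ => ?_) θ hθ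
  have hP := coeffPlus_eq hf ha ht hr m ℓ
  have hM := coeffMinus_eq hg hb ht hr m ℓ
  have hLb : BddIoo fun θ => (assocLegendre ℓ m.natAbs θ : ℂ) :=
    bddIoo_of_continuous (Complex.continuous_ofReal.comp (continuous_assocLegendre ℓ m.natAbs))
  have hsb : BddIoo fun θ => (Real.sin θ : ℂ) := bddIoo_of_continuous (by fun_prop)
  have hLc : ContinuousOn (fun θ => (assocLegendre ℓ m.natAbs θ : ℂ)) (Set.Ioo 0 Real.pi) :=
    (Complex.continuous_ofReal.comp (continuous_assocLegendre ℓ m.natAbs)).continuousOn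
  have hsc : ContinuousOn (fun θ => (Real.sin θ : ℂ)) (Set.Ioo 0 Real.pi) := by fun_prop
  simp only [sub_mul, mul_sub]
  rw [intervalIntegral.integral_sub
    ((hsb.mul (be1.mul hLb)).intervalIntegrable
      (hsc.mul ((continuousOn_mode _ ht hr m).mul hLc)))
    ((hsb.mul (be2.mul hLb)).intervalIntegrable
      (hsc.mul ((continuousOn_mode _ ht hr m).mul hLc)))]
  -- Below ℓ = 2 both pairings are zero; from ℓ = 2 on they agree by the definition of 𝓒, after
  -- division by the nonzero normalisation.
  rcases Nat.lt_or_ge ℓ 2 with h2 | h2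
  · rw [hP.2 (by omega) hℓ, hM.2 (by omega) hℓ, sub_zero]
  · have h3 := h.2 t ht r hr ℓ m h2 hℓ
    rw [hP.1, hM.1] at h3
    have hN : (spinNorm ℓ m.natAbs : ℂ) ≠ 0 := by exact_mod_cast (spinNorm_pos ℓ m.natAbs).ne'
    exact sub_eq_zero.2 (mul_left_cancel₀ hN h3)

end
end SmoothFn

/-! ### The antilinear operator K = 𝓛_{-1} 𝓛_0 𝓛_1 𝓛_2 ∘ conjugation -/

namespace SphereCalc

variable {A : Type*} [CommRing A] [Algebra ℂ A] (S : SphereCalc A)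

theorem lapLap_add (s : ℤ) (f g : A) : S.lapLap s (f + g) = S.lapLap s f + S.lapLap s g := by
  simp only [lapLap, map_add, map_sub, mul_add]
  ring

theorem lapLap_neg (s : ℤ) (f : A) : S.lapLap s (-f) = -S.lapLap s f := by
  simp only [lapLap, map_neg, map_sub, mul_neg]
  ring

theorem lapLap_sub (s : ℤ) (f g : A) : S.lapLap s (f - g) = S.lapLap s f - S.lapLap s g := by
  rw [sub_eq_add_neg, lapLap_add, lapLap_neg, sub_eq_add_neg]

theorem lap_lapLap (s : ℤ) (f : A) : S.lap s (S.lapLap s f) = S.lapLap s (S.lap s f) := by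
  simp only [lapLap, map_sub, linear_ofNat_mul (S.lap s) 2]

/-- The operator `𝓛_{-1} 𝓛_0 𝓛_1 𝓛_2` composed with a conjugation. -/
def edConj (cj : A →+* A) (f : A) : A := S.ed (-1) (S.ed 0 (S.ed 1 (S.ed 2 (cj f))))

variable {S} {cj : A →+* A}

theorem edConj_add (f g : A) : S.edConj cj (f + g) = S.edConj cj f + S.edConj cj g := by
  simp only [edConj, map_add, ed_add]

theorem edConj_neg (f : A) : S.edConj cj (-f) = -S.edConj cj f := by
  simp only [edConj, map_neg, ed_neg]

theorem edConj_sub (f g : A) : S.edConj cj (f - g) = S.edConj cj f - S.edConj cj g := by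
  rw [sub_eq_add_neg, edConj_add, edConj_neg, sub_eq_add_neg]

theorem AngularLinear.edConj {P : A →ₗ[ℂ] A} (hP : S.AngularLinear P)
    (hc : ∀ f, P (cj f) = cj (P f)) (f : A) : P (S.edConj cj f) = S.edConj cj (P f) := by
  simp only [SphereCalc.edConj, hP.ed, hc]

theorem IsConj.edConj_eq (h : S.IsConj cj) (f : A) :
    S.edConj cj f = S.ed (-1) (S.ed 0 (cj (S.dg 1 (S.dg 2 f)))) := by
  rw [edConj, h.dg, h.dg]

/-- `𝓛(𝓛-2)` commutes with `𝓛_{-1} 𝓛_0 𝓛_1 𝓛_2` composed with the conjugation. -/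
theorem IsConj.lapLap_edConj (h : S.IsConj cj) (f : A) :
    S.lapLap 2 (S.edConj cj f) = S.edConj cj (S.lapLap 2 f) := by
  -- Both sides are `ed (-1) (ed 0 ·)` around a conjugation and the operator 𝓛_1^† 𝓛_2^† 𝓛_{-1} 𝓛_0,
  -- whose reality on spin weight 0 allows the two to be exchanged.
  rw [h.edConj_eq, h.edConj_eq, lapLap_two_eq, lapLap_two_eq, h.dg_dg_ed_ed]

end SphereCalc

namespace SmoothFn

variable {M k : ℝ} {I : Set ℝ} [Exterior M k I]

/-! ### Conjugation symmetries and local operators -/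

section
variable {a : SmoothFn (region M k I)} {f : Pt → ℂ}

/-- Here 𝓒 f = -f^*, so locality of 𝓒 at spin 0 reads 𝓛_1 𝓛_2 f^* = -𝓛_1^† 𝓛_2^† f, and raising
twice gives a local form of the symmetry. -/
theorem edConj_eq_neg_of_symPartVanishes (hf : Rep f a)
    (ha : a ∈ (sphere M k I).spinSpace (tame M k I) 2) (h : SymPartVanishes M k I f) :
    (sphere M k I).edConj conj a = -(sphere M k I).lapLap 2 a := by
  obtain ⟨g, hg, h0⟩ := h
  have hgr : Rep g (-conj a) := fun p hp => by
    have h1 := h0 p hp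
    rw [hf p hp, RWTS.conjF] at h1
    have h2 : (starRingEnd ℂ) (g p) = -a p := by linear_combination 2 * h1
    rw [neg_apply _ hp, conj_apply _ hp, ← map_neg, ← h2, Complex.conj_conj]
  have h1 := ed_ed_eq_dg_dg_of_isConjugacy hf ha hgr hg
  rw [SphereCalc.ed_neg, SphereCalc.ed_neg] at h1
  rw [SphereCalc.lapLap_two_eq, ← h1, SphereCalc.ed_neg, SphereCalc.ed_neg, neg_neg,
    SphereCalc.edConj]

theorem edConj_eq_of_antiPartVanishes (hf : Rep f a)
    (ha : a ∈ (sphere M k I).spinSpace (tame M k I) 2) (h : AntiPartVanishes M k I f) :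
    (sphere M k I).edConj conj a = (sphere M k I).lapLap 2 a := by
  obtain ⟨g, hg, h0⟩ := h
  have hgr : Rep g (conj a) := fun p hp => by
    have h1 := h0 p hp
    rw [hf p hp, RWTS.conjF] at h1
    have h2 : (starRingEnd ℂ) (g p) = a p := by linear_combination -2 * h1
    rw [conj_apply _ hp, ← h2, Complex.conj_conj]
  rw [SphereCalc.lapLap_two_eq, ← ed_ed_eq_dg_dg_of_isConjugacy hf ha hgr hg, SphereCalc.edConj]

end

theorem dt_conj (f : SmoothFn (region M k I)) : dt M k I (conj f) = conj (dt M k I f) :=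
  (conj_pd _ _).symm

theorem edConj_mem_spinSpace {f : SmoothFn (region M k I)}
    (hf : f ∈ (sphere M k I).spinSpace (tame M k I) 2) :
    (sphere M k I).edConj conj f ∈ (sphere M k I).spinSpace (tame M k I) 2 := by
  have h0 := SphereCalc.conj_mem_spinSpace (sphere_isConj M k I) (fun _ => conj_mem_tame) hf
  exact SphereCalc.ed_mem_spinSpace (s := 1) tame_containsAngular
    (SphereCalc.ed_mem_spinSpace (s := 0) tame_containsAngular
      (SphereCalc.ed_mem_spinSpace (s := -1) tame_containsAngular
        (SphereCalc.ed_mem_spinSpace (s := -2) tame_containsAngular h0 rfl rfl) rfl rfl) rfl rfl)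
    rfl rfl

theorem lapLap_mem_spinSpace {f : SmoothFn (region M k I)}
    (hf : f ∈ (sphere M k I).spinSpace (tame M k I) 2) :
    (sphere M k I).lapLap 2 f ∈ (sphere M k I).spinSpace (tame M k I) 2 := by
  refine lap_two_mem_spinSpace (Submodule.sub_mem _ (lap_two_mem_spinSpace hf) ?_)
  rw [two_mul]
  exact Submodule.add_mem _ hf hf

/-- The symmetry of `Ψ` is inherited by `(𝓛(𝓛-2))⁻¹ ∂_t Ψ`. -/
theorem edConj_inverse_eq_neg {f g : SmoothFn (region M k I)}
    (hg : g ∈ (sphere M k I).spinSpace (tame M k I) 2)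
    (hf : (sphere M k I).edConj conj f = -(sphere M k I).lapLap 2 f)
    (h : (sphere M k I).lapLap 2 g = dt M k I f) :
    (sphere M k I).edConj conj g = -(sphere M k I).lapLap 2 g := by
  rw [eq_neg_iff_add_eq_zero]
  refine eq_zero_of_lapLap_eq_zero
    (Submodule.add_mem _ (edConj_mem_spinSpace hg) (lapLap_mem_spinSpace hg)) ?_
  have h1 : ∀ x, dt M k I ((sphere M k I).edConj conj x)
      = (sphere M k I).edConj conj (dt M k I x) :=
    dt_angularLinear.edConj dt_conj
  have h2 : ∀ x, dt M k I ((sphere M k I).lapLap 2 x) = (sphere M k I).lapLap 2 (dt M k I x) :=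
    dt_angularLinear.lapLap 2
  -- Λ (K g + Λ g) = K (T f) + Λ (T f) = T (K f + Λ f) = 0, and Λ is injective.
  rw [SphereCalc.lapLap_add, (sphere_isConj M k I).lapLap_edConj, h, ← h1, ← h2, hf, map_neg,
    neg_add_cancel]

/-! ### The Regge-Wheeler operator -/

section
variable (M k I)

theorem rw_angularLinear :
    (sphere M k I).AngularLinear (LinearMap.mulLeft ℂ (rw M k I)) :=
  .mulLeft (Θ_ofR _ _) (Φ_ofR _ _)

theorem rq_angularLinear :
    (sphere M k I).AngularLinear (LinearMap.mulLeft ℂ (rq M k I)) :=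
  .mulLeft (Θ_ofR _ _) (Φ_ofR _ _)

theorem rv_angularLinear :
    (sphere M k I).AngularLinear (LinearMap.mulLeft ℂ (rv M k I)) :=
  .mulLeft (Θ_ofR _ _) (Φ_ofR _ _)

end

/-- The Regge-Wheeler operator for spin weight `2`. -/
def wave (f : SmoothFn (region M k I)) : SmoothFn (region M k I) :=
  dt M k I (dt M k I f) - dx M k I (dx M k I f)
    + rw M k I * ((sphere M k I).lap 2 f - rq M k I * f)

theorem wave_add (f g : SmoothFn (region M k I)) : wave (f + g) = wave f + wave g := by
  simp only [wave, map_add, mul_add]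
  ring

theorem wave_neg (f : SmoothFn (region M k I)) : wave (-f) = -wave f := by
  simp only [wave, map_neg, mul_neg]
  ring

theorem wave_algebraMap_mul (c : ℂ) (f : SmoothFn (region M k I)) :
    wave (algebraMap ℂ _ c * f) = algebraMap ℂ _ c * wave f := by
  simp only [wave, SphereCalc.linear_algebraMap_mul, Derivation.leibniz, Derivation.map_algebraMap,
    smul_eq_mul, mul_zero, add_zero]
  ring

theorem dt_wave (f : SmoothFn (region M k I)) : dt M k I (wave f) = wave (dt M k I f) := by
  have h1 : ∀ x, dt M k I ((sphere M k I).lap 2 x) = (sphere M k I).lap 2 (dt M k I x) :=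
    dt_angularLinear.lap 2
  have hw : dt M k I (rw M k I) = 0 := dt_ofR _ _
  have hq : dt M k I (rq M k I) = 0 := dt_ofR _ _
  simp only [wave, map_add, map_sub, Derivation.leibniz, smul_eq_mul, hw, hq, dt_dx, h1]
  ring

theorem lapLap_wave (f : SmoothFn (region M k I)) :
    (sphere M k I).lapLap 2 (wave f) = wave ((sphere M k I).lapLap 2 f) := by
  have ht : ∀ x, dt M k I ((sphere M k I).lapLap 2 x) = (sphere M k I).lapLap 2 (dt M k I x) :=
    dt_angularLinear.lapLap 2
  have hx : ∀ x, dx M k I ((sphere M k I).lapLap 2 x) = (sphere M k I).lapLap 2 (dx M k I x) :=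
    dx_angularLinear.lapLap 2
  have hw : ∀ x, rw M k I * (sphere M k I).lapLap 2 x = (sphere M k I).lapLap 2 (rw M k I * x) :=
    (rw_angularLinear M k I).lapLap 2
  have hq : ∀ x, rq M k I * (sphere M k I).lapLap 2 x = (sphere M k I).lapLap 2 (rq M k I * x) :=
    (rq_angularLinear M k I).lapLap 2
  simp only [wave, SphereCalc.lapLap_add, SphereCalc.lapLap_sub, ht, hx, SphereCalc.lap_lapLap, hq,
    ← hw]

theorem dr_ofR_eq (g : ℝ → ℝ) (hg : ContDiffOn ℝ ∞ g (Set.Ioi (rPlus M k))) :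
    dr M k I (ofR M k I g hg)
      = ofR M k I (deriv g) (hg.deriv_of_isOpen isOpen_Ioi (by simp)) :=
  ext_on fun p hp => by
    have h := ((hg.differentiableOn (by simp)).differentiableAt
      (Ioi_mem_nhds hp.2.1)).hasDerivAt
    rw [dr_ofR g hg hp h, ofR_apply _ _ hp]

theorem ofR_mul_mem_spinSpace {s : ℤ} (g : ℝ → ℝ) (hg : ContDiffOn ℝ ∞ g (Set.Ioi (rPlus M k)))
    {f : SmoothFn (region M k I)} (hf : f ∈ (sphere M k I).spinSpace (tame M k I) s) :
    ofR M k I g hg * f ∈ (sphere M k I).spinSpace (tame M k I) s :=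
  SphereCalc.map_mem_spinSpace (P := LinearMap.mulLeft ℂ (ofR M k I g hg))
    (.mulLeft (Θ_ofR _ _) (Φ_ofR _ _)) (fun _ h => mul_mem (ofR_mem_tame g hg) h) hf

/-- Injectivity of Λ is to be applied to the wave operator of G, which must therefore have tame
angular derivatives. -/
theorem wave_mem_spinSpace {f : Pt → ℂ} (hf : IsSmoothSpin M k I 2 f)
    {a : SmoothFn (region M k I)} (ha : Rep f a) :
    wave a ∈ (sphere M k I).spinSpace (tame M k I) 2 := by
  have h := fun i j => mem_spinSpace_of_isSmoothSpin hf ha i j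
  have h0 : a ∈ _ := h 0 0
  have h1 : dt M k I a ∈ _ := h 1 0
  have h2 : dt M k I (dt M k I a) ∈ _ := h 2 0
  have h3 : dr M k I a ∈ _ := h 0 1
  have h4 : dr M k I (dr M k I a) ∈ _ := h 0 2
  have h5 : dr M k I (dt M k I a) ∈ _ := dt_dr a ▸ h 1 1
  have key : wave a = dt M k I (dt M k I a)
      - ra M k I * (dr M k I (ra M k I) * dr M k I a + ra M k I * dr M k I (dr M k I a)
        + dr M k I (ra M k I) * (rb M k I * dt M k I a)
        + ra M k I * (dr M k I (rb M k I) * dt M k I a + rb M k I * dr M k I (dt M k I a))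
        + rb M k I * (ra M k I * (dr M k I (dt M k I a) + rb M k I * dt M k I (dt M k I a))))
      + rw M k I * ((sphere M k I).lap 2 a - rq M k I * a) := by
    have hta : dt M k I (ra M k I) = 0 := dt_ofR _ _
    have htb : dt M k I (rb M k I) = 0 := dt_ofR _ _
    simp only [wave, dx_apply, map_add, Derivation.leibniz, smul_eq_mul, hta, htb, dt_dr]
    ring
  rw [key]
  simp only [ra, rb, rw, rq, dr_ofR_eq]
  repeat' first
    | assumption
    | exact lap_two_mem_spinSpace h0
    | apply Submodule.add_mem
    | apply Submodule.sub_mem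
    | apply ofR_mul_mem_spinSpace

/-- Λ and T commute with the wave operator, so Λ annihilates `wave g`. -/
theorem wave_inverse_eq_zero {F : Pt → ℂ} (hF : IsSmoothSpin M k I 2 F)
    {f g : SmoothFn (region M k I)} (hg : Rep F g) (hf : wave f = 0)
    (h : (sphere M k I).lapLap 2 g = dt M k I f) : wave g = 0 := by
  refine eq_zero_of_lapLap_eq_zero (wave_mem_spinSpace hF hg) ?_
  rw [lapLap_wave, h, ← dt_wave, hf, map_zero]

theorem wave_eq_zero_of_reggeWheeler {f : Pt → ℂ} {a : SmoothFn (region M k I)} (ha : Rep f a)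
    (h : ∀ p ∈ region M k I, reggeWheeler M k 2 (region M k I) f p = 0) : wave a = 0 := by
  have h1 : wave a = (dt M k I (dt M k I a - dx M k I a) + dx M k I (dt M k I a - dx M k I a))
      + rw M k I * ((sphere M k I).lap 2 a - rq M k I * a) := by
    rw [wave, map_sub, map_sub, dt_dx]
    ring
  rw [h1]
  refine ext_on fun p hp => ?_
  have h2 := h p hp
  rw [reggeWheeler, ha.opLbar.opL p hp, ha.angL 2 p hp, ha p hp] at h2
  rw [add_apply _ _ hp, mul_apply _ _ hp, sub_apply _ _ hp, mul_apply _ _ hp, rw, rq,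
    ofR_apply _ _ hp, ofR_apply _ _ hp, zero_apply, wt, pow_one]
  linear_combination -h2

/-! ### The Teukolsky-Starobinsky identities -/

section
variable (M k I)

/-- `w⁻¹ L`. -/
def wL : SmoothFn (region M k I) →ₗ[ℂ] SmoothFn (region M k I) :=
  LinearMap.mulLeft ℂ (rv M k I) ∘ₗ ((dt M k I).toLinearMap + (dx M k I).toLinearMap)

/-- `w⁻¹ L̲`. -/
def wLbar : SmoothFn (region M k I) →ₗ[ℂ] SmoothFn (region M k I) :=
  LinearMap.mulLeft ℂ (rv M k I) ∘ₗ ((dt M k I).toLinearMap - (dx M k I).toLinearMap)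

theorem wL_angularLinear : (sphere M k I).AngularLinear (wL M k I) :=
  (rv_angularLinear M k I).comp (dt_angularLinear.add dx_angularLinear)

theorem wLbar_angularLinear : (sphere M k I).AngularLinear (wLbar M k I) :=
  (rv_angularLinear M k I).comp (dt_angularLinear.sub dx_angularLinear)

variable {M k I}

theorem wL_apply (f : SmoothFn (region M k I)) :
    wL M k I f = rv M k I * (dt M k I f + dx M k I f) := rfl

theorem wLbar_apply (f : SmoothFn (region M k I)) :
    wLbar M k I f = rv M k I * (dt M k I f - dx M k I f) := rfl

theorem conj_ofR (g : ℝ → ℝ) (hg : ContDiffOn ℝ ∞ g (Set.Ioi (rPlus M k))) :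
    conj (ofR M k I g hg) = ofR M k I g hg := conj_ofCoord _ _ _

theorem conj_dx (f : SmoothFn (region M k I)) : conj (dx M k I f) = dx M k I (conj f) := by
  have ha : conj (ra M k I) = ra M k I := conj_ofR _ _
  have hb : conj (rb M k I) = rb M k I := conj_ofR _ _
  have h1 : conj (dr M k I f) = dr M k I (conj f) := conj_pd _ _
  rw [dx_apply, dx_apply, map_mul, map_add, map_mul, ha, hb, h1, dt_conj]

theorem conj_wL (f : SmoothFn (region M k I)) : conj (wL M k I f) = wL M k I (conj f) := by
  have hv : conj (rv M k I) = rv M k I := conj_ofR _ _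
  rw [wL_apply, wL_apply, map_mul, map_add, hv, conj_dx, dt_conj]

theorem conj_wLbar (f : SmoothFn (region M k I)) :
    conj (wLbar M k I f) = wLbar M k I (conj f) := by
  have hv : conj (rv M k I) = rv M k I := conj_ofR _ _
  rw [wLbar_apply, wLbar_apply, map_mul, map_sub, hv, conj_dx, dt_conj]

theorem dt_wL (f : SmoothFn (region M k I)) : dt M k I (wL M k I f) = wL M k I (dt M k I f) := by
  have hv : dt M k I (rv M k I) = 0 := dt_ofR _ _
  simp only [wL_apply, map_add, Derivation.leibniz, smul_eq_mul, hv, dt_dx]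
  ring

theorem dt_wLbar (f : SmoothFn (region M k I)) :
    dt M k I (wLbar M k I f) = wLbar M k I (dt M k I f) := by
  have hv : dt M k I (rv M k I) = 0 := dt_ofR _ _
  simp only [wLbar_apply, map_sub, Derivation.leibniz, smul_eq_mul, hv, dt_dx]
  ring

theorem wL_wL_inversion {f : SmoothFn (region M k I)} (hf : wave f = 0) :
    wL M k I (wL M k I (rw M k I ^ 2 * wLbar M k I (wLbar M k I f)))
      = (sphere M k I).lapLap 2 f + 2 * rc M k I * dt M k I f :=
  chandrasekhar_inversion (dt M k I) (dx M k I) ((sphere M k I).lap 2) (rw M k I) (rv M k I)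
    (ru M k I) (rq M k I) (rc M k I) rw_mul_rv dt_dx (dt_ofR _ _) (dt_ofR _ _) (dt_ofR _ _)
    (dt_ofR _ _) (Derivation.map_algebraMap _ _) dx_rw dx_ru dx_rq (Derivation.map_algebraMap _ _)
    rc_mul_ru (fun x => (dt_angularLinear.lap 2 x).symm) (fun x => (dx_angularLinear.lap 2 x).symm)
    (fun x => ((rw_angularLinear M k I).lap 2 x).symm)
    (fun x => ((rq_angularLinear M k I).lap 2 x).symm) f (eq_neg_of_add_eq_zero_left hf)

/-- Reversing ∂_{r⋆} exchanges L and L̲. The relations among `w`, `u`, `q`, `c` persist once `u` and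
`c` change sign, and the sign of `c` reverses the term 12M ∂_t. -/
theorem wLbar_wLbar_inversion {f : SmoothFn (region M k I)} (hf : wave f = 0) :
    wLbar M k I (wLbar M k I (rw M k I ^ 2 * wL M k I (wL M k I f)))
      = (sphere M k I).lapLap 2 f - 2 * rc M k I * dt M k I f := by
  have h := chandrasekhar_inversion (dt M k I) (-dx M k I) ((sphere M k I).lap 2) (rw M k I)
    (rv M k I) (-ru M k I) (rq M k I) (-rc M k I) rw_mul_rv
    (fun x => by simp [dt_dx]) (dt_ofR _ _) (dt_ofR _ _)
    (by rw [map_neg, neg_eq_zero]; exact dt_ofR _ _)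
    (dt_ofR _ _) (by rw [map_neg, neg_eq_zero]; exact Derivation.map_algebraMap _ _)
    (by rw [Derivation.neg_apply, dx_rw]; ring) (by simp [dx_ru])
    (by rw [Derivation.neg_apply, dx_rq]; ring)
    (by rw [map_neg, neg_eq_zero]; simp [rc, Derivation.map_algebraMap])
    (by rw [← rc_mul_ru]; ring) (fun x => (dt_angularLinear.lap 2 x).symm)
    (fun x => by
      have := (dx_angularLinear (M := M) (k := k) (I := I)).lap 2 x
      simp only [Derivation.neg_apply, map_neg]
      exact congrArg Neg.neg this.symm)
    (fun x => ((rw_angularLinear M k I).lap 2 x).symm)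
    (fun x => ((rq_angularLinear M k I).lap 2 x).symm) f
    (by simpa using eq_neg_of_add_eq_zero_left hf)
  simp only [Derivation.neg_apply, ← sub_eq_add_neg, sub_neg_eq_add] at h
  simp only [wL_apply, wLbar_apply]
  rw [h, SphereCalc.lapLap]
  ring

end

end SmoothFn
-- From conjugation symmetry to the Teukolsky-Starobinsky identities
namespace SmoothFn

variable {M k : ℝ} {I : Set ℝ} [Exterior M k I]

theorem const_angularLinear (c : ℂ) :
    (sphere M k I).AngularLinear (LinearMap.mulLeft ℂ (algebraMap ℂ (SmoothFn (region M k I)) c)) :=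
  .mulLeft (Derivation.map_algebraMap _ _) (Derivation.map_algebraMap _ _)

theorem edConj_const_mul (c : ℝ) (f : SmoothFn (region M k I)) :
    (sphere M k I).edConj conj (algebraMap ℂ _ (c : ℂ) * f)
      = algebraMap ℂ _ (c : ℂ) * (sphere M k I).edConj conj f :=
  ((const_angularLinear (M := M) (k := k) (I := I) (c : ℂ)).edConj (fun x => by
    simp only [LinearMap.mulLeft_apply, map_mul, conj_algebraMap, Complex.conj_ofReal]) f).symm

theorem lapLap_const_mul (s : ℤ) (c : ℂ) (f : SmoothFn (region M k I)) :
    (sphere M k I).lapLap s (algebraMap ℂ _ c * f)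
      = algebraMap ℂ _ c * (sphere M k I).lapLap s f :=
  ((const_angularLinear c).lapLap s f).symm

theorem dt_const_mul (c : ℂ) (f : SmoothFn (region M k I)) :
    dt M k I (algebraMap ℂ _ c * f) = algebraMap ℂ _ c * dt M k I f :=
  SphereCalc.linear_algebraMap_mul (dt M k I).toLinearMap c f

theorem dt_lapLap (s : ℤ) (f : SmoothFn (region M k I)) :
    dt M k I ((sphere M k I).lapLap s f) = (sphere M k I).lapLap s (dt M k I f) :=
  dt_angularLinear.lapLap s f

theorem dt_edConj (f : SmoothFn (region M k I)) :
    dt M k I ((sphere M k I).edConj conj f) = (sphere M k I).edConj conj (dt M k I f) :=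
  (dt_angularLinear (M := M) (k := k) (I := I)).edConj (cj := conj) dt_conj f

/-- The algebraic part of a Teukolsky-Starobinsky identity. Here `P` and `Q` are `w⁻¹L` and `w⁻¹L̲`
or vice versa. -/
theorem starobinsky_identity {P Q : SmoothFn (region M k I) →ₗ[ℂ] SmoothFn (region M k I)}
    (hP : (sphere M k I).AngularLinear P) (hPc : ∀ f, P (conj f) = conj (P f))
    (hPt : ∀ f, dt M k I (P f) = P (dt M k I f)) (c : ℝ)
    (hPQ : ∀ f, wave f = 0 → P (P (rw M k I ^ 2 * Q (Q f)))
      = (sphere M k I).lapLap 2 f + algebraMap ℂ _ (c : ℂ) * dt M k I f)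
    {Φ Ψ : SmoothFn (region M k I)} (hΦ : wave Φ = 0)
    (h : (sphere M k I).lapLap 2 Φ - algebraMap ℂ _ (c : ℂ) * dt M k I Φ
      = (sphere M k I).edConj conj Ψ - algebraMap ℂ _ (c : ℂ) * dt M k I Ψ) :
    rw M k I ^ 2 * P (P (P (P (rw M k I ^ 2 * Q (Q ((sphere M k I).lapLap 2 Φ
        - algebraMap ℂ _ (c : ℂ) * dt M k I Φ))))))
      = (sphere M k I).edConj conj (rw M k I ^ 2 * P (P ((sphere M k I).lapLap 2 Ψ
          + algebraMap ℂ _ (c : ℂ) * dt M k I Ψ)))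
        - algebraMap ℂ _ (c : ℂ) * dt M k I (rw M k I ^ 2 * P (P ((sphere M k I).lapLap 2 Ψ
          + algebraMap ℂ _ (c : ℂ) * dt M k I Ψ))) := by
  set κ : SmoothFn (region M k I) := algebraMap ℂ _ (c : ℂ) with hκ
  have hKP : ∀ x, (sphere M k I).edConj conj (P x) = P ((sphere M k I).edConj conj x) :=
    fun x => (hP.edConj hPc x).symm
  have hKw : ∀ x, (sphere M k I).edConj conj (rw M k I * x)
      = rw M k I * (sphere M k I).edConj conj x := fun x =>
    ((rw_angularLinear M k I).edConj (fun y => by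
      have hw : conj (rw M k I) = rw M k I := conj_ofR _ _
      simp only [LinearMap.mulLeft_apply, map_mul, hw]) x).symm
  have hw : dt M k I (rw M k I) = 0 := dt_ofR _ _
  have hTw : ∀ x, dt M k I (rw M k I ^ 2 * x) = rw M k I ^ 2 * dt M k I x := fun x => by
    simp only [pow_two, Derivation.leibniz, smul_eq_mul, hw, mul_zero, add_zero]
  -- The inversion is applied to (Λ - κ T) Φ, which is again a Regge-Wheeler solution because Λ and
  -- T commute with the wave operator.
  have hwave : wave ((sphere M k I).lapLap 2 Φ - κ * dt M k I Φ) = 0 := by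
    rw [sub_eq_add_neg, wave_add, wave_neg, wave_algebraMap_mul, ← dt_wave, ← lapLap_wave, hΦ,
      map_zero, mul_zero, neg_zero, add_zero, SphereCalc.lapLap, map_zero, mul_zero, sub_zero,
      map_zero]
  have hK : ∀ x, (sphere M k I).edConj conj (rw M k I ^ 2 * P (P x))
      = rw M k I ^ 2 * P (P ((sphere M k I).edConj conj x)) := fun x => by
    rw [pow_two, mul_assoc, hKw, hKw, hKP, hKP, mul_assoc]
  -- (Λ + κ T)(Λ - κ T) Φ = (Λ + κ T)(K - κ T) Ψ = (K - κ T)(Λ + κ T) Ψ. Moving κ through the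
  -- antilinear K requires κ to be real.
  have key : (sphere M k I).lapLap 2 ((sphere M k I).lapLap 2 Φ - κ * dt M k I Φ)
      + κ * dt M k I ((sphere M k I).lapLap 2 Φ - κ * dt M k I Φ)
      = (sphere M k I).edConj conj ((sphere M k I).lapLap 2 Ψ + κ * dt M k I Ψ)
        - κ * dt M k I ((sphere M k I).lapLap 2 Ψ + κ * dt M k I Ψ) := by
    rw [h, SphereCalc.lapLap_sub, lapLap_const_mul, map_sub, dt_const_mul, SphereCalc.edConj_add,
      edConj_const_mul, map_add, dt_const_mul, ← (sphere_isConj M k I).lapLap_edConj, dt_lapLap,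
      dt_edConj]
    ring
  rw [hPQ _ hwave, key, hK, hTw, hPt, hPt, map_sub, map_sub, SphereCalc.linear_algebraMap_mul,
    SphereCalc.linear_algebraMap_mul]
  ring

section
variable {f : Pt → ℂ} {a : SmoothFn (region M k I)}

/-- The operator Λ + 12M T is pulled inside the two factors w⁻¹L, so that it acts directly on the
Regge-Wheeler solution. -/
theorem Rep.revChandraPlus (h : Rep f a) : Rep (RWTS.revChandraPlus M k (region M k I) f)
    (rw M k I ^ 2 * wL M k I (wL M k I ((sphere M k I).lapLap 2 a
      + algebraMap ℂ _ ((12 * M : ℝ) : ℂ) * dt M k I a))) := by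
  have h2 : Rep _ (wL M k I (wL M k I a)) := h.winvL.winvL
  have e : wL M k I (wL M k I ((sphere M k I).lapLap 2 a
      + algebraMap ℂ _ ((12 * M : ℝ) : ℂ) * dt M k I a))
      = (sphere M k I).lapLap 2 (wL M k I (wL M k I a))
        + algebraMap ℂ _ ((12 * M : ℝ) : ℂ) * dt M k I (wL M k I (wL M k I a)) := by
    rw [map_add, map_add, SphereCalc.linear_algebraMap_mul, SphereCalc.linear_algebraMap_mul, dt_wL,
      dt_wL, (wL_angularLinear M k I).lapLap, (wL_angularLinear M k I).lapLap]
  intro p hp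
  rw [e, mul_apply _ _ hp, add_apply _ _ hp, mul_apply _ _ hp, algebraMap_apply _ hp,
    ← h2.angLL 2 p hp, ← h2.dT p hp, pow_apply _ _ hp, rw, ofR_apply _ _ hp, RWTS.revChandraPlus]
  push_cast
  rfl

/-- Conjugation exchanges 𝓛^{[-2]} with 𝓛^{[+2]}, so the spin -2 side can be handled entirely on
spin weight +2. -/
theorem Rep.conj_revChandraMinus (h : Rep f a) :
    Rep (RWTS.conjF (RWTS.revChandraMinus M k (region M k I) (RWTS.conjF f)))
    (rw M k I ^ 2 * wLbar M k I (wLbar M k I ((sphere M k I).lapLap 2 a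
      - algebraMap ℂ _ ((12 * M : ℝ) : ℂ) * dt M k I a))) := by
  have h2 : Rep _ (wLbar M k I (wLbar M k I (conj a))) := h.conjF.winvLbar.winvLbar
  have e : rw M k I ^ 2 * wLbar M k I (wLbar M k I ((sphere M k I).lapLap 2 a
      - algebraMap ℂ _ ((12 * M : ℝ) : ℂ) * dt M k I a))
      = conj (rw M k I ^ 2 * ((sphere M k I).lapLap (-2) (wLbar M k I (wLbar M k I (conj a)))
        - algebraMap ℂ _ ((12 * M : ℝ) : ℂ) * dt M k I (wLbar M k I (wLbar M k I (conj a))))) := by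
    have hw : conj (rw M k I) = rw M k I := conj_ofR _ _
    rw [map_mul, map_pow, hw, map_sub conj, map_mul conj, (sphere_isConj M k I).lapLap,
      conj_algebraMap, Complex.conj_ofReal, ← dt_conj, conj_wLbar, conj_wLbar, conj_conj, neg_neg,
      map_sub, map_sub, SphereCalc.linear_algebraMap_mul, SphereCalc.linear_algebraMap_mul,
      dt_wLbar, dt_wLbar, (wLbar_angularLinear M k I).lapLap, (wLbar_angularLinear M k I).lapLap]
  rw [e]
  refine Rep.conjF fun p hp => ?_
  rw [mul_apply _ _ hp, sub_apply _ _ hp, mul_apply _ _ hp, algebraMap_apply _ hp,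
    ← h2.angLL (-2) p hp, ← h2.dT p hp, pow_apply _ _ hp, rw, ofR_apply _ _ hp,
    RWTS.revChandraMinus]
  push_cast
  rfl

end

/-- The Teukolsky-Starobinsky identities for the reverse Chandrasekhar transformations of functions
with the right conjugation symmetry. -/
theorem teukolskyStarobinsky_of_symmetry {ψ φ : Pt → ℂ} {Ψ Φ : SmoothFn (region M k I)}
    (hψ : Rep ψ Ψ) (hφ : Rep φ Φ) (wΨ : wave Ψ = 0) (wΦ : wave Φ = 0)
    (h1 : (sphere M k I).edConj conj Ψ - (sphere M k I).lapLap 2 Φ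
      = algebraMap ℂ _ ((12 * M : ℝ) : ℂ) * (dt M k I Ψ - dt M k I Φ))
    (h2 : (sphere M k I).edConj conj Φ - (sphere M k I).lapLap 2 Ψ
      = algebraMap ℂ _ ((12 * M : ℝ) : ℂ) * (dt M k I Ψ - dt M k I Φ)) :
    TeukolskyStarobinsky M k (region M k I) (RWTS.revChandraPlus M k (region M k I) ψ)
      (RWTS.revChandraMinus M k (region M k I) (RWTS.conjF φ)) := by
  have hc : (2 : SmoothFn (region M k I)) * rc M k I
      = algebraMap ℂ _ ((12 * M : ℝ) : ℂ) := by
    have h12 : ((12 * M : ℝ) : ℂ) = 2 * (6 * (M : ℂ)) := by push_cast; ring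
    rw [h12, map_mul, map_ofNat, rc]
  have hp := hψ.revChandraPlus
  have hm := hφ.conj_revChandraMinus
  have id1 := starobinsky_identity (P := wL M k I) (Q := wLbar M k I) (wL_angularLinear M k I)
    (fun f => (conj_wL f).symm) dt_wL (12 * M)
    (fun f hf => by rw [wL_wL_inversion hf, hc]) wΦ (Ψ := Ψ) (by linear_combination -h1)
  -- The mirrored case: the roles of L, L̲ and of Ψ, Φ are exchanged, and `c` changes sign as in
  -- `wLbar_wLbar_inversion`.
  have id2 := starobinsky_identity (P := wLbar M k I) (Q := wL M k I) (wLbar_angularLinear M k I)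
    (fun f => (conj_wLbar f).symm) dt_wLbar (-(12 * M))
    (fun f hf => by
      rw [wLbar_wLbar_inversion hf, hc, Complex.ofReal_neg, map_neg]
      ring)
    wΨ (Ψ := Φ) (by rw [Complex.ofReal_neg, map_neg]; linear_combination -h2)
  have neg_sub : ∀ x y : SmoothFn (region M k I), x - algebraMap ℂ _ ((-(12 * M) : ℝ) : ℂ) * y
      = x + algebraMap ℂ _ ((12 * M : ℝ) : ℂ) * y := fun x y => by
    rw [Complex.ofReal_neg, map_neg]
    ring
  have neg_add : ∀ x y : SmoothFn (region M k I), x + algebraMap ℂ _ ((-(12 * M) : ℝ) : ℂ) * y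
      = x - algebraMap ℂ _ ((12 * M : ℝ) : ℂ) * y := fun x y => by
    rw [Complex.ofReal_neg, map_neg]
    ring
  simp only [neg_sub, neg_add] at id2
  generalize rw M k I ^ 2 * wL M k I (wL M k I ((sphere M k I).lapLap 2 Ψ
    + algebraMap ℂ _ ((12 * M : ℝ) : ℂ) * dt M k I Ψ)) = α at hp id1 id2
  generalize rw M k I ^ 2 * wLbar M k I (wLbar M k I ((sphere M k I).lapLap 2 Φ
    - algebraMap ℂ _ ((12 * M : ℝ) : ℂ) * dt M k I Φ)) = β at hm id1 id2
  have hwa : ∀ {p}, p ∈ region M k I → ((wt M k p.2.1 ^ 2 : ℝ) : ℂ) = (rw M k I ^ 2 : SmoothFn _) p :=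
    fun hp => by rw [pow_apply _ _ hp, rw, ofR_apply _ _ hp]; push_cast; rfl
  have hm' : Rep (RWTS.revChandraMinus M k (region M k I) (RWTS.conjF φ)) (conj β) := by
    intro p hp
    rw [conj_apply _ hp, ← hm p hp, RWTS.conjF, Complex.conj_conj]
  intro p hpD
  constructor
  · have l : Rep ((winvL M k (region M k I))^[4] _) (wL M k I (wL M k I (wL M k I (wL M k I β)))) :=
      hm.winvL.winvL.winvL.winvL
    have r1 : Rep _ ((sphere M k I).edConj conj α) := (((hp.conjF.edth 2).edth 1).edth 0).edth (-1)
    rw [l p hpD, r1 p hpD, hp.dT p hpD, hwa hpD, ← mul_apply _ _ hpD, id1, sub_apply _ _ hpD,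
      mul_apply _ _ hpD, algebraMap_apply _ hpD]
    push_cast
    rfl
  · have l : Rep ((winvLbar M k (region M k I))^[4] _)
        (wLbar M k I (wLbar M k I (wLbar M k I (wLbar M k I (conj α))))) :=
      hp.conjF.winvLbar.winvLbar.winvLbar.winvLbar
    have r1 : Rep _ ((sphere M k I).dg (-1) ((sphere M k I).dg 0
        ((sphere M k I).dg 1 ((sphere M k I).dg 2 β)))) :=
      (((hm.edthDag 2).edthDag 1).edthDag 0).edthDag (-1)
    have hw : conj (rw M k I) = rw M k I := conj_ofR _ _
    -- `id2` concerns (α̃^{[-2]})^* on spin weight +2; its conjugate is the second identity, with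
    -- 𝓛_n turned into 𝓛_n^†.
    have id2' := congrArg conj id2
    rw [map_mul, map_pow, hw, conj_wLbar, conj_wLbar, conj_wLbar, conj_wLbar, map_add conj,
      map_mul conj, conj_algebraMap, Complex.conj_ofReal, ← dt_conj, SphereCalc.edConj,
      (sphere_isConj M k I).ed, (sphere_isConj M k I).ed, (sphere_isConj M k I).ed,
      (sphere_isConj M k I).ed, conj_conj] at id2'
    rw [l p hpD, r1 p hpD, hm'.dT p hpD, hwa hpD, ← mul_apply _ _ hpD, id2', add_apply _ _ hpD,
      mul_apply _ _ hpD, algebraMap_apply _ hpD]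
    push_cast
    rfl

/-- With K Ψ^D = -Λ Ψ^D, K Ψ^R = Λ Ψ^R and K G = -Λ G, the terms of KΨ - ΛΦ in Ψ^D and Ψ^R cancel.
The two G-terms are equal and add up to 12M Λ G = 12M T Ψ^D, while Ψ - Φ = Ψ^D. The correction -12M
G is what makes the two sides balance. -/
theorem teukolskyStarobinsky_of_decoupled {ΨD ΨR G : Pt → ℂ}
    (hsol : IsDecoupledRWSolution M k I ΨD ΨR)
    (hG : IsInverseLL M k I (RWTS.dT (region M k I) ΨD) G)
    (hD : SymPartVanishes M k I ΨD) (hR : AntiPartVanishes M k I ΨR) :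
    TeukolskyStarobinsky M k (region M k I)
      (RWTS.revChandraPlus M k (region M k I) (psiPlus M ΨD ΨR G))
      (RWTS.revChandraMinus M k (region M k I) (psiMinus M ΨD ΨR G)) := by
  obtain ⟨d, rd⟩ : ∃ d : SmoothFn (region M k I), Rep ΨD d := ⟨_, rep_ofFun ΨD hsol.spinD.smooth⟩
  obtain ⟨e, re⟩ : ∃ e : SmoothFn (region M k I), Rep ΨR e := ⟨_, rep_ofFun ΨR hsol.spinR.smooth⟩
  obtain ⟨g, rg⟩ : ∃ g : SmoothFn (region M k I), Rep G g := ⟨_, rep_ofFun G hG.1.smooth⟩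
  have sd : d ∈ _ := mem_spinSpace_of_isSmoothSpin hsol.spinD rd 0 0
  have se : e ∈ _ := mem_spinSpace_of_isSmoothSpin hsol.spinR re 0 0
  have sg : g ∈ _ := mem_spinSpace_of_isSmoothSpin hG.1 rg 0 0
  have Λg : (sphere M k I).lapLap 2 g = dt M k I d := ext_on fun p hp => by
    rw [← rg.angLL 2 p hp, hG.2 p hp, rd.dT p hp]
  have wd : wave d = 0 := wave_eq_zero_of_reggeWheeler rd hsol.eqD
  have we : wave e = 0 := wave_eq_zero_of_reggeWheeler re hsol.eqR
  have wg : wave g = 0 := wave_inverse_eq_zero hG.1 rg wd Λg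
  have Kd := edConj_eq_neg_of_symPartVanishes rd sd hD
  have Ke := edConj_eq_of_antiPartVanishes re se hR
  have Kg := edConj_inverse_eq_neg sg Kd Λg
  set η : SmoothFn (region M k I) := algebraMap ℂ _ ((1 / 2 : ℝ) : ℂ) with hη
  set κ : SmoothFn (region M k I) := algebraMap ℂ _ ((12 * M : ℝ) : ℂ) with hκ
  have h2η : 2 * η = 1 := by
    rw [hη, ← map_ofNat (algebraMap ℂ (SmoothFn (region M k I))) 2, ← map_mul]
    norm_num
  have rψ : Rep (psiPlus M ΨD ΨR G) (η * d + η * (e - κ * g)) := fun p hp => by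
    simp only [add_apply _ _ hp, mul_apply _ _ hp, sub_apply _ _ hp, hη, hκ, algebraMap_apply _ hp,
      ← rd p hp, ← re p hp, ← rg p hp, psiPlus]
    push_cast
    ring
  have rφ : Rep (fun p => -(1 / 2) * ΨD p + 1 / 2 * (ΨR p - 12 * (M : ℂ) * G p))
      (-(η * d) + η * (e - κ * g)) := fun p hp => by
    simp only [add_apply _ _ hp, neg_apply _ hp, mul_apply _ _ hp, sub_apply _ _ hp, hη, hκ,
      algebraMap_apply _ hp, ← rd p hp, ← re p hp, ← rg p hp]
    push_cast
    ring
  refine teukolskyStarobinsky_of_symmetry rψ rφ ?_ ?_ ?_ ?_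
  · rw [wave_add, wave_algebraMap_mul, wave_algebraMap_mul, sub_eq_add_neg, wave_add, wave_neg,
      wave_algebraMap_mul, wd, we, wg]
    ring
  · rw [wave_add, wave_neg, wave_algebraMap_mul, wave_algebraMap_mul, sub_eq_add_neg e, wave_add,
      wave_neg, wave_algebraMap_mul, wd, we, wg]
    ring
  · simp only [SphereCalc.edConj_add, SphereCalc.edConj_sub, SphereCalc.lapLap_add,
      SphereCalc.lapLap_sub, SphereCalc.lapLap_neg, hη, hκ, edConj_const_mul, lapLap_const_mul,
      map_add, map_sub, map_neg, dt_const_mul, Kd, Ke, Kg, Λg]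
    ring
  · simp only [SphereCalc.edConj_add, SphereCalc.edConj_sub, SphereCalc.edConj_neg,
      SphereCalc.lapLap_add, SphereCalc.lapLap_sub, hη, hκ, edConj_const_mul, lapLap_const_mul,
      map_add, map_sub, map_neg, dt_const_mul, Kd, Ke, Kg, Λg]
    ring

end SmoothFn
end RWTS

end

theorem corollary2p14 (M k : ℝ) (hM : 0 < M) (hk : 0 < k)
    (I : Set ℝ) (hI : I = Set.univ ∨ ∃ t₀ : ℝ, I = Set.Ici t₀)
    (ΨD ΨR : RWTS.Pt → ℂ)
    (hsol : RWTS.IsDecoupledRWSolution M k I ΨD ΨR)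
    (G : RWTS.Pt → ℂ)
    (hG : RWTS.IsInverseLL M k I (RWTS.dT (RWTS.region M k I) ΨD) G)
    (hD : RWTS.SymPartVanishes M k I ΨD)
    (hR : RWTS.AntiPartVanishes M k I ΨR) :
    RWTS.TeukolskyStarobinsky M k (RWTS.region M k I)
      (RWTS.revChandraPlus M k (RWTS.region M k I) (RWTS.psiPlus M ΨD ΨR G))
      (RWTS.revChandraMinus M k (RWTS.region M k I) (RWTS.psiMinus M ΨD ΨR G)) := by
  have ext : RWTS.Exterior M k I := ⟨hM, hk, hI⟩
  exact RWTS.SmoothFn.teukolskyStarobinsky_of_decoupled hsol hG hD hR
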